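/- Let $n\ge 1$. An $n$-weighted tournament $T=(V,w)$ consists of a finite set $V$ of $m$ alternatives and weights $w(x,y)\in\{0,\dots,n\}$ with $w(x,y)+w(y,x)=n$ for all $x\ne y$. The Borda score of $x$ is $\sum_{z\ne x}w(x,z)$, and the Borda winners are the alternatives of maximum Borda score. A reversal function is a map $R:V\times V\to\{-n,\dots,n\}$ with $R(x,y)=-R(y,x)$ and $0\le w(x,y)+R(x,y)\le n$; its size is $\sum_{R(y,z)>0}R(y,z)$, and $T^R$ is the tournament with weights $w+R$. For an alternative $d$ that is not a Borda winner of $T$, $R$ is a wCRS for $d$ if $d$ is a Borda winner of $T^R$, and $\mathrm{MoV}(d,T)=-\min\{\mathrm{size}(R): R \text{ is a wCRS for } d\}$. **Theorem.** (1) The margin of victory of Borda non-winners can be computed in polynomial time. That is, there are a program of a random-access machine (integer cells; addition, subtraction, indirect addressing, sign tests; logarithmic cost) and a polynomial $p$ such that for every $n\ge1$, every $n$-weighted tournament $T$ on $V=\{0,\dots,m-1\}$ and every $d\in V$ that is not a Borda winner of $T$, the program, given $m$, $n$, $d$ and the weight matrix $w$, halts at cost at most $p(m+\beta(n))$, where $\beta(n)$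 is the number of binary digits of $n$, and outputs $\mathrm{MoV}(d,T)$ together with a wCRS for $d$ of minimum size. (2) For every $n$-weighted tournament $T=(V,w)$, every Borda non-winner $d$ and every target score $l\in\mathbb N$, finding a minimum-size wCRS $R$ for $d$ such that $d$ has Borda score $l$ in $T^R$ reduces to an integral minimum-cost $b$-flow problem in the following four-layer network $G_{d,l}$. The nodes are a source $s$, the unordered pairs of distinct alternatives, the alternatives, and a sink $t$. The edges are: from $s$ to each pair, with capacity $n$ and cost $0$; for all $x\ne y$, from the pair $\{x,y\}$ to $x$, a green edge with capacity $w(x,y)$ and cost $0$ and a red edge with capacity $w(y,x)$ and cost $1$; from each alternative $x\ne d$ to $t$, with capacity $l$ and cost $0$. With $N=n\binom m2$, the balances (outflow minus inflow) are $b(s)=N$, $b(d)=-l$, $b(t)=l-N$, and $0$ at all other nodes. Precisely: for every integral $b$-flow $f$ that has minimum cost among the integral $b$-flows of $G_{d,l}$, putting $R(x,y)=f(\mathrm{red}(\{x,y\},x))-f(\mathrm{red}(\{x,y\},y))$ for $x\neq y$ and $R(x,x)=0$ defines a wCRS for $d$ which has minimum size among those that give $d$ score $l$, and the size of $R$ equals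 the cost of $f$; conversely, every wCRS for $d$ of minimum size among those that give $d$ score $l$ arises in this way from an integral $b$-flow of minimum cost. -/

import Mathlib

/-! ## Weighted tournaments, reversal functions and the margin of victory -/

/-- An `n`-weighted tournament on the set `V` of alternatives: weights in `{0, …, n}` with
`w x y + w y x = n` for distinct `x`, `y` (the diagonal values play no role). -/
structure WeightedTournament (V : Type*) (n : ℕ) where
  w : V → V → ℕ
  w_le : ∀ x y, w x y ≤ n
  w_add : ∀ x y, x ≠ y → w x y + w y x = n

/-- A reversal function for `T`. Its values lie in `{-n, …, n}`, because both `w x y` and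
`w x y + R x y` lie in `{0, …, n}`. -/
structure Reversal {V : Type*} {n : ℕ} (T : WeightedTournament V n) where
  val : V → V → ℤ
  antisymm : ∀ x y, val x y = -val y x
  nonneg : ∀ x y, 0 ≤ (T.w x y : ℤ) + val x y
  le : ∀ x y, (T.w x y : ℤ) + val x y ≤ n

namespace WeightedTournament

variable {V : Type*} {n : ℕ}

/-- The tournament `T^R` with weights `w x y + R x y`. -/
def reverse (T : WeightedTournament V n) (R : Reversal T) : WeightedTournament V n where
  w x y := ((T.w x y : ℤ) + R.val x y).toNat
  w_le x y := by
    have h := R.le x y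
    omega
  w_add x y hxy := by
    have h1 := R.nonneg x y
    have h2 := R.nonneg y x
    have h3 := R.antisymm x y
    have h4 := T.w_add x y hxy
    omega

/-- The Borda score of `x`: its weighted outdegree. -/
def bordaScore [Fintype V] [DecidableEq V] (T : WeightedTournament V n) (x : V) : ℕ :=
  ∑ z ∈ Finset.univ.erase x, T.w x z

/-- The Borda winners: the alternatives of maximum Borda score. -/
def bordaWinners [Fintype V] [DecidableEq V] (T : WeightedTournament V n) : Set V :=
  {x | ∀ y, T.bordaScore y ≤ T.bordaScore x}

end WeightedTournament

namespace Reversal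

variable {V : Type*} {n : ℕ} {T : WeightedTournament V n}

/-- The size of a reversal function: the sum of its positive values. -/
def size [Fintype V] (R : Reversal T) : ℤ :=
  ∑ p : V × V with 0 < R.val p.1 p.2, R.val p.1 p.2

/-- Weighted destructive reversal set for the winner `a` under the tournament solution `S`. -/
def IsWDRS (S : WeightedTournament V n → Set V) (a : V) (R : Reversal T) : Prop :=
  a ∈ S T ∧ a ∉ S (T.reverse R)

/-- Weighted constructive reversal set for the non-winner `d` under the tournament solution `S`. -/
def IsWCRS (S : WeightedTournament V n → Set V) (d : V) (R : Reversal T) : Prop :=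
  d ∉ S T ∧ d ∈ S (T.reverse R)

/-- `R` has minimum size among the reversal functions satisfying `P`. -/
def IsMinimum [Fintype V] (P : Reversal T → Prop) (R : Reversal T) : Prop :=
  P R ∧ ∀ R' : Reversal T, P R' → R.size ≤ R'.size

end Reversal

open Classical in
/-- The margin of victory of an alternative under the tournament solution `S`. -/
noncomputable def marginOfVictory {V : Type*} [Fintype V] {n : ℕ}
    (S : WeightedTournament V n → Set V) (T : WeightedTournament V n) (a : V) : ℤ :=
  if a ∈ S T then sInf {k : ℤ | ∃ R : Reversal T, R.IsWDRS S a ∧ R.size = k}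
  else -sInf {k : ℤ | ∃ R : Reversal T, R.IsWCRS S a ∧ R.size = k}

/-! ## Random-access programs with logarithmic cost -/

/-- A memory: integer cells, addressed by the integers. -/
abbrev Memory : Type := ℤ → ℤ

/-- Programs of a random-access machine whose arithmetic is addition and subtraction. The
arguments written into a program are constants; `load` and `store` address indirectly. -/
inductive Program : Type
  /-- `M[i] := c` -/
  | const (i c : ℤ)
  /-- `M[i] := M[j] + M[k]` -/
  | add (i j k : ℤ)
  /-- `M[i] := M[j] - M[k]` -/
  | sub (i j k : ℤ)
  /-- `M[i] := M[M[j]]` -/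
  | load (i j : ℤ)
  /-- `M[M[i]] := M[j]` -/
  | store (i j : ℤ)
  /-- first `P`, then `Q` -/
  | seq (P Q : Program)
  /-- if `M[i] > 0` then `P` else `Q` -/
  | ite (i : ℤ) (P Q : Program)
  /-- while `M[i] > 0` do `P` -/
  | loop (i : ℤ) (P : Program)

/-- The number of binary digits of `|z|`. -/
def bitLength (z : ℤ) : ℕ := z.natAbs.size

/-- `Exec P μ ν t`: started on the memory `μ`, the program `P` halts with memory `ν`, and the run
costs `t`. Cost is logarithmic: every elementary instruction and every test costs one plus the
bit lengths of all the numbers (contents and computed addresses) that it handles. -/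
inductive Exec : Program → Memory → Memory → ℕ → Prop
  | const (i c : ℤ) (μ : Memory) :
      Exec (.const i c) μ (Function.update μ i c) (1 + bitLength c)
  | add (i j k : ℤ) (μ : Memory) :
      Exec (.add i j k) μ (Function.update μ i (μ j + μ k))
        (1 + bitLength (μ j) + bitLength (μ k))
  | sub (i j k : ℤ) (μ : Memory) :
      Exec (.sub i j k) μ (Function.update μ i (μ j - μ k))
        (1 + bitLength (μ j) + bitLength (μ k))
  | load (i j : ℤ) (μ : Memory) :
      Exec (.load i j) μ (Function.update μ i (μ (μ j)))
        (1 + bitLength (μ j) + bitLength (μ (μ j)))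
  | store (i j : ℤ) (μ : Memory) :
      Exec (.store i j) μ (Function.update μ (μ i) (μ j))
        (1 + bitLength (μ i) + bitLength (μ j))
  | seq {P Q : Program} {μ ν ρ : Memory} {s t : ℕ} :
      Exec P μ ν s → Exec Q ν ρ t → Exec (.seq P Q) μ ρ (s + t)
  | ite_pos {i : ℤ} {P Q : Program} {μ ν : Memory} {t : ℕ} :
      0 < μ i → Exec P μ ν t → Exec (.ite i P Q) μ ν (1 + bitLength (μ i) + t)
  | ite_neg {i : ℤ} {P Q : Program} {μ ν : Memory} {t : ℕ} :
      ¬ 0 < μ i → Exec Q μ ν t → Exec (.ite i P Q) μ ν (1 + bitLength (μ i) + t)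
  | loop_pos {i : ℤ} {P : Program} {μ ν ρ : Memory} {s t : ℕ} :
      0 < μ i → Exec P μ ν s → Exec (.loop i P) ν ρ t →
        Exec (.loop i P) μ ρ (1 + bitLength (μ i) + s + t)
  | loop_neg {i : ℤ} {P : Program} {μ : Memory} :
      ¬ 0 < μ i → Exec (.loop i P) μ μ (1 + bitLength (μ i))

/-- The input memory for a tournament `T` on `{0, …, m - 1}` and an alternative `d`: cells `0`, `1`,
`2` hold `m`, `n`, `d`, the next `m * m` cells hold the weight matrix row by row, and all other
cells hold `0`. -/
def inputMemory {m n : ℕ} (T : WeightedTournament (Fin m) n) (d : Fin m) : Memory := fun a =>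
  if a = 0 then (m : ℤ) else if a = 1 then (n : ℤ) else if a = 2 then ((d : ℕ) : ℤ)
  else ∑ x : Fin m, ∑ y : Fin m,
    if a = 3 + ((x : ℕ) : ℤ) * m + ((y : ℕ) : ℤ) then (T.w x y : ℤ) else 0

/-! ## Flow networks, and the network of a tournament, an alternative and a target score -/

/-- A flow network with integral data; multiple edges are allowed. -/
structure FlowNetwork (N E : Type*) where
  tail : E → N
  head : E → N
  capacity : E → ℕ
  cost : E → ℤ
  balance : N → ℤ

namespace FlowNetwork

variable {N E : Type*} [Fintype E] [DecidableEq N] (G : FlowNetwork N E)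

/-- Integral `b`-flows: outflow minus inflow is the balance, at every node. -/
def IsFlow (f : E → ℕ) : Prop :=
  (∀ e, f e ≤ G.capacity e) ∧
    ∀ v, ((∑ e with G.tail e = v, (f e : ℤ)) - ∑ e with G.head e = v, (f e : ℤ)) = G.balance v

/-- The cost of a flow. -/
def flowCost (f : E → ℕ) : ℤ := ∑ e, (f e : ℤ) * G.cost e

/-- Minimum-cost integral `b`-flows. -/
def IsMinCostFlow (f : E → ℕ) : Prop :=
  G.IsFlow f ∧ ∀ g, G.IsFlow g → G.flowCost f ≤ G.flowCost g

end FlowNetwork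

/-- Unordered pairs of distinct alternatives, that is, the edges of the tournament. -/
abbrev UPair (V : Type*) : Type _ := {e : Sym2 V // ¬ e.IsDiag}

/-- Ordered pairs of distinct alternatives. -/
abbrev OPair (V : Type*) : Type _ := {p : V × V // p.1 ≠ p.2}

/-- The edge of the tournament between the members of an ordered pair. -/
def OPair.toUPair {V : Type*} (p : OPair V) : UPair V :=
  ⟨s(p.1.1, p.1.2), fun h => p.2 (Sym2.mk_isDiag_iff.mp h)⟩

/-- The nodes, in four layers: the source, the edges of the tournament, the alternatives and the
sink. -/
inductive BordaNode (V : Type*) : Type _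
  | source
  | pair (e : UPair V)
  | alt (x : V)
  | sink
  deriving DecidableEq

/-- The edges: source to pairs, green edges and red edges (those indexed by `(x, y)` lead from the
pair `{x, y}` to `x`), and alternatives other than `d` to the sink. -/
abbrev BordaEdge {V : Type*} (d : V) : Type _ :=
  UPair V ⊕ OPair V ⊕ OPair V ⊕ {x : V // x ≠ d}

/-- The network for the tournament `T`, the alternative `d` and the target score `l`. -/
def bordaNetwork {V : Type*} [Fintype V] [DecidableEq V] {n : ℕ} (T : WeightedTournament V n)
    (d : V) (l : ℕ) : FlowNetwork (BordaNode V) (BordaEdge d) where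
  tail
    | .inl _ => .source
    | .inr (.inl p) => .pair p.toUPair
    | .inr (.inr (.inl p)) => .pair p.toUPair
    | .inr (.inr (.inr x)) => .alt x.1
  head
    | .inl e => .pair e
    | .inr (.inl p) => .alt p.1.1
    | .inr (.inr (.inl p)) => .alt p.1.1
    | .inr (.inr (.inr _)) => .sink
  capacity
    | .inl _ => n
    | .inr (.inl p) => T.w p.1.1 p.1.2
    | .inr (.inr (.inl p)) => T.w p.1.2 p.1.1
    | .inr (.inr (.inr _)) => l
  cost
    | .inl _ => 0
    | .inr (.inl _) => 0
    | .inr (.inr (.inl _)) => 1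
    | .inr (.inr (.inr _)) => 0
  balance
    | .source => (n : ℤ) * (Fintype.card V).choose 2
    | .pair _ => 0
    | .alt x => if x = d then -(l : ℤ) else 0
    | .sink => (l : ℤ) - (n : ℤ) * (Fintype.card V).choose 2

/-- The reversal function `R` is read off the flow `f`: `R x y` is the flow on the red edge from
`{x, y}` to `x` minus the flow on the red edge from `{x, y}` to `y`. -/
def Reversal.IsReadOff {V : Type*} {n : ℕ} {T : WeightedTournament V n} {d : V}
    (R : Reversal T) (f : BordaEdge d → ℕ) : Prop :=
  ∀ (x y : V) (h : x ≠ y), R.val x y =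
    (f (.inr (.inr (.inl ⟨(x, y), h⟩))) : ℤ) - (f (.inr (.inr (.inl ⟨(y, x), h.symm⟩))) : ℤ)

/-! The algorithm. Add a terminal node `m` to the alternatives and encode a reversal function `R`
together with a target score `l` as an antisymmetric matrix `X` on `K = m + 1` nodes: `X x y` is `R
x y`, and `X m x` is the excess of the new score of `x` over `l`. For fixed `l` the inflows `colSum`
are prescribed, and a reversed unit costs 1. That `d` wins is priced, not imposed: every unit by
which some `x ≠ d` exceeds `l`, or by which `d` falls short of `l`, costs 2. Thus every `l` has an
obvious feasible start, with no reversal at all. The penalty is exact: by `Reversal.exists_winner` a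
deficit of `g` can be repaired by `g` unit reversals, cheaper than the `2 * g` paid for it, so a
cheapest `X` over all `l` makes `d` a winner and its cost is the size of `R`.

For fixed `l` the cost is separable and convex, and capacity scaling finds an optimum
(`solveCode_spec`). With step length `D`, a power of two, Bellman–Ford (`IsTable`) looks for a cycle
of negative residual cost `resCost`; pushing `D` along it lowers the cost by at least `D`
(`pushSeq_cycle`). If there is none, the distances are potentials with differences at most `2 * K`,
and weak duality with an error term (`cost_gap`) puts the cost within `G * (D - 1)` of the optimum,
where `G = (m + 1) ^ 2 * (m + 3)`. The next phase, with half the step, therefore starts within `2 *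
G` steps of the optimum, and `K ^ 5` cancellations suffice. At `D = 1` the error vanishes.

The same inequality compares different scores: the final potentials give a subgradient of the
optimum cost as a function of `l` (`Sol.cost_le`), and bisection on its sign finds the best score
(`searchCode_spec`).

The program is written in a language whose loops are bounded by unassigned registers; `Cm.code_spec`
compiles it with polynomially many unit steps. Without multiplication a number gains at most one bit
per step, so the logarithmic cost is polynomial as well (`UExec.exec`).

The network. The balance of the source saturates its edges, so the flows that `x` and `y` receive
from the pair `{x, y}` add up to `n` and are the weights of a new tournament. The balance of `d` and
the capacities towards the sink say that `d` wins it with score `l`. Green edges carry at most the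
old weights, so the red flow dominates the positive part of the resulting `R`, and the size is at
most the cost (`size_toReversal_le`); conversely `ofReversal` turns `R` into a flow whose red part
is exactly the positive part of `R`. Hence the minima agree, and equality of the sums forces
equality on every red edge, which is the read-off formula. -/

/-! ## Unit-cost runs -/

/-- `UExec P μ ν k`: started on `μ`, the program `P` halts with memory `ν` after `k` unit steps. -/
inductive UExec : Program → Memory → Memory → ℕ → Prop
  | const (i c : ℤ) (μ : Memory) : UExec (.const i c) μ (Function.update μ i c) 1
  | add (i j k : ℤ) (μ : Memory) : UExec (.add i j k) μ (Function.update μ i (μ j + μ k)) 1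
  | sub (i j k : ℤ) (μ : Memory) : UExec (.sub i j k) μ (Function.update μ i (μ j - μ k)) 1
  | load (i j : ℤ) (μ : Memory) : UExec (.load i j) μ (Function.update μ i (μ (μ j))) 1
  | store (i j : ℤ) (μ : Memory) : UExec (.store i j) μ (Function.update μ (μ i) (μ j)) 1
  | seq {P Q : Program} {μ ν ρ : Memory} {s t : ℕ} :
      UExec P μ ν s → UExec Q ν ρ t → UExec (.seq P Q) μ ρ (s + t)
  | ite_pos {i : ℤ} {P Q : Program} {μ ν : Memory} {t : ℕ} :
      0 < μ i → UExec P μ ν t → UExec (.ite i P Q) μ ν (1 + t)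
  | ite_neg {i : ℤ} {P Q : Program} {μ ν : Memory} {t : ℕ} :
      ¬ 0 < μ i → UExec Q μ ν t → UExec (.ite i P Q) μ ν (1 + t)
  | loop_pos {i : ℤ} {P : Program} {μ ν ρ : Memory} {s t : ℕ} :
      0 < μ i → UExec P μ ν s → UExec (.loop i P) ν ρ t → UExec (.loop i P) μ ρ (1 + s + t)
  | loop_neg {i : ℤ} {P : Program} {μ : Memory} : ¬ 0 < μ i → UExec (.loop i P) μ μ 1

/-- A bound for the constants that are assigned by a program. -/
def Program.constBound : Program → ℕ
  | .const _ c => c.natAbs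
  | .seq P Q => P.constBound + Q.constBound
  | .ite _ P Q => P.constBound + Q.constBound
  | .loop _ P => P.constBound
  | _ => 0

theorem bitLength_le_of_abs_le {z : ℤ} {B : ℕ} (h : |z| ≤ 2 ^ B) : bitLength z ≤ B + 1 := by
  unfold bitLength
  rw [Nat.size_le]
  have h1 : (z.natAbs : ℤ) ≤ ((2 ^ B : ℕ) : ℤ) := by rw [Int.natCast_natAbs]; exact_mod_cast h
  have h2 : z.natAbs ≤ 2 ^ B := by exact_mod_cast h1
  have h3 : 0 < 2 ^ B := by positivity
  rw [pow_succ]; omega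

theorem Memory.update_le {μ : Memory} {B : ℕ} (h : ∀ a, |μ a| ≤ 2 ^ B) {i z : ℤ}
    (hz : |z| ≤ 2 ^ (B + 1)) (a : ℤ) : |Function.update μ i z a| ≤ 2 ^ (B + 1) := by
  rcases eq_or_ne a i with rfl | hne
  · simpa using hz
  · rw [Function.update_of_ne hne]
    exact (h a).trans (pow_le_pow_right₀ (by norm_num) (by omega))

/-- Without multiplication, numbers at most double in every step, so that the logarithmic cost is
polynomial in the unit cost. -/
theorem UExec.exec {P : Program} {μ ν : Memory} {k : ℕ} (h : UExec P μ ν k) :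
    ∀ B : ℕ, P.constBound ≤ 2 ^ B → (∀ a, |μ a| ≤ 2 ^ B) →
      (∀ a, |ν a| ≤ 2 ^ (B + k)) ∧ ∃ t, Exec P μ ν t ∧ t ≤ k * (3 + 2 * (B + k)) := by
  have mono : ∀ {z : ℤ} {B C : ℕ}, B ≤ C → |z| ≤ 2 ^ B → |z| ≤ 2 ^ C := fun hBC hz =>
    hz.trans (pow_le_pow_right₀ (by norm_num) hBC)
  induction h with
  | const i c μ =>
    intro B hc hμ
    have hc' : |c| ≤ 2 ^ B := by
      rw [← Int.natCast_natAbs]; exact_mod_cast hc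
    have := bitLength_le_of_abs_le hc'
    exact ⟨Memory.update_le hμ (mono (by omega) hc'), _, .const i c μ, by omega⟩
  | add i j k μ =>
    intro B _ hμ
    have h1 := bitLength_le_of_abs_le (hμ j)
    have h2 := bitLength_le_of_abs_le (hμ k)
    refine ⟨Memory.update_le hμ ?_, _, .add i j k μ, by omega⟩
    have := abs_add_le (μ j) (μ k)
    have h3 := hμ j
    have h4 := hμ k
    rw [pow_succ]; linarith
  | sub i j k μ =>
    intro B _ hμ
    have h1 := bitLength_le_of_abs_le (hμ j)
    have h2 := bitLength_le_of_abs_le (hμ k)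
    refine ⟨Memory.update_le hμ ?_, _, .sub i j k μ, by omega⟩
    have := abs_sub (μ j) (μ k)
    have h3 := hμ j
    have h4 := hμ k
    rw [pow_succ]; linarith
  | load i j μ =>
    intro B _ hμ
    have h1 := bitLength_le_of_abs_le (hμ j)
    have h2 := bitLength_le_of_abs_le (hμ (μ j))
    exact ⟨Memory.update_le hμ (mono (by omega) (hμ _)), _, .load i j μ, by omega⟩
  | store i j μ =>
    intro B _ hμ
    have h1 := bitLength_le_of_abs_le (hμ i)
    have h2 := bitLength_le_of_abs_le (hμ j)
    exact ⟨Memory.update_le hμ (mono (by omega) (hμ _)), _, .store i j μ, by omega⟩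
  | @seq P Q μ ν ρ s t _ _ ih1 ih2 =>
    intro B hc hμ
    simp only [Program.constBound] at hc
    obtain ⟨hν, t1, e1, b1⟩ := ih1 B (by omega) hμ
    -- The second program starts on what the first one left, where numbers may be `s` bits longer.
    obtain ⟨hρ, t2, e2, b2⟩ := ih2 (B + s)
      (by have := Nat.pow_le_pow_right (n := 2) (by norm_num) (show B ≤ B + s by omega); omega) hν
    refine ⟨fun a => by rw [← add_assoc]; exact hρ a, _, .seq e1 e2, ?_⟩
    nlinarith
  | @ite_pos i P Q μ ν t hp _ ih =>
    intro B hc hμ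
    simp only [Program.constBound] at hc
    obtain ⟨hν, t1, e1, b1⟩ := ih B (by omega) hμ
    have h1 := bitLength_le_of_abs_le (hμ i)
    exact ⟨fun a => mono (by omega) (hν a), _, .ite_pos hp e1, by nlinarith⟩
  | @ite_neg i P Q μ ν t hp _ ih =>
    intro B hc hμ
    simp only [Program.constBound] at hc
    obtain ⟨hν, t1, e1, b1⟩ := ih B (by omega) hμ
    have h1 := bitLength_le_of_abs_le (hμ i)
    exact ⟨fun a => mono (by omega) (hν a), _, .ite_neg hp e1, by nlinarith⟩
  | @loop_pos i P μ ν ρ s t hp _ _ ih1 ih2 =>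
    intro B hc hμ
    simp only [Program.constBound] at hc ih2
    obtain ⟨hν, t1, e1, b1⟩ := ih1 B (by omega) hμ
    obtain ⟨hρ, t2, e2, b2⟩ := ih2 (B + s)
      (by have := Nat.pow_le_pow_right (n := 2) (by norm_num) (show B ≤ B + s by omega); omega) hν
    have h1 := bitLength_le_of_abs_le (hμ i)
    refine ⟨fun a => mono (by omega) (hρ a), _, .loop_pos hp e1 e2, ?_⟩
    nlinarith
  | @loop_neg i P μ hp =>
    intro B hc hμ
    have h1 := bitLength_le_of_abs_le (hμ i)
    exact ⟨fun a => mono (by omega) (hμ a), _, .loop_neg hp, by nlinarith⟩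

/-! ## A language of bounded loops over registers and arrays -/

/-- States: integer registers, and arrays of integers. -/
structure St where
  reg : ℕ → ℤ
  arr : ℕ → ℕ → ℤ

namespace St

/-- Assign to a register. -/
def setR (s : St) (i : ℕ) (z : ℤ) : St := ⟨Function.update s.reg i z, s.arr⟩

/-- Assign to an array entry. -/
def setA (s : St) (a i : ℕ) (z : ℤ) : St :=
  ⟨s.reg, Function.update s.arr a (Function.update (s.arr a) i z)⟩

@[simp] theorem setR_reg (s : St) (i j : ℕ) (z : ℤ) :
    (s.setR i z).reg j = if j = i then z else s.reg j := by
  simp [setR, Function.update_apply]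

@[simp] theorem setR_arr (s : St) (i : ℕ) (z : ℤ) : (s.setR i z).arr = s.arr := rfl

@[simp] theorem setA_reg (s : St) (a i : ℕ) (z : ℤ) : (s.setA a i z).reg = s.reg := rfl

@[simp] theorem setA_arr (s : St) (a i b j : ℕ) (z : ℤ) :
    (s.setA a i z).arr b j = if b = a ∧ j = i then z else s.arr b j := by
  by_cases h : b = a
  · subst h; simp [setA, Function.update_apply]
  · simp [setA, h]

end St

/-- Expressions. Array indices are truncated at `0`. -/
inductive Ex : Type
  | c (z : ℤ)
  | r (i : ℕ)
  | add (e f : Ex)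
  | sub (e f : Ex)
  | rd (a : ℕ) (e : Ex)

/-- Values of expressions. -/
def Ex.ev : Ex → St → ℤ
  | .c z, _ => z
  | .r i, s => s.reg i
  | .add e f, s => e.ev s + f.ev s
  | .sub e f, s => e.ev s - f.ev s
  | .rd a e, s => s.arr a (e.ev s).toNat

/-- Commands. -/
inductive Cm : Type
  | skip
  | set (i : ℕ) (e : Ex)
  | wr (a : ℕ) (e f : Ex)
  | seq (S T : Cm)
  | ite (e : Ex) (S T : Cm)
  | rep (i : ℕ) (S : Cm)

/-- The effect of a command; `rep i S` runs `S` as often as register `i` says at the start. -/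
def Cm.ev : Cm → St → St
  | .skip, s => s
  | .set i e, s => s.setR i (e.ev s)
  | .wr a e f, s => s.setA a (e.ev s).toNat (f.ev s)
  | .seq S T, s => T.ev (S.ev s)
  | .ite e S T, s => if 0 < e.ev s then S.ev s else T.ev s
  | .rep i S, s => S.ev^[(s.reg i).toNat] s

/-- Is the register assigned by the command? -/
def Cm.modR : Cm → ℕ → Bool
  | .skip, _ => false
  | .set i _, j => i == j
  | .wr _ _ _, _ => false
  | .seq S T, j => S.modR j || T.modR j
  | .ite _ S T, j => S.modR j || T.modR j
  | .rep _ S, j => S.modR j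

/-- Is the array assigned by the command? -/
def Cm.modA : Cm → ℕ → Bool
  | .skip, _ => false
  | .set _ _, _ => false
  | .wr a _ _, b => a == b
  | .seq S T, j => S.modA j || T.modA j
  | .ite _ S T, j => S.modA j || T.modA j
  | .rep _ S, j => S.modA j

theorem Cm.ev_reg (S : Cm) (j : ℕ) (h : S.modR j = false) (s : St) :
    (S.ev s).reg j = s.reg j := by
  induction S generalizing s with
  | skip => rfl
  | set i e =>
    have : j ≠ i := by rintro rfl; simp [Cm.modR] at h
    simp [Cm.ev, this]
  | wr a e f => rfl
  | seq S T ihS ihT =>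
    simp only [Cm.modR, Bool.or_eq_false_iff] at h
    simp only [Cm.ev]; rw [ihT h.2, ihS h.1]
  | ite e S T ihS ihT =>
    simp only [Cm.modR, Bool.or_eq_false_iff] at h
    simp only [Cm.ev]; split
    · exact ihS h.1 s
    · exact ihT h.2 s
  | rep i S ih =>
    simp only [Cm.ev]
    generalize (s.reg i).toNat = k
    induction k generalizing s with
    | zero => rfl
    | succ k ihk => rw [Function.iterate_succ_apply, ihk, ih h]

theorem Cm.ev_arr (S : Cm) (a : ℕ) (h : S.modA a = false) (s : St) :
    (S.ev s).arr a = s.arr a := by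
  induction S generalizing s with
  | skip => rfl
  | set i e => rfl
  | wr b e f =>
    have : a ≠ b := by rintro rfl; simp [Cm.modA] at h
    funext j
    simp [Cm.ev, this]
  | seq S T ihS ihT =>
    simp only [Cm.modA, Bool.or_eq_false_iff] at h
    simp only [Cm.ev]; rw [ihT h.2, ihS h.1]
  | ite e S T ihS ihT =>
    simp only [Cm.modA, Bool.or_eq_false_iff] at h
    simp only [Cm.ev]; split
    · exact ihS h.1 s
    · exact ihT h.2 s
  | rep i S ih =>
    simp only [Cm.ev]
    generalize (s.reg i).toNat = k
    induction k generalizing s with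
    | zero => rfl
    | succ k ihk => rw [Function.iterate_succ_apply, ihk, ih h]

/-! ## Compilation -/

/-- The cell of a temporary. -/
def tmpCell (d : ℕ) : ℤ := -(16 * d + 15)

/-- The cell of a register. -/
def regCell (i : ℕ) : ℤ := -(16 * i + 14)

/-- The cell of an array entry; array `0` consists of the cells `0, 1, 2, …`. -/
def arrCell (a i : ℕ) : ℤ := if a = 0 then i else -(16 * i + a)

/-- The memory represents the state. -/
def Represents (μ : Memory) (s : St) : Prop :=
  (∀ i, μ (regCell i) = s.reg i) ∧ ∀ a < 14, ∀ i, μ (arrCell a i) = s.arr a i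

/-- The memories agree outside the temporaries from `d` on. -/
def AgreeBelow (d : ℕ) (μ ν : Memory) : Prop := ∀ x, (∀ k, d ≤ k → x ≠ tmpCell k) → ν x = μ x

/-- The negative cells are split by residues modulo 16: offset 15 for temporaries, 14 for registers,
and `a` for the arrays `1 ≤ a < 14`. Array `0` owns the nonnegative cells. -/
theorem regCell_ne_tmpCell (i k : ℕ) : regCell i ≠ tmpCell k := by
  unfold regCell tmpCell; omega

theorem arrCell_ne_tmpCell {a : ℕ} (ha : a < 14) (i k : ℕ) : arrCell a i ≠ tmpCell k := by
  unfold arrCell tmpCell; split <;> omega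

theorem arrCell_ne_regCell {a : ℕ} (ha : a < 14) (i k : ℕ) : arrCell a i ≠ regCell k := by
  unfold arrCell regCell; split <;> omega

theorem tmpCell_inj {j k : ℕ} : tmpCell j = tmpCell k ↔ j = k := by
  unfold tmpCell; omega

theorem regCell_inj {j k : ℕ} : regCell j = regCell k ↔ j = k := by
  unfold regCell; omega

theorem arrCell_inj {a b i j : ℕ} (ha : a < 14) (hb : b < 14) :
    arrCell a i = arrCell b j ↔ a = b ∧ i = j := by
  unfold arrCell; split <;> split <;> omega

namespace AgreeBelow

theorem trans {d : ℕ} {μ ν ρ : Memory} (h : AgreeBelow d μ ν) (h' : AgreeBelow d ν ρ) :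
    AgreeBelow d μ ρ := fun x hx => (h' x hx).trans (h x hx)

theorem mono {d e : ℕ} {μ ν : Memory} (h : AgreeBelow e μ ν) (hde : d ≤ e) : AgreeBelow d μ ν :=
  fun x hx => h x fun k hk => hx k (hde.trans hk)

theorem update {d e : ℕ} {μ : Memory} (hde : d ≤ e) (z : ℤ) :
    AgreeBelow d μ (Function.update μ (tmpCell e) z) := fun _ hx =>
  Function.update_of_ne (hx e hde) _ _

theorem represents {d : ℕ} {μ ν : Memory} (h : AgreeBelow d μ ν) {s : St} (hs : Represents μ s) :
    Represents ν s :=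
  ⟨fun i => (h _ fun k _ => regCell_ne_tmpCell i k).trans (hs.1 i),
    fun a ha i => (h _ fun k _ => arrCell_ne_tmpCell ha i k).trans (hs.2 a ha i)⟩

theorem tmp {d k : ℕ} {μ ν : Memory} (h : AgreeBelow d μ ν) (hk : k < d) :
    ν (tmpCell k) = μ (tmpCell k) :=
  h _ fun j hj => by rw [Ne, tmpCell_inj]; omega

end AgreeBelow

/-- Replace the index in temporary `d` by the cell of the entry of array `a` at this index. -/
def addrCode (a d : ℕ) : Program :=
  .seq (.ite (tmpCell d) (.const (tmpCell (d + 1)) 0) (.const (tmpCell d) 0))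
    (if a = 0 then .const (tmpCell (d + 1)) 0 else
      .seq (.add (tmpCell d) (tmpCell d) (tmpCell d)) <|
      .seq (.add (tmpCell d) (tmpCell d) (tmpCell d)) <|
      .seq (.add (tmpCell d) (tmpCell d) (tmpCell d)) <|
      .seq (.add (tmpCell d) (tmpCell d) (tmpCell d)) <|
      .seq (.const (tmpCell (d + 1)) (-a)) (.sub (tmpCell d) (tmpCell (d + 1)) (tmpCell d)))

/-- The initial test truncates negative indices, as `Int.toNat` does in `Ex.ev`. Four doublings then
multiply by 16, the stride of the arrays other than array `0`. -/
theorem addrCode_spec (a d : ℕ) (μ : Memory) :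
    ∃ ν k, UExec (addrCode a d) μ ν k ∧ k ≤ 8 ∧ ν (tmpCell d) = arrCell a (μ (tmpCell d)).toNat ∧
      AgreeBelow d μ ν := by
  have hne : tmpCell d ≠ tmpCell (d + 1) := by rw [Ne, tmpCell_inj]; omega
  obtain ⟨ν₁, h1, e1, a1⟩ : ∃ ν, UExec (.ite (tmpCell d) (.const (tmpCell (d + 1)) 0)
      (.const (tmpCell d) 0)) μ ν 2 ∧ ν (tmpCell d) = ((μ (tmpCell d)).toNat : ℤ) ∧
      AgreeBelow d μ ν := by
    by_cases h : 0 < μ (tmpCell d)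
    · refine ⟨_, .ite_pos h (.const _ _ _), ?_, .update (by omega) _⟩
      rw [Function.update_of_ne hne]; omega
    · refine ⟨_, .ite_neg h (.const _ _ _), ?_, .update le_rfl _⟩
      rw [Function.update_self]; omega
  unfold addrCode
  by_cases ha : a = 0
  · rw [if_pos ha]
    refine ⟨_, _, .seq h1 (.const _ _ _), by omega, ?_, a1.trans (.update (by omega) _)⟩
    rw [Function.update_of_ne hne, e1, arrCell, if_pos ha]
  · rw [if_neg ha]
    refine ⟨_, _, .seq h1 (.seq (.add _ _ _ _) (.seq (.add _ _ _ _) (.seq (.add _ _ _ _)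
      (.seq (.add _ _ _ _) (.seq (.const _ _ _) (.sub _ _ _ _)))))), by omega, ?_, ?_⟩
    · simp [Function.update_of_ne hne, e1, arrCell, ha]
      ring
    · exact a1.trans <| (AgreeBelow.update le_rfl _).trans <| (AgreeBelow.update le_rfl _).trans <|
        (AgreeBelow.update le_rfl _).trans <| (AgreeBelow.update le_rfl _).trans <|
        (AgreeBelow.update (by omega) _).trans (AgreeBelow.update le_rfl _)

/-- Code for an expression, with the value in temporary `d`. -/
def Ex.code : Ex → ℕ → Program
  | .c z, d => .const (tmpCell d) z
  | .r i, d => .seq (.const (tmpCell (d + 1)) 0) (.add (tmpCell d) (regCell i) (tmpCell (d + 1)))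
  | .add e f, d => .seq (e.code d) (.seq (f.code (d + 1))
      (.add (tmpCell d) (tmpCell d) (tmpCell (d + 1))))
  | .sub e f, d => .seq (e.code d) (.seq (f.code (d + 1))
      (.sub (tmpCell d) (tmpCell d) (tmpCell (d + 1))))
  | .rd a e, d => .seq (e.code d) (.seq (addrCode a d) (.load (tmpCell d) (tmpCell d)))

/-- A bound for the unit cost of an expression. -/
def Ex.steps : Ex → ℕ
  | .c _ => 1
  | .r _ => 2
  | .add e f => e.steps + f.steps + 1
  | .sub e f => e.steps + f.steps + 1
  | .rd _ e => e.steps + 9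

/-- Only arrays with numbers below `14` occur. -/
def Ex.wf : Ex → Bool
  | .c _ => true
  | .r _ => true
  | .add e f => e.wf && f.wf
  | .sub e f => e.wf && f.wf
  | .rd a e => decide (a < 14) && e.wf

/-- The temporaries form a stack: a second operand is evaluated from `d + 1` on, so the first value
survives in temporary `d`. -/
theorem Ex.code_spec (e : Ex) (he : e.wf = true) (s : St) (d : ℕ) (μ : Memory)
    (hμ : Represents μ s) :
    ∃ ν k, UExec (e.code d) μ ν k ∧ k ≤ e.steps ∧ ν (tmpCell d) = e.ev s ∧ AgreeBelow d μ ν := by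
  induction e generalizing d μ with
  | c z => exact ⟨_, _, .const _ _ _, le_rfl, by simp [Ex.ev], .update le_rfl _⟩
  | r i =>
    refine ⟨_, _, .seq (.const _ _ _) (.add _ _ _ _), le_rfl, ?_,
      (AgreeBelow.update (by omega) _).trans (.update le_rfl _)⟩
    simp [Ex.ev, Function.update_of_ne (regCell_ne_tmpCell i (d + 1)), hμ.1 i]
  | add e f ihe ihf =>
    simp only [Ex.wf, Bool.and_eq_true] at he
    obtain ⟨ν₁, k₁, h1, b1, v1, a1⟩ := ihe he.1 d μ hμ
    obtain ⟨ν₂, k₂, h2, b2, v2, a2⟩ := ihf he.2 (d + 1) ν₁ (a1.represents hμ)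
    refine ⟨_, _, .seq h1 (.seq h2 (.add _ _ _ _)), by simp only [Ex.steps]; omega, ?_,
      a1.trans ((a2.mono (by omega)).trans (.update le_rfl _))⟩
    simp [Ex.ev, a2.tmp (Nat.lt_succ_self d), v1, v2]
  | sub e f ihe ihf =>
    simp only [Ex.wf, Bool.and_eq_true] at he
    obtain ⟨ν₁, k₁, h1, b1, v1, a1⟩ := ihe he.1 d μ hμ
    obtain ⟨ν₂, k₂, h2, b2, v2, a2⟩ := ihf he.2 (d + 1) ν₁ (a1.represents hμ)
    refine ⟨_, _, .seq h1 (.seq h2 (.sub _ _ _ _)), by simp only [Ex.steps]; omega, ?_,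
      a1.trans ((a2.mono (by omega)).trans (.update le_rfl _))⟩
    simp [Ex.ev, a2.tmp (Nat.lt_succ_self d), v1, v2]
  | rd a e ih =>
    simp only [Ex.wf, Bool.and_eq_true, decide_eq_true_eq] at he
    obtain ⟨ν₁, k₁, h1, b1, v1, a1⟩ := ih he.2 d μ hμ
    obtain ⟨ν₂, k₂, h2, b2, v2, a2⟩ := addrCode_spec a d ν₁
    refine ⟨_, _, .seq h1 (.seq h2 (.load _ _ _)), by simp only [Ex.steps]; omega, ?_,
      a1.trans (a2.trans (.update le_rfl _))⟩
    have := (a2.represents (a1.represents hμ)).2 a he.1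
    simp [Ex.ev, v2, v1, this]

/-- Code for a command; the temporaries below `d` are not used. -/
def Cm.code : Cm → ℕ → Program
  | .skip, d => .const (tmpCell d) 0
  | .set i e, d => .seq (e.code d) (.seq (.const (tmpCell (d + 1)) 0)
      (.add (regCell i) (tmpCell d) (tmpCell (d + 1))))
  | .wr a e f, d => .seq (e.code d) (.seq (addrCode a d) (.seq (f.code (d + 1))
      (.store (tmpCell d) (tmpCell (d + 1)))))
  | .seq S T, d => .seq (S.code d) (T.code d)
  | .ite e S T, d => .seq (e.code d) (.ite (tmpCell d) (S.code d) (T.code d))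
  | .rep i S, d => .seq ((Ex.r i).code d) (.loop (tmpCell d) (.seq (S.code (d + 1))
      (.seq (.const (tmpCell (d + 1)) 1) (.sub (tmpCell d) (tmpCell d) (tmpCell (d + 1))))))

open Polynomial in
/-- A bound for the unit cost of a command, in terms of a bound for the numbers of repetitions. -/
noncomputable def Cm.steps : Cm → ℕ[X]
  | .skip => 1
  | .set _ e => C (e.steps + 2)
  | .wr _ e f => C (e.steps + f.steps + 9)
  | .seq S T => S.steps + T.steps
  | .ite e S T => C (e.steps + 1) + S.steps + T.steps
  | .rep _ S => 3 + X * (3 + S.steps)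

/-- The arrays have numbers below `14`, the registers in `l` are not assigned, and they hold all
numbers of repetitions. -/
def Cm.wf (l : List ℕ) : Cm → Bool
  | .skip => true
  | .set i e => !l.contains i && e.wf
  | .wr a e f => decide (a < 14) && e.wf && f.wf
  | .seq S T => S.wf l && T.wf l
  | .ite e S T => e.wf && S.wf l && T.wf l
  | .rep i S => l.contains i && S.wf l

theorem Cm.reg_of_wf {l : List ℕ} {S : Cm} (hS : S.wf l = true) {i : ℕ} (hi : i ∈ l) (s : St) :
    (S.ev s).reg i = s.reg i := by
  refine Cm.ev_reg S i ?_ s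
  induction S with
  | skip => rfl
  | set j e =>
    simp only [Cm.wf, Bool.and_eq_true, Bool.not_eq_true', List.contains_eq_mem,
      decide_eq_false_iff_not] at hS
    simp only [Cm.modR, beq_eq_false_iff_ne]
    rintro rfl; exact hS.1 hi
  | wr a e f => rfl
  | seq S T ihS ihT =>
    simp only [Cm.wf, Bool.and_eq_true] at hS
    simp [Cm.modR, ihS hS.1, ihT hS.2]
  | ite e S T ihS ihT =>
    simp only [Cm.wf, Bool.and_eq_true] at hS
    simp [Cm.modR, ihS hS.1.2, ihT hS.2]
  | rep j S ih =>
    simp only [Cm.wf, Bool.and_eq_true] at hS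
    simp [Cm.modR, ih hS.2]

/-- The registers in `l` are never assigned and hold all repetition counts, so the bound `N` on
their initial values stays valid inside nested loops. A loop counts down in a temporary of its own,
and its body is compiled from the next temporary on. -/
theorem Cm.code_spec (l : List ℕ) (N : ℕ) (S : Cm) (hS : S.wf l = true) (s : St)
    (hN : ∀ i ∈ l, s.reg i ≤ N) (d : ℕ) (μ : Memory) (hμ : Represents μ s) :
    ∃ ν k, UExec (S.code d) μ ν k ∧ k ≤ S.steps.eval N ∧ Represents ν (S.ev s) ∧
      ∀ j < d, ν (tmpCell j) = μ (tmpCell j) := by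
  induction S generalizing s d μ with
  | skip =>
    have := AgreeBelow.update (μ := μ) (le_refl d) 0
    exact ⟨_, _, .const _ _ _, by simp [Cm.steps], this.represents hμ, fun j hj => this.tmp hj⟩
  | set i e =>
    simp only [Cm.wf, Bool.and_eq_true] at hS
    obtain ⟨ν₁, k₁, h1, b1, v1, a1⟩ := e.code_spec hS.2 s d μ hμ
    have a2 := a1.trans (.update (show d ≤ d + 1 by omega) 0)
    have hr := a2.represents hμ
    have hne : tmpCell d ≠ tmpCell (d + 1) := by rw [Ne, tmpCell_inj]; omega
    refine ⟨_, _, .seq h1 (.seq (.const _ _ _) (.add _ _ _ _)), by simp [Cm.steps]; omega,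
      ⟨fun j => ?_, fun a ha j => ?_⟩, fun j hj => ?_⟩
    · by_cases hj : j = i
      · subst hj; simp [Cm.ev, Function.update_of_ne hne, v1]
      · rw [Function.update_of_ne (by rwa [Ne, regCell_inj]), hr.1]
        simp [Cm.ev, hj]
    · rw [Function.update_of_ne (arrCell_ne_regCell ha _ _), hr.2 a ha]
      simp [Cm.ev]
    · rw [Function.update_of_ne (regCell_ne_tmpCell _ _).symm, a2.tmp hj]
  | wr a e f =>
    simp only [Cm.wf, Bool.and_eq_true, decide_eq_true_eq] at hS
    obtain ⟨ν₁, k₁, h1, b1, v1, a1⟩ := e.code_spec hS.1.2 s d μ hμ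
    obtain ⟨ν₂, k₂, h2, b2, v2, a2⟩ := addrCode_spec a d ν₁
    obtain ⟨ν₃, k₃, h3, b3, v3, a3⟩ := f.code_spec hS.2 s (d + 1) ν₂
      (a2.represents (a1.represents hμ))
    have a4 := (a1.trans a2).trans (a3.mono (show d ≤ d + 1 by omega))
    have hr := a4.represents hμ
    have hd : ν₃ (tmpCell d) = arrCell a (e.ev s).toNat := by
      rw [a3.tmp (Nat.lt_succ_self d), v2, v1]
    refine ⟨_, _, .seq h1 (.seq h2 (.seq h3 (.store _ _ _))), by simp [Cm.steps]; omega,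
      ⟨fun j => ?_, fun b hb j => ?_⟩, fun j hj => ?_⟩
    · rw [hd, Function.update_of_ne (arrCell_ne_regCell hS.1.1 _ _).symm, hr.1]
      simp [Cm.ev]
    · simp only [hd, v3, Function.update_apply, hr.2 b hb, arrCell_inj hb hS.1.1]
      simp [Cm.ev]
    · rw [hd, Function.update_of_ne (arrCell_ne_tmpCell hS.1.1 _ _).symm, a4.tmp hj]
  | seq S T ihS ihT =>
    simp only [Cm.wf, Bool.and_eq_true] at hS
    obtain ⟨ν₁, k₁, h1, b1, r1, t1⟩ := ihS hS.1 s hN d μ hμ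
    obtain ⟨ν₂, k₂, h2, b2, r2, t2⟩ := ihT hS.2 (S.ev s)
      (fun i hi => by rw [Cm.reg_of_wf hS.1 hi]; exact hN i hi) d ν₁ r1
    exact ⟨_, _, .seq h1 h2, by simp [Cm.steps]; omega, r2,
      fun j hj => (t2 j hj).trans (t1 j hj)⟩
  | ite e S T ihS ihT =>
    simp only [Cm.wf, Bool.and_eq_true] at hS
    obtain ⟨ν₁, k₁, h1, b1, v1, a1⟩ := e.code_spec hS.1.1 s d μ hμ
    have hr := a1.represents hμ
    by_cases h : 0 < e.ev s
    · obtain ⟨ν₂, k₂, h2, b2, r2, t2⟩ := ihS hS.1.2 s hN d ν₁ hr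
      refine ⟨_, _, .seq h1 (.ite_pos (by rwa [v1]) h2), by simp [Cm.steps]; omega, ?_,
        fun j hj => (t2 j hj).trans (a1.tmp hj)⟩
      simpa [Cm.ev, h] using r2
    · obtain ⟨ν₂, k₂, h2, b2, r2, t2⟩ := ihT hS.2 s hN d ν₁ hr
      refine ⟨_, _, .seq h1 (.ite_neg (by rwa [v1]) h2), by simp [Cm.steps]; omega, ?_,
        fun j hj => (t2 j hj).trans (a1.tmp hj)⟩
      simpa [Cm.ev, h] using r2
  | rep i S ih =>
    simp only [Cm.wf, Bool.and_eq_true, List.contains_eq_mem, decide_eq_true_eq] at hS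
    obtain ⟨ν₁, k₁, h1, b1, v1, a1⟩ := (Ex.r i).code_spec rfl s d μ hμ
    -- Induction on the number of remaining rounds. The `3` counts the test, the loading of the
    -- constant `1` and the decrement.
    have key : ∀ (c : ℕ) (s : St) (ν : Memory) (z : ℤ), (∀ i ∈ l, s.reg i ≤ N) →
        Represents ν s → ν (tmpCell d) = z → z.toNat = c →
        ∃ ρ k, UExec (.loop (tmpCell d) (.seq (S.code (d + 1))
          (.seq (.const (tmpCell (d + 1)) 1) (.sub (tmpCell d) (tmpCell d) (tmpCell (d + 1))))))
          ν ρ k ∧ k ≤ 1 + c * (3 + S.steps.eval N) ∧ Represents ρ (S.ev^[c] s) ∧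
          ∀ j < d, ρ (tmpCell j) = ν (tmpCell j) := by
      intro c
      induction c with
      | zero =>
        intro s ν z _ hν hz hc
        exact ⟨ν, 1, .loop_neg (by rw [hz]; omega), by omega, hν, fun _ _ => rfl⟩
      | succ c ihc =>
        intro s ν z hl hν hz hc
        obtain ⟨ν₁, k₁, h1, b1, r1, t1⟩ := ih hS.2 s hl (d + 1) ν hν
        have hne : tmpCell d ≠ tmpCell (d + 1) := by rw [Ne, tmpCell_inj]; omega
        have ag := (AgreeBelow.update (μ := ν₁) (show d ≤ d + 1 by omega) 1).trans
          (.update le_rfl (ν₁ (tmpCell d) - 1))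
        obtain ⟨ρ, k₂, h2, b2, r2, t2⟩ := ihc (S.ev s) _ (z - 1)
          (fun i hi => by rw [Cm.reg_of_wf hS.2 hi]; exact hl i hi) (ag.represents r1)
          (by rw [Function.update_self, t1 d (by omega), hz]) (by omega)
        refine ⟨ρ, 1 + (k₁ + (1 + 1)) + k₂,
          .loop_pos (by rw [hz]; omega) (.seq h1 (.seq (.const _ _ _) (.sub _ _ _ _))) ?_, ?_,
          by rwa [Function.iterate_succ_apply], fun j hj => ?_⟩
        · simpa [Function.update_of_ne hne] using h2
        · nlinarith
        · rw [t2 j hj, ag.tmp hj, t1 j (by omega)]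
    obtain ⟨ρ, k₂, h2, b2, r2, t2⟩ := key (s.reg i).toNat s ν₁ _ hN (a1.represents hμ) v1 rfl
    refine ⟨ρ, _, .seq h1 h2, ?_, r2, fun j hj => (t2 j hj).trans (a1.tmp hj)⟩
    have h3 : (s.reg i).toNat ≤ N := by have := hN i hS.1; omega
    have h4 := Nat.mul_le_mul_right (3 + S.steps.eval N) h3
    simp only [Ex.steps] at b1
    simp [Cm.steps]
    omega

/-! ## Convex circulations: residual costs, potentials, pushing along cycles -/

namespace Circ

open Finset

/-- Antisymmetric on `{0, …, K - 1}`. -/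
def Anti (K : ℕ) (X : ℕ → ℕ → ℤ) : Prop := ∀ u < K, ∀ v < K, X u v = -X v u

/-- Bounded by the capacities. -/
def Within (K : ℕ) (U X : ℕ → ℕ → ℤ) : Prop := ∀ u < K, ∀ v < K, X u v ≤ U u v

/-- The cost: every unit of `X u v > 0` costs `p u v`. -/
def cost (K : ℕ) (p X : ℕ → ℕ → ℤ) : ℤ := ∑ u ∈ range K, ∑ v ∈ range K, p u v * max (X u v) 0

/-- The inflow of `v`. -/
def colSum (K : ℕ) (X : ℕ → ℕ → ℤ) (v : ℕ) : ℤ := ∑ u ∈ range K, X u v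

/-- The unit cost of increasing `X u v` by `D`, with `I` for impossible increases. -/
def resCost (p U : ℕ → ℕ → ℤ) (I D : ℤ) (X : ℕ → ℕ → ℤ) (u v : ℕ) : ℤ :=
  if 0 < X u v + D then (if 0 < X u v + D - U u v then I else p u v) else 0 - p v u

/-- Potentials for the residual costs. -/
def IsPotential (K : ℕ) (C : ℕ → ℕ → ℤ) (π : ℕ → ℤ) : Prop :=
  (∀ u < K, ∀ v < K, |π v - π u| ≤ 2 * K) ∧ ∀ u < K, ∀ v < K, π v ≤ π u + C u v

/-- Convexity of the cost of one pair, which has slope `p` on the right of 0 and `-p'` on the left.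
If the arc is blocked, `y - x` is at most `D - 1`, and both sides move by a bounded multiple of it.
If `x + D` is positive, slope `p` is wrong on at most `D - 1` units, by at most `p + p' ≤ 4` each.
Otherwise `-p'` is the slope at `x ≤ 0`, and convexity gives the bound without error. -/
theorem pair_gap_of_le {p p' U I D x y q B : ℤ} (hp : 0 ≤ p) (hp2 : p ≤ 2) (hp' : 0 ≤ p')
    (hp2' : p' ≤ 2) (hD : 1 ≤ D) (hxy : x ≤ y) (hyU : y ≤ U) (hB : |q| ≤ B)
    (hq : q ≤ if 0 < x + D then (if 0 < x + D - U then I else p) else 0 - p') :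
    q * (y - x) - (B + 4) * (D - 1) ≤
      (p * max y 0 + p' * max (-y) 0) - (p * max x 0 + p' * max (-x) 0) := by
  have hB' := abs_le.mp hB
  have hB0 : 0 ≤ B := (abs_nonneg q).trans hB
  obtain ⟨e, he⟩ : ∃ e, y = x + e := ⟨y - x, by ring⟩
  subst he
  have he0 : 0 ≤ e := by linarith
  have hD0 : 0 ≤ D - 1 := by linarith
  have hBD : 0 ≤ (B + 4) * (D - 1) := by positivity
  have hsub : x + e - x = e := by ring
  rw [hsub]
  split at hq
  · rename_i h1
    split at hq
    · rename_i h2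
      have h3 : e ≤ D - 1 := by linarith
      have h4 : q * e ≤ B * (D - 1) := by nlinarith
      have h5 : -(2 * e) ≤ (p * max (x + e) 0 + p' * max (-(x + e)) 0) -
          (p * max x 0 + p' * max (-x) 0) := by
        rcases le_total 0 x with h | h <;> rcases le_total 0 (x + e) with h' | h' <;>
          simp only [max_eq_left, max_eq_right, h, h', Left.neg_nonpos_iff, Left.nonneg_neg_iff] <;>
          nlinarith
      nlinarith
    · rcases le_total 0 x with h | h
      · have h' : 0 ≤ x + e := by linarith
        simp only [max_eq_left, max_eq_right, h, h', Left.neg_nonpos_iff]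
        nlinarith
      · have h6 : p * (x + e) ≤ p * max (x + e) 0 := mul_le_mul_of_nonneg_left (le_max_left _ _) hp
        have h7 : 0 ≤ p' * max (-(x + e)) 0 := mul_nonneg hp' (le_max_right _ _)
        simp only [max_eq_left, max_eq_right, h, Left.nonneg_neg_iff]
        have h8 : -(D - 1) ≤ x := by linarith
        have h9 : q * e ≤ p * e := mul_le_mul_of_nonneg_right hq he0
        have h10 : -(4 * (D - 1)) ≤ (p + p') * x := by nlinarith
        nlinarith
  · rename_i h1
    have hx : x ≤ 0 := by linarith
    have h9 : q * e ≤ (0 - p') * e := mul_le_mul_of_nonneg_right hq he0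
    have h6 : 0 ≤ p * max (x + e) 0 := mul_nonneg hp (le_max_right _ _)
    have h7 : p' * (-(x + e)) ≤ p' * max (-(x + e)) 0 :=
      mul_le_mul_of_nonneg_left (le_max_left _ _) hp'
    simp only [max_eq_left, max_eq_right, hx, Left.nonneg_neg_iff]
    nlinarith

/-- Antisymmetry lets both directions of a pair be priced by one convex function of `X u v`; each
pair then occurs twice. -/
theorem two_mul_cost {K : ℕ} {p X : ℕ → ℕ → ℤ} (hX : Anti K X) :
    2 * cost K p X =
      ∑ u ∈ range K, ∑ v ∈ range K, (p u v * max (X u v) 0 + p v u * max (-X u v) 0) := by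
  have h : cost K p X = ∑ u ∈ range K, ∑ v ∈ range K, p v u * max (-X u v) 0 := by
    unfold cost
    rw [sum_comm]
    refine sum_congr rfl fun u hu => sum_congr rfl fun v hv => ?_
    rw [hX v (mem_range.mp hv) u (mem_range.mp hu)]
  simp only [sum_add_distrib]
  rw [← h, ← cost]; ring

/-- Summation by parts. -/
theorem sum_potential {K : ℕ} {Z : ℕ → ℕ → ℤ} (hZ : Anti K Z) (π : ℕ → ℤ) :
    ∑ u ∈ range K, ∑ v ∈ range K, (π v - π u) * Z u v =
      2 * ∑ v ∈ range K, π v * colSum K Z v := by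
  have h1 : ∑ u ∈ range K, ∑ v ∈ range K, π v * Z u v = ∑ v ∈ range K, π v * colSum K Z v := by
    rw [sum_comm]; simp only [colSum, mul_sum]
  have h2 : ∑ u ∈ range K, ∑ v ∈ range K, π u * Z u v = -∑ v ∈ range K, π v * colSum K Z v := by
    simp only [colSum, mul_sum, ← sum_neg_distrib]
    refine sum_congr rfl fun u hu => sum_congr rfl fun v hv => ?_
    rw [hZ u (mem_range.mp hu) v (mem_range.mp hv)]; ring
  simp only [sub_mul, sum_sub_distrib, h1, h2]; ring

/-- Weak duality, up to an error that vanishes at `D = 1`: potential differences lie below the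
residual costs, so `pair_gap_of_le` applies to each pair with `q = π v - π u` and `B = 2 * K`. The
inflows of `X` and `Y` may differ; this yields optimality for one score as well as the comparison of
different scores. -/
theorem cost_gap {K : ℕ} {p U X Y : ℕ → ℕ → ℤ} {I D : ℤ} {π : ℕ → ℤ}
    (hp : ∀ u < K, ∀ v < K, 0 ≤ p u v ∧ p u v ≤ 2) (hD : 1 ≤ D)
    (hX : Anti K X) (hY : Anti K Y) (hYU : Within K U Y)
    (hπ : IsPotential K (resCost p U I D X) π) :
    2 * (∑ v ∈ range K, π v * (colSum K Y v - colSum K X v)) -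
      K * K * ((2 * K + 4) * (D - 1)) ≤ 2 * (cost K p Y - cost K p X) := by
  have hZ : Anti K fun u v => Y u v - X u v := fun u hu v hv => by
    have := hX u hu v hv
    have := hY u hu v hv
    dsimp only; omega
  have h1 := sum_potential hZ π
  have h2 : ∀ v, colSum K (fun u v => Y u v - X u v) v = colSum K Y v - colSum K X v := fun v => by
    simp [colSum, sum_sub_distrib]
  simp only [h2] at h1
  rw [← h1, mul_sub 2, two_mul_cost hX, two_mul_cost hY, ← sum_sub_distrib]
  have h3 : (K : ℤ) * K * ((2 * K + 4) * (D - 1)) =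
      ∑ u ∈ range K, ∑ v ∈ range K, ((2 * K + 4) * (D - 1) : ℤ) := by
    simp; ring
  rw [h3, ← sum_sub_distrib]
  refine sum_le_sum fun u hu => ?_
  rw [← sum_sub_distrib, ← sum_sub_distrib]
  refine sum_le_sum fun v hv => ?_
  rw [mem_range] at hu hv
  -- A pair on which `Y` is smaller is read in the opposite direction.
  rcases le_total (X u v) (Y u v) with h | h
  · refine pair_gap_of_le (hp u hu v hv).1 (hp u hu v hv).2 (hp v hv u hu).1 (hp v hv u hu).2 hD h
      (hYU u hu v hv) (hπ.1 u hu v hv) (I := I) ?_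
    have := hπ.2 u hu v hv
    unfold resCost at this
    linarith
  · have h' : X v u ≤ Y v u := by rw [hX v hv u hu, hY v hv u hu]; linarith
    have := pair_gap_of_le (hp v hv u hu).1 (hp v hv u hu).2 (hp u hu v hv).1 (hp u hu v hv).2 hD h'
      (hYU v hv u hu) (hπ.1 v hv u hu) (I := I) (by
        have := hπ.2 v hv u hu
        unfold resCost at this
        linarith)
    rw [hX v hv u hu, hY v hv u hu, neg_neg, neg_neg] at this
    linarith

/-- Increase `X u v` by `D`. -/
def push (X : ℕ → ℕ → ℤ) (u v : ℕ) (D : ℤ) : ℕ → ℕ → ℤ := fun a b =>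
  if a = u ∧ b = v then X a b + D else if a = v ∧ b = u then X a b - D else X a b

theorem push_anti {K : ℕ} {X : ℕ → ℕ → ℤ} (hX : Anti K X) {u v : ℕ} (huv : u ≠ v) (D : ℤ) :
    Anti K (push X u v D) := by
  intro a ha b hb
  have h := hX a ha b hb
  unfold push
  by_cases h1 : a = u ∧ b = v
  · have h2 : ¬ (b = u ∧ a = v) := by omega
    have h3 : b = v ∧ a = u := by omega
    rw [if_pos h1, if_neg h2, if_pos h3]; omega
  · by_cases h4 : a = v ∧ b = u
    · have h3 : b = u ∧ a = v := by omega
      rw [if_neg h1, if_pos h4, if_pos h3]; omega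
    · have h2 : ¬ (b = u ∧ a = v) := by omega
      have h3 : ¬ (b = v ∧ a = u) := by omega
      rw [if_neg h1, if_neg h4, if_neg h2, if_neg h3]; omega

theorem push_within {K : ℕ} {U X : ℕ → ℕ → ℤ} (hX : Within K U X) {u v : ℕ} {D : ℤ} (hD : 0 ≤ D)
    (h : X u v + D ≤ U u v) : Within K U (push X u v D) := by
  intro a ha b hb
  have h' := hX a ha b hb
  unfold push
  split_ifs with h1 h2
  · obtain ⟨rfl, rfl⟩ := h1; exact h
  · linarith
  · exact h'

theorem sum_ite_pair {K u v : ℕ} (hu : u < K) (hv : v < K) (z : ℤ) :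
    ∑ a ∈ range K, ∑ b ∈ range K, (if a = u ∧ b = v then z else 0) = z := by
  have : ∀ a b : ℕ, (if a = u ∧ b = v then z else 0) =
      if a = u then (if b = v then z else 0) else 0 :=
    fun a b => by split_ifs <;> simp_all
  simp only [this, sum_ite_irrel, sum_ite_eq', sum_const_zero, mem_range, hu, hv, if_true]

/-- Unless the arc is blocked, the residual cost is the slope at the end point of the step, which by
convexity is at least the average slope along the step. -/
theorem push_cost {K : ℕ} {p U X : ℕ → ℕ → ℤ} {I D : ℤ}
    (hp : ∀ u < K, ∀ v < K, 0 ≤ p u v) (hX : Anti K X) {u v : ℕ} (hu : u < K) (hv : v < K)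
    (huv : u ≠ v) (h : X u v + D ≤ U u v) :
    cost K p (push X u v D) ≤ cost K p X + D * resCost p U I D X u v := by
  have h1 : cost K p (push X u v D) - cost K p X =
      p u v * (max (X u v + D) 0 - max (X u v) 0) +
        p v u * (max (X v u - D) 0 - max (X v u) 0) := by
    rw [← sum_ite_pair hu hv (p u v * (max (X u v + D) 0 - max (X u v) 0)),
      ← sum_ite_pair hv hu (p v u * (max (X v u - D) 0 - max (X v u) 0))]
    unfold cost
    rw [← sum_sub_distrib, ← sum_add_distrib]
    refine sum_congr rfl fun a _ => ?_
    rw [← sum_sub_distrib, ← sum_add_distrib]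
    refine sum_congr rfl fun b _ => ?_
    unfold push
    split_ifs with h1 h2 h2
    · omega
    · obtain ⟨rfl, rfl⟩ := h1; ring
    · obtain ⟨rfl, rfl⟩ := h2; ring
    · ring
  have h2 := hp u hu v hv
  have h3 := hp v hv u hu
  rw [hX v hv u hu] at h1
  suffices cost K p (push X u v D) - cost K p X ≤ D * resCost p U I D X u v by linarith
  rw [h1]
  unfold resCost
  split_ifs with h4 h5
  · omega
  · have h6 : max (X u v + D) 0 = X u v + D := max_eq_left h4.le
    have h7 : max (-X u v - D) 0 = 0 := max_eq_right (by linarith)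
    rw [h6, h7]
    have h8 : X u v ≤ max (X u v) 0 := le_max_left _ _
    have h9 : 0 ≤ max (-X u v) 0 := le_max_right _ _
    nlinarith
  · have h6 : max (X u v + D) 0 = 0 := max_eq_right (by linarith)
    have h7 : max (-X u v - D) 0 = -X u v - D := max_eq_left (by linarith)
    rw [h6, h7]
    have h8 : 0 ≤ max (X u v) 0 := le_max_right _ _
    have h9 : -X u v ≤ max (-X u v) 0 := le_max_left _ _
    nlinarith

theorem push_colSum {K : ℕ} (X : ℕ → ℕ → ℤ) {u v : ℕ} (hu : u < K) (hv : v < K) (huv : u ≠ v)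
    (D : ℤ) (b : ℕ) :
    colSum K (push X u v D) b = colSum K X b +
      (if b = v then D else 0) - if b = u then D else 0 := by
  have h : ∀ a, push X u v D a b =
      X a b + (if a = u then (if b = v then D else 0) else 0) -
        if a = v then (if b = u then D else 0) else 0 := by
    intro a
    unfold push
    split_ifs <;> omega
  simp only [colSum, h, sum_sub_distrib, sum_add_distrib, sum_ite_eq', mem_range, hu, hv, if_true]

/-- Push `D` along the first `k` arcs `(a (i + 1), a i)`. -/
def pushSeq (D : ℤ) (a : ℕ → ℕ) (X : ℕ → ℕ → ℤ) : ℕ → ℕ → ℕ → ℤ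
  | 0 => X
  | k + 1 => push (pushSeq D a X k) (a (k + 1)) (a k) D

/-- On a simple cycle with at least three arcs no pair of nodes is used twice, in either direction.
So the arcs still to come keep their values (last clause), and residual costs and capacities
measured at `X` remain correct throughout. The inflows telescope along the path and return to their
old values once it closes. -/
theorem pushSeq_spec {K : ℕ} {p U X : ℕ → ℕ → ℤ} {I D : ℤ} {a : ℕ → ℕ} {c : ℕ}
    (hp : ∀ u < K, ∀ v < K, 0 ≤ p u v) (hX : Anti K X) (hXU : Within K U X) (hD : 0 ≤ D)
    (ha : ∀ i ≤ c, a i < K) (hinj : ∀ i < c, ∀ j < c, a i = a j → i = j) (hc : a 0 = a c)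
    (hc3 : 3 ≤ c) (hav : ∀ i < c, X (a (i + 1)) (a i) + D ≤ U (a (i + 1)) (a i)) :
    ∀ k ≤ c, Anti K (pushSeq D a X k) ∧ Within K U (pushSeq D a X k) ∧
      cost K p (pushSeq D a X k) ≤
        cost K p X + D * ∑ i ∈ range k, resCost p U I D X (a (i + 1)) (a i) ∧
      (∀ b, colSum K (pushSeq D a X k) b =
        colSum K X b + (if b = a 0 then D else 0) - if b = a k then D else 0) ∧
      ∀ i < c, k ≤ i → pushSeq D a X k (a (i + 1)) (a i) = X (a (i + 1)) (a i) := by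
  have hsucc : ∀ i < c, a (i + 1) ≠ a i := by
    intro i hi h
    rcases Nat.lt_or_ge (i + 1) c with h1 | h1
    · have := hinj _ h1 _ hi h; omega
    · have h2 : i + 1 = c := by omega
      rw [h2, ← hc] at h
      have := hinj _ (by omega) _ hi h; omega
  intro k
  induction k with
  | zero => intro _; exact ⟨hX, hXU, by simp [pushSeq], by simp [pushSeq], fun _ _ _ => rfl⟩
  | succ k ih =>
    intro hk
    obtain ⟨h1, h2, h3, h4, h5⟩ := ih (by omega)
    have hne := hsucc k (by omega)
    have hu := ha (k + 1) hk
    have hv := ha k (by omega)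
    have hk5 := h5 k (by omega) le_rfl
    have hav' : pushSeq D a X k (a (k + 1)) (a k) + D ≤ U (a (k + 1)) (a k) := by
      rw [hk5]; exact hav k (by omega)
    refine ⟨push_anti h1 hne D, push_within h2 hD hav', ?_, ?_, ?_⟩
    · have h6 := push_cost (I := I) hp h1 hu hv hne hav'
      have h7 : resCost p U I D (pushSeq D a X k) (a (k + 1)) (a k) =
          resCost p U I D X (a (k + 1)) (a k) := by simp only [resCost, hk5]
      rw [h7] at h6
      rw [sum_range_succ, mul_add]
      exact h6.trans (by linarith)
    · intro b
      rw [pushSeq, push_colSum _ hu hv hne, h4 b]; ring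
    · intro i hi hki
      rw [pushSeq, push, if_neg, if_neg, h5 i hi (by omega)]
      · rintro ⟨h6, h7⟩
        have h8 : i = k + 1 := hinj i hi (k + 1) (by omega) h7
        subst h8
        rcases Nat.lt_or_ge (k + 1 + 1) c with h9 | h9
        · have := hinj _ h9 _ (by omega) h6; omega
        · have h10 : k + 1 + 1 = c := by omega
          rw [h10, ← hc] at h6
          have := hinj _ (by omega) _ (by omega) h6; omega
      · rintro ⟨_, h7⟩
        have := hinj i hi k (by omega) h7; omega

/-- The capacity on the diagonal keeps loops from being blocked. Free loops allow a walk in the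
Bellman–Ford table to wait. -/
theorem resCost_self {p U X : ℕ → ℕ → ℤ} {I D : ℤ} {u : ℕ} (hp : p u u = 0) (hX : X u u = 0)
    (hU : D ≤ U u u) : resCost p U I D X u u = 0 := by
  unfold resCost; split_ifs <;> omega

theorem neg_two_le_resCost {p U X : ℕ → ℕ → ℤ} {I D : ℤ} {u v : ℕ} (hp : 0 ≤ p u v)
    (hp2 : p v u ≤ 2) (hI : 0 ≤ I) : -2 ≤ resCost p U I D X u v := by
  unfold resCost; split_ifs <;> omega

/-- At most one direction of a pair can be a refund when `D > 0`, and the other direction pays it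
back, at the same price or with `I ≥ 2`. Hence two opposite arcs never form a negative cycle. -/
theorem resCost_add_nonneg {p U X : ℕ → ℕ → ℤ} {I D : ℤ} {u v : ℕ} (hp : 0 ≤ p u v)
    (hp' : 0 ≤ p v u) (hX : X u v = -X v u) (hI : 2 ≤ I) (hp2 : p u v ≤ 2) (hp2' : p v u ≤ 2)
    (hD : 0 < D) :
    0 ≤ resCost p U I D X u v + resCost p U I D X v u := by
  unfold resCost; split_ifs <;> omega

/-- Pushing along a simple cycle of negative residual cost. -/
theorem pushSeq_cycle {K : ℕ} {p U X : ℕ → ℕ → ℤ} {I D : ℤ} {a : ℕ → ℕ} {c : ℕ}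
    (hp : ∀ u < K, ∀ v < K, 0 ≤ p u v ∧ p u v ≤ 2) (hpd : ∀ u < K, p u u = 0)
    (hU : ∀ u < K, ∀ v < K, 0 ≤ U u v) (hX : Anti K X) (hXU : Within K U X) (hD : 0 < D)
    (hUd : ∀ u < K, D ≤ U u u) (hI : 2 * K < I) (hcK : c ≤ K) (hc0 : 0 < c)
    (ha : ∀ i ≤ c, a i < K) (hinj : ∀ i < c, ∀ j < c, a i = a j → i = j) (hc : a 0 = a c)
    (hneg : ∑ i ∈ range c, resCost p U I D X (a (i + 1)) (a i) < 0) :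
    Anti K (pushSeq D a X c) ∧ Within K U (pushSeq D a X c) ∧
      cost K p (pushSeq D a X c) ≤ cost K p X - D ∧
      ∀ b, colSum K (pushSeq D a X c) b = colSum K X b := by
  have hKpos : (0 : ℤ) < K := by exact_mod_cast lt_of_lt_of_le hc0 hcK
  have hX0 : ∀ u < K, X u u = 0 := fun u hu => by have := hX u hu u hu; omega
  have hlow : ∀ i < c, -2 ≤ resCost p U I D X (a (i + 1)) (a i) := fun i hi =>
    neg_two_le_resCost (hp _ (ha _ hi) _ (ha _ hi.le)).1 (hp _ (ha _ hi.le) _ (ha _ hi)).2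
      (by omega)
  have hc3 : 3 ≤ c := by
    by_contra h
    rcases (by omega : c = 1 ∨ c = 2) with rfl | rfl
    · rw [sum_range_one, ← hc, resCost_self (hpd _ (ha 0 (by omega))) (hX0 _ (ha 0 (by omega)))
        (hUd _ (ha 0 (by omega)))] at hneg
      omega
    · rw [sum_range_succ, sum_range_one, ← hc] at hneg
      have h0 := ha 0 (by omega)
      have h1 := ha 1 (by omega)
      have := resCost_add_nonneg (U := U) (I := I) (hp _ h1 _ h0).1 (hp _ h0 _ h1).1
        (hX _ h1 _ h0) (by omega) (hp _ h1 _ h0).2 (hp _ h0 _ h1).2 hD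
      simp only [zero_add] at hneg
      omega
  -- A blocked arc costs `I > 2 * K`, which the other arcs, at most `K` of them and each of cost at
  -- least `-2`, cannot outweigh.
  have hav : ∀ i < c, X (a (i + 1)) (a i) + D ≤ U (a (i + 1)) (a i) := by
    intro i hi
    by_contra hcon
    have hU0 := hU (a (i + 1)) (ha (i + 1) hi) (a i) (ha i hi.le)
    have h1 : resCost p U I D X (a (i + 1)) (a i) = I := by
      unfold resCost; rw [if_pos (by omega), if_pos (by omega)]
    have h2 : ∑ j ∈ range c, (if j = i then I + 2 else 0 : ℤ) + ∑ j ∈ range c, (-2 : ℤ) ≤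
        ∑ j ∈ range c, resCost p U I D X (a (j + 1)) (a j) := by
      rw [← sum_add_distrib]
      refine sum_le_sum fun j hj => ?_
      split_ifs with h
      · subst h; omega
      · have := hlow j (mem_range.mp hj); omega
    rw [sum_ite_eq', if_pos (mem_range.mpr hi)] at h2
    simp only [sum_const, card_range, nsmul_eq_mul] at h2
    have : (c : ℤ) ≤ K := by exact_mod_cast hcK
    linarith
  obtain ⟨h1, h2, h3, h4, _⟩ := pushSeq_spec (I := I) (fun u hu v hv => (hp u hu v hv).1) hX hXU
    hD.le ha hinj hc hc3 hav c le_rfl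
  refine ⟨h1, h2, ?_, fun b => by rw [h4, ← hc]; ring⟩
  -- Integrality: a negative cycle saves at least one per unit, hence at least `D`.
  have : ∑ i ∈ range c, resCost p U I D X (a (i + 1)) (a i) ≤ -1 := by omega
  nlinarith

theorem not_isPotential_of_cycle {K : ℕ} {C : ℕ → ℕ → ℤ} {a : ℕ → ℕ} {c : ℕ}
    (ha : ∀ i ≤ c, a i < K) (hc : a 0 = a c)
    (hneg : ∑ i ∈ range c, C (a (i + 1)) (a i) < 0) (π : ℕ → ℤ) : ¬ IsPotential K C π := by
  intro h
  have h1 : ∑ i ∈ range c, (π (a i) - π (a (i + 1))) ≤ ∑ i ∈ range c, C (a (i + 1)) (a i) :=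
    sum_le_sum fun i hi => by
      have hi := mem_range.mp hi
      have := h.2 _ (ha (i + 1) hi) _ (ha i hi.le)
      linarith
  rw [sum_range_sub', hc] at h1
  omega

/-- A table of the Bellman–Ford algorithm: `d k v` is the minimum cost of a walk to `v` with `k`
arcs, and `par k v` the last but one node of such a walk. -/
structure IsTable (K : ℕ) (C : ℕ → ℕ → ℤ) (d : ℕ → ℕ → ℤ) (par : ℕ → ℕ → ℕ) : Prop where
  zero : ∀ v < K, d 0 v = 0
  par_lt : ∀ k < K, ∀ v < K, par (k + 1) v < K
  eq : ∀ k < K, ∀ v < K, d (k + 1) v = d k (par (k + 1) v) + C (par (k + 1) v) v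
  le : ∀ k < K, ∀ u < K, ∀ v < K, d (k + 1) v ≤ d k u + C u v

namespace IsTable

variable {K : ℕ} {C : ℕ → ℕ → ℤ} {d : ℕ → ℕ → ℤ} {par : ℕ → ℕ → ℕ}

/-- A walk may wait on a free loop, so longer walks include the shorter ones. -/
theorem anti (h : IsTable K C d par) (hC : ∀ v < K, C v v = 0) {j k : ℕ} (hjk : j ≤ k)
    (hk : k ≤ K) {v : ℕ} (hv : v < K) : d k v ≤ d j v := by
  induction k, hjk using Nat.le_induction with
  | base => exact le_rfl
  | succ k _ ih =>
    have := h.le k hk v hv v hv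
    rw [hC v hv] at this
    exact (this.trans (by simp)).trans (ih (by omega))

theorem bound (h : IsTable K C d par) (hC2 : ∀ u < K, ∀ v < K, -2 ≤ C u v) :
    ∀ k ≤ K, ∀ v < K, -2 * (k : ℤ) ≤ d k v := by
  intro k
  induction k with
  | zero => intro _ v hv; simp [h.zero v hv]
  | succ k ih =>
    intro hk v hv
    have h1 := h.par_lt k hk v hv
    have h2 := ih (by omega) _ h1
    have h3 := hC2 _ h1 v hv
    rw [h.eq k hk v hv]; push_cast; linarith

/-- If layer `K` does not improve on layer `K - 1`, the latter satisfies the triangle inequality.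
Its entries lie between `-2 * (K - 1)` and `0`, because arcs cost at least `-2`. -/
theorem isPotential (h : IsTable K C d par) (hC : ∀ v < K, C v v = 0)
    (hC2 : ∀ u < K, ∀ v < K, -2 ≤ C u v) (hst : ∀ v < K, ¬ d K v < d (K - 1) v) :
    IsPotential K C (d (K - 1)) := by
  refine ⟨fun u hu v hv => ?_, fun u hu v hv => ?_⟩
  · have h1 := h.bound hC2 (K - 1) (by omega) u hu
    have h2 := h.bound hC2 (K - 1) (by omega) v hv
    have h3 := h.anti hC (Nat.zero_le (K - 1)) (by omega) hu
    have h4 := h.anti hC (Nat.zero_le (K - 1)) (by omega) hv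
    rw [h.zero u hu] at h3
    rw [h.zero v hv] at h4
    rw [abs_le]; constructor <;> omega
  · have h1 := h.le (K - 1) (by omega) u hu v hv
    rw [show K - 1 + 1 = K by omega] at h1
    have h2 := hst v hv
    omega

/-- A closed section of a walk of `K` arcs that beats all shorter walks has negative cost. -/
theorem cycle_neg (h : IsTable K C d par) (hC : ∀ v < K, C v v = 0) {a : ℕ → ℕ}
    (ha : ∀ i ≤ K, a i < K) (hpar : ∀ i < K, a (i + 1) = par (K - i) (a i))
    (himp : d K (a 0) < d (K - 1) (a 0)) {lo hi : ℕ} (hlo : lo < hi) (hhi : hi ≤ K)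
    (heq : a lo = a hi) :
    ∑ i ∈ range (hi - lo), C (a (lo + i + 1)) (a (lo + i)) < 0 := by
  have hstep : ∀ i < K, d (K - i) (a i) = d (K - (i + 1)) (a (i + 1)) + C (a (i + 1)) (a i) := by
    intro i hi
    have h1 := h.eq (K - (i + 1)) (by omega) (a i) (ha i hi.le)
    rw [show K - (i + 1) + 1 = K - i by omega, ← hpar i hi] at h1
    exact h1
  have hsum : ∑ i ∈ range (hi - lo), C (a (lo + i + 1)) (a (lo + i)) =
      d (K - lo) (a lo) - d (K - hi) (a hi) := by
    have : ∀ i ∈ range (hi - lo), C (a (lo + i + 1)) (a (lo + i)) =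
        d (K - (lo + i)) (a (lo + i)) - d (K - (lo + (i + 1))) (a (lo + (i + 1))) := by
      intro i hi
      have := hstep (lo + i) (by have := mem_range.mp hi; omega)
      rw [this, ← add_assoc]; ring
    rw [sum_congr rfl this, sum_range_sub' fun i => d (K - (lo + i)) (a (lo + i))]
    simp [show lo + (hi - lo) = hi by omega]
  rw [hsum]
  by_contra hcon
  -- If the closed section were not negative, cutting it out would give walks that are `hi - lo`
  -- arcs shorter and no dearer, first to `a lo` and then to every later node up to the end `a 0`.
  -- This contradicts the improvement of layer `K`.
  have key : ∀ j ≤ lo, d (K - (lo - j) - (hi - lo)) (a (lo - j)) ≤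
      d (K - (lo - j)) (a (lo - j)) := by
    intro j
    induction j with
    | zero =>
      intro _
      rw [Nat.sub_zero, show K - lo - (hi - lo) = K - hi by omega]
      rw [heq] at hcon ⊢
      omega
    | succ j ih =>
      intro hj
      have h1 := ih (by omega)
      obtain ⟨i, hi'⟩ : ∃ i, i = lo - (j + 1) := ⟨_, rfl⟩
      rw [show lo - j = i + 1 by omega] at h1
      rw [← hi', hstep i (by omega)]
      have h2 := h.le (K - (i + 1) - (hi - lo)) (by omega) (a (i + 1)) (ha _ (by omega)) (a i)
        (ha _ (by omega))
      rw [show K - (i + 1) - (hi - lo) + 1 = K - i - (hi - lo) by omega] at h2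
      linarith
  have h1 := key lo le_rfl
  simp only [Nat.sub_self, Nat.sub_zero] at h1
  have h2 := h.anti hC (show K - (hi - lo) ≤ K - 1 by omega) (by omega) (ha 0 (by omega))
  linarith

end IsTable

end Circ

/-! ## Loops with a counter -/

section Loops

open Finset

/-- The states agree on everything that the command does not assign. -/
def Cm.Keeps (S : Cm) (s t : St) : Prop :=
  (∀ j, S.modR j = false → t.reg j = s.reg j) ∧ ∀ a, S.modA a = false → t.arr a = s.arr a

theorem Cm.keeps_ev (S : Cm) (s : St) : S.Keeps s (S.ev s) :=
  ⟨fun j h => S.ev_reg j h s, fun a h => S.ev_arr a h s⟩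

theorem Cm.Keeps.trans {S : Cm} {s t r : St} (h : S.Keeps s t) (h' : S.Keeps t r) : S.Keeps s r :=
  ⟨fun j hj => (h'.1 j hj).trans (h.1 j hj), fun a ha => (h'.2 a ha).trans (h.2 a ha)⟩

theorem Cm.Keeps.mono {S T : Cm} {s t : St} (h : S.Keeps s t)
    (hR : ∀ j, T.modR j = false → S.modR j = false)
    (hA : ∀ a, T.modA a = false → S.modA a = false) :
    T.Keeps s t :=
  ⟨fun j hj => h.1 j (hR j hj), fun a ha => h.2 a (hA a ha)⟩

/-- Run `B` with `i = 0, 1, …` below register `N`. -/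
def Cm.for (i N : ℕ) (B : Cm) : Cm :=
  .seq (.set i (.c 0)) (.rep N (.seq B (.set i (.add (.r i) (.c 1)))))

theorem Cm.modR_for (i N : ℕ) (B : Cm) (j : ℕ) :
    (Cm.for i N B).modR j = (i == j || B.modR j) := by
  simp [Cm.for, Cm.modR]; grind

theorem Cm.modA_for (i N : ℕ) (B : Cm) (a : ℕ) : (Cm.for i N B).modA a = B.modA a := by
  simp [Cm.for, Cm.modA]

/-- The premise `Keeps` hands all unassigned registers and arrays back to the step, so an invariant
need only speak of what changes. -/
theorem Cm.for_inv {i N : ℕ} {B : Cm} (s : St) {n : ℕ} (hN : s.reg N = n) (hiN : N ≠ i)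
    (hB : B.modR i = false) (Inv : ℕ → St → Prop) (h0 : Inv 0 (s.setR i 0))
    (hs : ∀ k < n, ∀ t, (Cm.for i N B).Keeps s t → t.reg i = k → Inv k t →
      Inv (k + 1) ((B.ev t).setR i (k + 1))) :
    Inv n ((Cm.for i N B).ev s) := by
  have key : ∀ k ≤ n, (Cm.for i N B).Keeps s
        ((Cm.seq B (.set i (.add (.r i) (.c 1)))).ev^[k] (s.setR i 0)) ∧
      ((Cm.seq B (.set i (.add (.r i) (.c 1)))).ev^[k] (s.setR i 0)).reg i = k ∧
      Inv k ((Cm.seq B (.set i (.add (.r i) (.c 1)))).ev^[k] (s.setR i 0)) := by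
    intro k
    induction k with
    | zero =>
      intro _
      refine ⟨⟨fun j hj => ?_, fun a _ => rfl⟩, by simp, h0⟩
      have : j ≠ i := by rintro rfl; simp [Cm.modR_for] at hj
      simp [this]
    | succ k ih =>
      intro hk
      obtain ⟨h1, h2, h3⟩ := ih (by omega)
      have h4 := hs k hk _ h1 h2 h3
      rw [Function.iterate_succ_apply']
      set t := (Cm.seq B (.set i (.add (.r i) (.c 1)))).ev^[k] (s.setR i 0)
      have h5 : (Cm.seq B (.set i (.add (.r i) (.c 1)))).ev t = (B.ev t).setR i (k + 1) := by
        simp [Cm.ev, Ex.ev, B.ev_reg i hB, h2]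
      rw [h5]
      refine ⟨h1.trans ⟨fun j hj => ?_, fun a ha => ?_⟩, by simp, h4⟩
      · rw [Cm.modR_for, Bool.or_eq_false_iff] at hj
        have : j ≠ i := by rintro rfl; simp at hj
        simp [this, B.ev_reg j hj.2]
      · rw [Cm.modA_for] at ha
        simp [B.ev_arr a ha]
  have h6 := (key n le_rfl).2.2
  have h7 : (Cm.for i N B).ev s =
      (Cm.seq B (.set i (.add (.r i) (.c 1)))).ev^[n] (s.setR i 0) := by
    simp [Cm.for, Cm.ev, Ex.ev, hiN, hN]
  rwa [h7]

theorem Cm.for_fill {i N a : ℕ} {B : Cm} (s : St) {n : ℕ} (hN : s.reg N = n) (hiN : N ≠ i)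
    (hB : B.modR i = false) (f : ℕ → ℕ) (F : ℕ → ℤ) (hf : ∀ k < n, ∀ j < n, f k = f j → k = j)
    (hs : ∀ k < n, ∀ t, (Cm.for i N B).Keeps s t → t.reg i = k →
      (B.ev t).arr a = Function.update (t.arr a) (f k) (F k)) :
    (∀ k < n, ((Cm.for i N B).ev s).arr a (f k) = F k) ∧
      ∀ x, (∀ k < n, f k ≠ x) → ((Cm.for i N B).ev s).arr a x = s.arr a x := by
  have := Cm.for_inv s hN hiN hB (fun k t => (∀ j < k, t.arr a (f j) = F j) ∧
    ∀ x, (∀ j < k, f j ≠ x) → t.arr a x = s.arr a x) ⟨by simp, by simp⟩ (by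
      intro k hk t ht hti hI
      rw [St.setR_arr, hs k hk t ht hti]
      refine ⟨fun j hj => ?_, fun x hx => ?_⟩
      · rcases eq_or_ne j k with rfl | hne
        · simp
        · rw [Function.update_of_ne (fun h => hne (hf j (by omega) k hk h)), hI.1 j (by omega)]
      · rw [Function.update_of_ne (hx k (by omega)).symm, hI.2 x fun j hj => hx j (by omega)])
  exact this

theorem Cm.for_sum {i N r : ℕ} {B : Cm} (s : St) {n : ℕ} (hN : s.reg N = n) (hiN : N ≠ i)
    (hir : r ≠ i) (hB : B.modR i = false) (F : ℕ → ℤ)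
    (hs : ∀ k < n, ∀ t, (Cm.for i N B).Keeps s t → t.reg i = k → (B.ev t).reg r = t.reg r + F k) :
    ((Cm.for i N B).ev s).reg r = s.reg r + ∑ k ∈ range n, F k := by
  refine Cm.for_inv s hN hiN hB (fun k t => t.reg r = s.reg r + ∑ k ∈ range k, F k)
    (by simp [hir]) ?_
  intro k hk t ht hti hI
  simp only [St.setR_reg, hir, if_false]
  rw [hs k hk t ht hti, hI, sum_range_succ]; ring

/-- Two nested loops of the same length. -/
def Cm.for2 (i j N : ℕ) (B : Cm) : Cm := .for i N (.for j N B)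

theorem Cm.for2_keeps {i j N : ℕ} {B : Cm} {s t r : St} (h : (Cm.for2 i j N B).Keeps s t)
    (h' : (Cm.for j N B).Keeps t r) : (Cm.for2 i j N B).Keeps s r :=
  h.trans (h'.mono (fun k hk => by
    rw [Cm.for2, Cm.modR_for, Bool.or_eq_false_iff] at hk; exact hk.2) fun a ha => by
    rwa [Cm.for2, Cm.modA_for] at ha)

theorem Cm.for2_fill {i j N a : ℕ} {B : Cm} (s : St) {n : ℕ} (hN : s.reg N = n) (hiN : N ≠ i)
    (hjN : N ≠ j) (hij : i ≠ j) (hBi : B.modR i = false) (hBj : B.modR j = false)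
    (hBN : B.modR N = false) (f : ℕ → ℕ → ℕ) (F : ℕ → ℕ → ℤ)
    (hf : ∀ u < n, ∀ v < n, ∀ u' < n, ∀ v' < n, f u v = f u' v' → u = u' ∧ v = v')
    (hs : ∀ u < n, ∀ v < n, ∀ t, (Cm.for2 i j N B).Keeps s t → t.reg i = u → t.reg j = v →
      (B.ev t).arr a = Function.update (t.arr a) (f u v) (F u v)) :
    (∀ u < n, ∀ v < n, ((Cm.for2 i j N B).ev s).arr a (f u v) = F u v) ∧
      ∀ x, (∀ u < n, ∀ v < n, f u v ≠ x) → ((Cm.for2 i j N B).ev s).arr a x = s.arr a x := by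
  have hmi : (Cm.for j N B).modR i = false := by simp [Cm.modR_for, hBi, hij.symm]
  have := Cm.for_inv s hN hiN hmi (fun k t => (∀ u < k, ∀ v < n, t.arr a (f u v) = F u v) ∧
    ∀ x, (∀ u < k, ∀ v < n, f u v ≠ x) → t.arr a x = s.arr a x) ⟨by simp, by simp⟩ (by
      intro k hk t ht hti hI
      have htN : t.reg N = n := by
        rw [ht.1 N (by simp [Cm.modR_for, hBN, hiN.symm, hjN.symm]), hN]
      obtain ⟨h1, h2⟩ := Cm.for_fill (a := a) t htN hjN hBj (f k) (F k)
        (fun v hv v' hv' h => (hf k hk v hv k hk v' hv' h).2) (fun v hv r hr hrj =>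
          hs k hk v hv r (Cm.for2_keeps ht hr) (by
            rw [hr.1 i hmi, hti]) hrj)
      rw [St.setR_arr]
      refine ⟨fun u hu v hv => ?_, fun x hx => ?_⟩
      · rcases eq_or_ne u k with rfl | hne
        · exact h1 v hv
        · rw [h2 _ fun v' hv' h => hne (hf _ (by omega) _ hv _ hk _ hv' h.symm).1,
            hI.1 u (by omega) v hv]
      · rw [h2 x fun v hv => hx k (by omega) v hv, hI.2 x fun u hu => hx u (by omega)])
  exact this

theorem Cm.for2_sum {i j N r : ℕ} {B : Cm} (s : St) {n : ℕ} (hN : s.reg N = n) (hiN : N ≠ i)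
    (hjN : N ≠ j) (hij : i ≠ j) (hri : r ≠ i) (hrj : r ≠ j) (hBi : B.modR i = false)
    (hBj : B.modR j = false) (hBN : B.modR N = false) (F : ℕ → ℕ → ℤ)
    (hs : ∀ u < n, ∀ v < n, ∀ t, (Cm.for2 i j N B).Keeps s t → t.reg i = u → t.reg j = v →
      (B.ev t).reg r = t.reg r + F u v) :
    ((Cm.for2 i j N B).ev s).reg r = s.reg r + ∑ u ∈ range n, ∑ v ∈ range n, F u v := by
  have hmi : (Cm.for j N B).modR i = false := by simp [Cm.modR_for, hBi, hij.symm]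
  refine Cm.for_sum s hN hiN hri hmi _ fun k hk t ht hti => ?_
  have htN : t.reg N = n := by
    rw [ht.1 N (by simp [Cm.modR_for, hBN, hiN.symm, hjN.symm]), hN]
  exact Cm.for_sum t htN hjN hrj hBj _ fun v hv r hr hrj =>
    hs k hk v hv r (Cm.for2_keeps ht hr) (by rw [hr.1 i hmi, hti]) hrj

/-- Equality test. -/
def Cm.ifEq (e f : Ex) (S T : Cm) : Cm := .ite (.sub e f) T (.ite (.sub f e) T S)

theorem Cm.ev_seq (S T : Cm) (s : St) : (Cm.seq S T).ev s = T.ev (S.ev s) := rfl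

theorem Cm.ev_ite_pos {e : Ex} {s : St} (h : 0 < e.ev s) (S T : Cm) :
    (Cm.ite e S T).ev s = S.ev s := if_pos h

theorem Cm.ev_ite_neg {e : Ex} {s : St} (h : ¬ 0 < e.ev s) (S T : Cm) :
    (Cm.ite e S T).ev s = T.ev s := if_neg h

theorem Cm.ev_ifEq_pos {e f : Ex} {s : St} (h : e.ev s = f.ev s) (S T : Cm) :
    (Cm.ifEq e f S T).ev s = S.ev s := by
  rw [Cm.ifEq, ev_ite_neg (by simp [Ex.ev, h]), ev_ite_neg (by simp [Ex.ev, h])]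

theorem Cm.ev_ifEq_neg {e f : Ex} {s : St} (h : e.ev s ≠ f.ev s) (S T : Cm) :
    (Cm.ifEq e f S T).ev s = T.ev s := by
  rcases lt_or_gt_of_ne h with h | h
  · rw [Cm.ifEq, ev_ite_neg (by simp [Ex.ev, h.le]), ev_ite_pos (by simp [Ex.ev, h])]
  · rw [Cm.ifEq, ev_ite_pos (by simp [Ex.ev, h])]

end Loops

/-! ## The program -/

namespace Borda

/-! Registers: `0` number `m` of alternatives, `1` number `K = m + 1` of nodes, `2` `K + 1`,
`3` number of phases, `4` `n`, `5` `d`, `6` capacity of the terminal arcs, `7` cost of impossible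
arcs, `8` step length, `9` and `10` nodes, `11` layer, `12`, `13`, `14` current minimum, its
position, candidate, `15` and `16` improvement found, and where, `17` position in the walk,
`18`, `19`, `20` cycle found, its start and end, `21` phase, `22`, `23`, `24` lower bound and
candidate of the score, stage of the search, `25` cost, `26` slope, `27` best cost, `28` and `29`
flags, `30` number of digits of `n`, `31` accumulator.

Arrays: `0` input and output, `1` multiples of `K`, `2` powers of two, `3` capacities, `4` costs,
`5` scores, `6` circulation, `7` residual costs, `8` and `9` distances and parents, `10` walk,
`11` positions in the walk, `12` multiples of `m`. Matrices are stored with row length `K`. -/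

/-- Entry of a matrix. -/
def rd2 (a : ℕ) (e f : Ex) : Ex := .rd a (.add (.rd 1 e) f)

/-- Assign to an entry of a matrix. -/
def wr2 (a : ℕ) (e f g : Ex) : Cm := .wr a (.add (.rd 1 e) f) g

/-- Residual costs. -/
def resCode : Cm :=
  .for2 9 10 1 <| .ite (.add (rd2 6 (.r 9) (.r 10)) (.r 8))
    (.ite (.sub (.add (rd2 6 (.r 9) (.r 10)) (.r 8)) (rd2 3 (.r 9) (.r 10)))
      (wr2 7 (.r 9) (.r 10) (.r 7))
      (wr2 7 (.r 9) (.r 10) (rd2 4 (.r 9) (.r 10))))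
    (wr2 7 (.r 9) (.r 10) (.sub (.c 0) (rd2 4 (.r 10) (.r 9))))

/-- One distance of the next layer. -/
def relaxCode : Cm :=
  .seq (.set 12 (rd2 8 (.r 11) (.r 10))) <| .seq (.set 13 (.r 10)) <|
  .for 9 1 <| .seq (.set 14 (.add (rd2 8 (.r 11) (.r 9)) (rd2 7 (.r 9) (.r 10)))) <|
    .ite (.sub (.r 12) (.r 14)) (.seq (.set 12 (.r 14)) (.set 13 (.r 9))) .skip

/-- One layer of the table. -/
def layerCode : Cm :=
  .for 10 1 <| .seq relaxCode <| .seq (wr2 8 (.add (.r 11) (.c 1)) (.r 10) (.r 12))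
    (wr2 9 (.add (.r 11) (.c 1)) (.r 10) (.r 13))

/-- Distances and parents. -/
def tableCode : Cm :=
  .seq (.for 10 1 (wr2 8 (.c 0) (.r 10) (.c 0))) <|
  .for 11 1 layerCode

/-- Does the last layer improve? -/
def detectCode : Cm :=
  .seq (.set 15 (.c 0)) <| .seq (.set 16 (.c 0)) <|
  .for 10 1 <| .ite (.sub (rd2 8 (.r 0) (.r 10)) (rd2 8 (.r 1) (.r 10)))
    (.seq (.set 15 (.c 1)) (.set 16 (.r 10))) .skip

/-- The walk, backwards. -/
def walkCode : Cm :=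
  .seq (.wr 10 (.c 0) (.r 16)) <|
  .for 17 1 (.wr 10 (.add (.r 17) (.c 1)) (rd2 9 (.sub (.r 1) (.r 17)) (.rd 10 (.r 17))))

/-- The first cycle of the walk. -/
def cycleCode : Cm :=
  .seq (.for 10 1 (.wr 11 (.r 10) (.c 0))) <|
  .seq (.set 18 (.c 0)) <| .seq (.set 19 (.c 0)) <| .seq (.set 20 (.c 0)) <|
  .for 17 2 <| .ite (.r 18) .skip <| .ite (.rd 11 (.rd 10 (.r 17)))
    (.seq (.set 18 (.c 1)) <| .seq (.set 19 (.sub (.rd 11 (.rd 10 (.r 17))) (.c 1)))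
      (.set 20 (.r 17)))
    (.wr 11 (.rd 10 (.r 17)) (.add (.r 17) (.c 1)))

/-- Push along the cycle. -/
def pushCode : Cm :=
  .for 17 1 <| .ite (.sub (.r 20) (.r 17)) (.ite (.sub (.add (.r 17) (.c 1)) (.r 19))
    (.seq (wr2 6 (.rd 10 (.add (.r 17) (.c 1))) (.rd 10 (.r 17))
        (.add (rd2 6 (.rd 10 (.add (.r 17) (.c 1))) (.rd 10 (.r 17))) (.r 8)))
      (wr2 6 (.rd 10 (.r 17)) (.rd 10 (.add (.r 17) (.c 1)))
        (.sub (rd2 6 (.rd 10 (.r 17)) (.rd 10 (.add (.r 17) (.c 1)))) (.r 8))))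
    .skip) .skip

/-- Cancel a negative cycle, if there is one. -/
def cancelCode : Cm :=
  .seq resCode <| .seq tableCode <| .seq detectCode <|
  .ite (.r 15) (.seq walkCode (.seq cycleCode pushCode)) .skip

/-- The start for a given score. -/
def startCode : Cm :=
  .for2 9 10 1 <| .ifEq (.r 9) (.r 0)
    (.ifEq (.r 10) (.r 0) (wr2 6 (.r 9) (.r 10) (.c 0))
      (wr2 6 (.r 9) (.r 10) (.sub (.rd 5 (.r 10)) (.r 23))))
    (.ifEq (.r 10) (.r 0) (wr2 6 (.r 9) (.r 10) (.sub (.r 23) (.rd 5 (.r 9))))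
      (wr2 6 (.r 9) (.r 10) (.c 0)))

/-- Optimum for a given score. -/
def solveCode : Cm :=
  .seq startCode <| .for 21 3 <|
  .seq (.set 8 (.rd 2 (.sub (.sub (.r 3) (.c 1)) (.r 21)))) <|
  .rep 1 <| .rep 1 <| .rep 1 <| .rep 1 <| .rep 1 cancelCode

/-- Cost of the circulation. -/
def costCode : Cm :=
  .seq (.set 25 (.c 0)) <| .for2 9 10 1 <|
  .ite (rd2 6 (.r 9) (.r 10))
    (.ite (rd2 4 (.r 9) (.r 10))
      (.seq (.set 25 (.add (.r 25) (rd2 6 (.r 9) (.r 10))))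
        (.ite (.sub (rd2 4 (.r 9) (.r 10)) (.c 1))
          (.set 25 (.add (.r 25) (rd2 6 (.r 9) (.r 10)))) .skip))
      .skip)
    .skip

/-- Slope of the optimum cost as a function of the score, up to sign. -/
def slopeCode : Cm :=
  .seq (.set 26 (.c 0)) <| .for 10 0 <|
  .set 26 (.add (.r 26) (.sub (rd2 8 (.r 0) (.r 10)) (rd2 8 (.r 0) (.r 0))))

/-- Write the output. -/
def outCode : Cm :=
  .seq (.set 27 (.r 25)) <| .seq (.set 28 (.c 1)) <| .seq (.wr 0 (.c 0) (.sub (.c 0) (.r 25))) <|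
  .for2 9 10 0 (.wr 0 (.add (.add (.c 1) (.rd 12 (.r 9))) (.r 10)) (rd2 6 (.r 9) (.r 10)))

/-- Search for the best score. -/
def searchCode : Cm :=
  .seq (.set 22 (.c (-1))) <| .seq (.set 28 (.c 0)) <| .for 24 3 <|
  .seq (.set 23 (.add (.r 22) (.rd 2 (.sub (.sub (.r 3) (.c 1)) (.r 24))))) <|
  .seq solveCode <| .seq costCode <| .seq slopeCode <|
  .seq (.set 29 (.c 1)) <| .seq (.ite (.r 28) (.set 29 (.sub (.r 27) (.r 25))) .skip) <|
  .seq (.ite (.r 29) outCode .skip) (.ite (.r 26) (.set 22 (.r 23)) .skip)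

/-- Multiples of a register. -/
def rowCode (a r : ℕ) : Cm :=
  .seq (.set 31 (.c 0)) <| .for 9 2 <| .seq (.wr a (.r 9) (.r 31)) (.set 31 (.add (.r 31) (.r r)))

/-- Powers of two. -/
def powCode : Cm :=
  .seq (.wr 2 (.c 0) (.c 1)) <| .for 9 3 <|
  .wr 2 (.add (.r 9) (.c 1)) (.add (.rd 2 (.r 9)) (.rd 2 (.r 9)))

/-- Capacities. -/
def capCode : Cm :=
  .for2 9 10 1 <| .ifEq (.r 9) (.r 10) (wr2 3 (.r 9) (.r 10) (.r 6)) <|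
  .ifEq (.r 9) (.r 0) (wr2 3 (.r 9) (.r 10) (.r 6)) <|
  .ifEq (.r 10) (.r 0) (wr2 3 (.r 9) (.r 10) (.r 6)) <|
  wr2 3 (.r 9) (.r 10) (.rd 0 (.add (.add (.c 3) (.rd 12 (.r 10))) (.r 9)))

/-- Costs. -/
def priceCode : Cm :=
  .for2 9 10 1 <| .ifEq (.r 9) (.r 10) (wr2 4 (.r 9) (.r 10) (.c 0)) <|
  .ifEq (.r 9) (.r 0)
    (.ifEq (.r 10) (.r 5) (wr2 4 (.r 9) (.r 10) (.c 0)) (wr2 4 (.r 9) (.r 10) (.c 2))) <|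
  .ifEq (.r 10) (.r 0)
    (.ifEq (.r 9) (.r 5) (wr2 4 (.r 9) (.r 10) (.c 2)) (wr2 4 (.r 9) (.r 10) (.c 0))) <|
  wr2 4 (.r 9) (.r 10) (.c 1)

/-- Borda scores. -/
def scoreCode : Cm :=
  .for 9 0 <| .seq (.set 31 (.c 0)) <|
  .seq (.for 10 0 <| .ifEq (.r 9) (.r 10) .skip <|
    .set 31 (.add (.r 31) (.rd 0 (.add (.add (.c 3) (.rd 12 (.r 9))) (.r 10))))) <|
  .wr 5 (.r 9) (.r 31)

/-- Write the tables. -/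
def initCode : Cm :=
  .seq (.set 7 (.add (.add (.r 1) (.r 1)) (.r 1))) <|
  .seq (rowCode 1 1) <| .seq (rowCode 12 0) <| .seq powCode <|
  .seq (.set 6 (.add (.rd 2 (.r 3)) (.rd 2 (.r 3)))) <|
  .seq capCode <| .seq priceCode scoreCode

/-- Everything after the number of phases is known. -/
def mainCode : Cm := .seq initCode searchCode

/-- Read the sizes. -/
def readCode : Cm :=
  .seq (.set 0 (.rd 0 (.c 0))) <| .seq (.set 4 (.rd 0 (.c 1))) <| .seq (.set 5 (.rd 0 (.c 2))) <|
  .seq (.set 1 (.add (.r 0) (.c 1))) (.set 2 (.add (.r 1) (.c 1)))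

/-- The number of phases. -/
def phaseCode : Cm := .set 3 (.add (.r 30) (.r 1))

/-- These four registers are all the loop bounds. They are set by `readCode` and `phaseCode`, which
is why those two are compiled separately. -/
theorem mainCode_wf : mainCode.wf [0, 1, 2, 3] = true := by decide

theorem readCode_wf : readCode.wf [] = true := by decide

theorem phaseCode_wf : phaseCode.wf [] = true := by decide

end Borda

/-! ### Correctness of the residual costs and of one Bellman–Ford layer -/

namespace Borda

open Finset Circ

/-- A matrix with row length `m + 1`. -/
def mat (m a : ℕ) (s : St) : ℕ → ℕ → ℤ := fun u v => s.arr a (u * (m + 1) + v)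

theorem index_inj {K u v u' v' : ℕ} (hv : v < K) (hv' : v' < K)
    (h : u * K + v = u' * K + v') : u = u' ∧ v = v' := by
  have hu : u = u' := by
    rcases lt_trichotomy u u' with h1 | h1 | h1
    · have := Nat.mul_le_mul_right K (Nat.succ_le_of_lt h1)
      rw [Nat.succ_mul] at this; omega
    · exact h1
    · have := Nat.mul_le_mul_right K (Nat.succ_le_of_lt h1)
      rw [Nat.succ_mul] at this; omega
  subst hu
  exact ⟨rfl, by omega⟩

/-- The tables that stay fixed while the program searches. -/
structure Env (m H : ℕ) (I : ℤ) (p U : ℕ → ℕ → ℤ) (sc : ℕ → ℤ) (s : St) : Prop where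
  hm : s.reg 0 = m
  hK : s.reg 1 = ((m + 1 : ℕ) : ℤ)
  hK1 : s.reg 2 = ((m + 2 : ℕ) : ℤ)
  hH : s.reg 3 = ((H + 1 : ℕ) : ℤ)
  hI : s.reg 7 = I
  row : ∀ u ≤ m + 1, s.arr 1 u = ((u * (m + 1) : ℕ) : ℤ)
  pow : ∀ j ≤ H, s.arr 2 j = 2 ^ j
  cap : ∀ u < m + 1, ∀ v < m + 1, mat m 3 s u v = U u v
  price : ∀ u < m + 1, ∀ v < m + 1, mat m 4 s u v = p u v
  score : ∀ x < m, s.arr 5 x = sc x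
  rowm : ∀ u ≤ m, s.arr 12 u = ((u * m : ℕ) : ℤ)

variable {m H : ℕ} {I : ℤ} {p U : ℕ → ℕ → ℤ} {sc : ℕ → ℤ} {s : St}

theorem Env.of_keeps (E : Env m H I p U sc s) {S : Cm} {t : St} (h : S.Keeps s t)
    (hR : ∀ j ∈ [0, 1, 2, 3, 7], S.modR j = false)
    (hA : ∀ a ∈ [1, 2, 3, 4, 5, 12], S.modA a = false) : Env m H I p U sc t := by
  simp only [List.mem_cons, List.not_mem_nil, or_false, forall_eq_or_imp, forall_eq] at hR hA
  obtain ⟨r0, r1, r2, r3, r7⟩ := hR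
  obtain ⟨a1, a2, a3, a4, a5, a12⟩ := hA
  constructor
  · rw [h.1 _ r0, E.hm]
  · rw [h.1 _ r1, E.hK]
  · rw [h.1 _ r2, E.hK1]
  · rw [h.1 _ r3, E.hH]
  · rw [h.1 _ r7, E.hI]
  · rw [h.2 _ a1]; exact E.row
  · rw [h.2 _ a2]; exact E.pow
  · unfold mat; rw [h.2 _ a3]; exact E.cap
  · unfold mat; rw [h.2 _ a4]; exact E.price
  · rw [h.2 _ a5]; exact E.score
  · rw [h.2 _ a12]; exact E.rowm

theorem Env.ev (E : Env m H I p U sc s) {S : Cm}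
    (hR : ∀ j ∈ [0, 1, 2, 3, 7], S.modR j = false)
    (hA : ∀ a ∈ [1, 2, 3, 4, 5, 12], S.modA a = false) : Env m H I p U sc (S.ev s) :=
  E.of_keeps (S.keeps_ev s) hR hA

theorem Env.setR (E : Env m H I p U sc s) {j : ℕ} (z : ℤ) (hj : j ∉ [0, 1, 2, 3, 7]) :
    Env m H I p U sc (s.setR j z) := by
  refine E.of_keeps (Cm.keeps_ev (.set j (.c z)) s) (fun i hi => ?_) fun _ _ => rfl
  simp only [Cm.modR, beq_eq_false_iff_ne]
  rintro rfl; exact hj hi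

theorem ev_rd2 (E : Env m H I p U sc s) (a : ℕ) {e f : Ex} {u v : ℕ} (he : e.ev s = u)
    (hf : f.ev s = v) (hu : u ≤ m + 1) : (rd2 a e f).ev s = mat m a s u v := by
  simp only [rd2, Ex.ev, he, hf, Int.toNat_natCast, E.row u hu, mat]
  norm_cast

theorem ev_wr2_of_row (hrow : ∀ u ≤ m + 1, s.arr 1 u = ((u * (m + 1) : ℕ) : ℤ)) (a : ℕ)
    {e f g : Ex} {u v : ℕ} (he : e.ev s = u) (hf : f.ev s = v) (hu : u ≤ m + 1) :
    (wr2 a e f g).ev s = s.setA a (u * (m + 1) + v) (g.ev s) := by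
  simp only [wr2, Cm.ev, Ex.ev, he, hf, Int.toNat_natCast, hrow u hu]
  norm_cast

theorem ev_wr2 (E : Env m H I p U sc s) (a : ℕ) {e f g : Ex} {u v : ℕ} (he : e.ev s = u)
    (hf : f.ev s = v) (hu : u ≤ m + 1) :
    (wr2 a e f g).ev s = s.setA a (u * (m + 1) + v) (g.ev s) :=
  ev_wr2_of_row E.row a he hf hu

theorem mat_setA (a b u v u' v' : ℕ) (z : ℤ) (s : St) (hv : v < m + 1) (hv' : v' < m + 1) :
    mat m b (s.setA a (u * (m + 1) + v) z) u' v' =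
      if b = a ∧ u' = u ∧ v' = v then z else mat m b s u' v' := by
  unfold mat
  rw [St.setA_arr]
  refine if_congr (and_congr_right fun _ => ⟨fun h => index_inj hv' hv h, fun h => ?_⟩) rfl rfl
  rw [h.1, h.2]

@[simp] theorem mat_setR (m a i : ℕ) (z : ℤ) (s : St) : mat m a (s.setR i z) = mat m a s := rfl

theorem setA_arr_self (s : St) (a i : ℕ) (z : ℤ) :
    (s.setA a i z).arr a = Function.update (s.arr a) i z := by simp [St.setA]

theorem resCode_spec (E : Env m H I p U sc s) : ∀ u < m + 1, ∀ v < m + 1,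
    mat m 7 (resCode.ev s) u v = resCost p U I (s.reg 8) (mat m 6 s) u v := by
  refine (Cm.for2_fill (a := 7) s E.hK (by decide) (by decide) (by decide) (by decide) (by decide)
    (by decide) (fun u v => u * (m + 1) + v) _ (fun u _ v hv u' _ v' hv' h => index_inj hv hv' h)
    ?_).1
  intro u hu v hv t ht htu htv
  have Et := E.of_keeps ht (by decide) (by decide)
  have h6 : mat m 6 t = mat m 6 s := by unfold mat; rw [ht.2 6 (by decide)]
  have h8 : t.reg 8 = s.reg 8 := ht.1 8 (by decide)
  have e6 := ev_rd2 Et 6 (e := .r 9) (f := .r 10) htu htv (by omega)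
  have e3 := ev_rd2 Et 3 (e := .r 9) (f := .r 10) htu htv (by omega)
  have e4 := ev_rd2 Et 4 (e := .r 9) (f := .r 10) htu htv (by omega)
  have e4' := ev_rd2 Et 4 (e := .r 10) (f := .r 9) htv htu (by omega)
  have w := fun g => ev_wr2 Et 7 (e := .r 9) (f := .r 10) (g := g) htu htv (by omega)
  rw [h6] at e6
  rw [Et.cap u hu v hv] at e3
  rw [Et.price u hu v hv] at e4
  rw [Et.price v hv u hu] at e4'
  unfold resCost
  have hc : ∀ e : Ex, e = .add (rd2 6 (.r 9) (.r 10)) (.r 8) →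
      e.ev t = mat m 6 s u v + s.reg 8 := by
    rintro e rfl; rw [Ex.ev, e6, Ex.ev, h8]
  split_ifs with h1 h2
  · rw [Cm.ev_ite_pos (by rwa [hc _ rfl]), Cm.ev_ite_pos (by rw [Ex.ev, hc _ rfl, e3]; exact h2), w,
      setA_arr_self, Ex.ev, Et.hI]
  · rw [Cm.ev_ite_pos (by rwa [hc _ rfl]), Cm.ev_ite_neg (by rw [Ex.ev, hc _ rfl, e3]; exact h2), w,
      setA_arr_self, e4]
  · rw [Cm.ev_ite_neg (by rwa [hc _ rfl]), w, setA_arr_self, Ex.ev, Ex.ev, e4']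

/-- The minimum is initialised with the walk that waits at `v`; its loop is free, so it is a genuine
candidate and no infinite value is needed. -/
theorem relaxCode_spec (E : Env m H I p U sc s) {k v : ℕ} (hk : k < m + 1) (hv : v < m + 1)
    (hsk : s.reg 11 = k) (hsv : s.reg 10 = v) (hC : mat m 7 s v v = 0) :
    ∃ u < m + 1, (relaxCode.ev s).reg 13 = u ∧
      (relaxCode.ev s).reg 12 = mat m 8 s k u + mat m 7 s u v ∧
      ∀ w < m + 1, (relaxCode.ev s).reg 12 ≤ mat m 8 s k w + mat m 7 s w v := by
  have e8 := ev_rd2 E 8 (e := .r 11) (f := .r 10) hsk hsv (by omega)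
  unfold relaxCode
  rw [Cm.ev, Cm.ev, Cm.ev, Cm.ev, e8]
  set s' := (s.setR 12 (mat m 8 s k v)).setR 13
    ((Ex.r 10).ev (s.setR 12 (mat m 8 s k v))) with hs'
  have E' : Env m H I p U sc s' := (E.setR _ (by decide)).setR _ (by decide)
  have h := Cm.for_inv (i := 9) (N := 1) s' E'.hK (by decide)
    (B := .seq (.set 14 (.add (rd2 8 (.r 11) (.r 9)) (rd2 7 (.r 9) (.r 10)))) <|
      .ite (.sub (.r 12) (.r 14)) (.seq (.set 12 (.r 14)) (.set 13 (.r 9))) .skip) (by decide)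
    (fun j t => ∃ u < m + 1, t.reg 13 = u ∧ t.reg 12 = mat m 8 s k u + mat m 7 s u v ∧
      ∀ w < j, t.reg 12 ≤ mat m 8 s k w + mat m 7 s w v)
    ⟨v, hv, by simp [hs', Ex.ev, hsv], by simp [hs', hC], by simp⟩ ?_
  · exact h
  · rintro j hj t ht htj ⟨u, hu, h13, h12, hmin⟩
    have Et := E'.of_keeps ht (by decide) (by decide)
    have h8 : mat m 8 t = mat m 8 s := by unfold mat; rw [ht.2 8 (by decide)]; rfl
    have h7 : mat m 7 t = mat m 7 s := by unfold mat; rw [ht.2 7 (by decide)]; rfl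
    have h11 : t.reg 11 = k := by rw [ht.1 11 (by decide)]; simpa [hs'] using hsk
    have h10 : t.reg 10 = v := by rw [ht.1 10 (by decide)]; simpa [hs'] using hsv
    have e8 := ev_rd2 Et 8 (e := .r 11) (f := .r 9) h11 htj (by omega)
    have e7 := ev_rd2 Et 7 (e := .r 9) (f := .r 10) htj h10 (by omega)
    rw [Cm.ev, Cm.ev, Ex.ev, e8, e7, h8, h7]
    set t' := t.setR 14 (mat m 8 s k j + mat m 7 s j v) with ht'
    have hc : (Ex.sub (.r 12) (.r 14)).ev t' = t.reg 12 - (mat m 8 s k j + mat m 7 s j v) := by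
      simp [Ex.ev, ht']
    by_cases hlt : mat m 8 s k j + mat m 7 s j v < t.reg 12
    · rw [Cm.ev_ite_pos (by rw [hc]; omega)]
      refine ⟨j, hj, by simp [Cm.ev, Ex.ev, ht', htj], by simp [Cm.ev, Ex.ev, ht'], ?_⟩
      intro w hw
      simp only [Cm.ev, Ex.ev, ht', St.setR_reg]
      norm_num
      rcases Nat.lt_succ_iff_lt_or_eq.mp hw with h | rfl
      · exact hlt.le.trans (hmin w h)
      · exact le_rfl
    · rw [Cm.ev_ite_neg (by rw [hc]; omega)]
      refine ⟨u, hu, by simpa [Cm.ev, ht'] using h13, by simpa [Cm.ev, ht'] using h12, ?_⟩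
      intro w hw
      simp only [Cm.ev, ht', St.setR_reg]
      norm_num
      rcases Nat.lt_succ_iff_lt_or_eq.mp hw with h | rfl
      · exact hmin w h
      · omega

/-- The entries `(k + 1, v)` of the table are correct. -/
def Relaxed (m : ℕ) (C : ℕ → ℕ → ℤ) (t : St) (k v : ℕ) : Prop :=
  ∃ u < m + 1, mat m 9 t (k + 1) v = u ∧ mat m 8 t (k + 1) v = mat m 8 t k u + C u v ∧
    ∀ w < m + 1, mat m 8 t (k + 1) v ≤ mat m 8 t k w + C w v

/-- All writes go to row `k + 1`, that is, to indices from `(k + 1) * (m + 1)` on, so the earlier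
rows survive. -/
theorem layerCode_spec (E : Env m H I p U sc s) {k : ℕ} (hk : k < m + 1)
    (hsk : s.reg 11 = k) (hC : ∀ v < m + 1, mat m 7 s v v = 0) :
    (∀ x < (k + 1) * (m + 1), (layerCode.ev s).arr 8 x = s.arr 8 x ∧
      (layerCode.ev s).arr 9 x = s.arr 9 x) ∧
    ∀ v < m + 1, Relaxed m (mat m 7 s) (layerCode.ev s) k v := by
  refine Cm.for_inv s E.hK (by decide) (by decide) (fun j t =>
    (∀ x < (k + 1) * (m + 1), t.arr 8 x = s.arr 8 x ∧ t.arr 9 x = s.arr 9 x) ∧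
    ∀ v < j, Relaxed m (mat m 7 s) t k v) ⟨by simp, by simp⟩ ?_
  rintro j hj t ht htj ⟨hlow, hrel⟩
  have Et := E.of_keeps ht (by decide) (by decide)
  have h7 : mat m 7 t = mat m 7 s := by unfold mat; rw [ht.2 7 (by decide)]
  have h11 : t.reg 11 = k := by rw [ht.1 11 (by decide)]; exact hsk
  obtain ⟨u, hu, h13, h12, hmin⟩ := relaxCode_spec Et hk hj h11 htj (by rw [h7]; exact hC j hj)
  rw [Cm.ev, Cm.ev]
  set r := relaxCode.ev t with hr
  have Er : Env m H I p U sc r := Et.ev (by decide) (by decide)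
  have r10 : r.reg 10 = j := by rw [hr, Cm.ev_reg _ 10 (by decide), htj]
  have r11 : r.reg 11 = k := by rw [hr, Cm.ev_reg _ 11 (by decide), h11]
  have r8 : r.arr 8 = t.arr 8 := Cm.ev_arr _ 8 (by decide) t
  have r9 : r.arr 9 = t.arr 9 := Cm.ev_arr _ 9 (by decide) t
  have w8 := ev_wr2 Er 8 (e := .add (.r 11) (.c 1)) (f := .r 10) (g := .r 12) (u := k + 1) (v := j)
    (by simp [Ex.ev, r11]) r10 (by omega)
  rw [w8, Ex.ev]
  have E2 : Env m H I p U sc ((wr2 8 (.add (.r 11) (.c 1)) (.r 10) (.r 12)).ev r) :=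
    Er.ev (by decide) (by decide)
  rw [w8, Ex.ev] at E2
  have w9 := ev_wr2 E2 9 (e := .add (.r 11) (.c 1)) (f := .r 10) (g := .r 13) (u := k + 1) (v := j)
    (by simp [Ex.ev, r11]) r10 (by omega)
  rw [w9, Ex.ev]
  rw [h7] at hmin h12
  set q := ((r.setA 8 ((k + 1) * (m + 1) + j) (r.reg 12)).setA 9 ((k + 1) * (m + 1) + j)
    ((r.setA 8 ((k + 1) * (m + 1) + j) (r.reg 12)).reg 13)).setR 10 (j + 1) with hq
  have q8 : ∀ k' v', v' < m + 1 → mat m 8 q k' v' =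
      if k' = k + 1 ∧ v' = j then r.reg 12 else mat m 8 t k' v' := by
    intro k' v' hv'
    simp [hq, mat_setA _ _ _ _ _ _ _ _ hj hv', show mat m 8 r = mat m 8 t by unfold mat; rw [r8]]
  have q9 : ∀ k' v', v' < m + 1 → mat m 9 q k' v' =
      if k' = k + 1 ∧ v' = j then r.reg 13 else mat m 9 t k' v' := by
    intro k' v' hv'
    simp [hq, mat_setA _ _ _ _ _ _ _ _ hj hv', show mat m 9 r = mat m 9 t by unfold mat; rw [r9]]
  refine ⟨fun x hx => ?_, fun v hv => ?_⟩
  · have hne : x ≠ (k + 1) * (m + 1) + j := by omega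
    simp [hq, hne, r8, r9, hlow x hx]
  · have hv1 : v < m + 1 := by omega
    have hk1 : ¬ k = k + 1 := by omega
    rcases Nat.lt_succ_iff_lt_or_eq.mp hv with h | rfl
    · obtain ⟨u, hu, h9, h8, hmin⟩ := hrel v h
      refine ⟨u, hu, ?_, ?_, fun w hw => ?_⟩
      · rw [q9 _ _ hv1, if_neg (by omega), h9]
      · rw [q8 _ _ hv1, q8 _ _ hu, if_neg (by omega), if_neg (by omega), h8]
      · rw [q8 _ _ hv1, q8 _ _ hw, if_neg (by omega), if_neg (by omega)]; exact hmin w hw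
    · refine ⟨u, hu, ?_, ?_, fun w hw => ?_⟩
      · rw [q9 _ _ hv1, if_pos ⟨rfl, rfl⟩, h13]
      · rw [q8 _ _ hv1, q8 _ _ hu, if_pos ⟨rfl, rfl⟩, if_neg (by omega), h12]
      · rw [q8 _ _ hv1, q8 _ _ hw, if_pos ⟨rfl, rfl⟩, if_neg (by omega)]; exact hmin w hw

end Borda

/-! ### Finding and cancelling a negative cycle -/

namespace Borda

open Finset Circ

variable {m H : ℕ} {I : ℤ} {p U : ℕ → ℕ → ℤ} {sc : ℕ → ℤ} {s : St}

/-- The parents. -/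
def parent (m : ℕ) (s : St) : ℕ → ℕ → ℕ := fun k v => (mat m 9 s k v).toNat

theorem tableCode_spec (E : Env m H I p U sc s) (hC : ∀ v < m + 1, mat m 7 s v v = 0) :
    IsTable (m + 1) (mat m 7 s) (mat m 8 (tableCode.ev s)) (parent m (tableCode.ev s)) ∧
      ∀ k < m + 1, ∀ v < m + 1, mat m 9 (tableCode.ev s) (k + 1) v =
        parent m (tableCode.ev s) (k + 1) v := by
  rw [tableCode, Cm.ev]
  have hfill := (Cm.for_fill (i := 10) (N := 1) (a := 8) (B := wr2 8 (.c 0) (.r 10) (.c 0)) s E.hK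
    (by decide) (by decide) (fun v => 0 * (m + 1) + v) (fun _ => 0) (by intros; omega) (by
      intro k hk t ht htk
      have Et := E.of_keeps ht (by decide) (by decide)
      rw [ev_wr2 Et 8 (e := .c 0) (f := .r 10) (u := 0) rfl htk (by omega), setA_arr_self]
      rfl)).1
  have E1 : Env m H I p U sc ((Cm.for 10 1 (wr2 8 (.c 0) (.r 10) (.c 0))).ev s) :=
    E.ev (by decide) (by decide)
  have h71 := Cm.ev_arr (Cm.for 10 1 (wr2 8 (.c 0) (.r 10) (.c 0))) 7 (by decide) s
  set s1 := (Cm.for 10 1 (wr2 8 (.c 0) (.r 10) (.c 0))).ev s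
  have h7 : mat m 7 s1 = mat m 7 s := by unfold mat; rw [h71]
  have key := Cm.for_inv (i := 11) (N := 1) (B := layerCode) s1 E1.hK (by decide) (by decide)
    (fun k t => (∀ v < m + 1, mat m 8 t 0 v = 0) ∧
      ∀ k' < k, ∀ v < m + 1, Relaxed m (mat m 7 s) t k' v) ⟨hfill, by simp⟩ (by
    rintro k hk t ht htk ⟨h0, hrel⟩
    have Et := E1.of_keeps ht (by decide) (by decide)
    have ht7 : mat m 7 t = mat m 7 s := by rw [← h7]; unfold mat; rw [ht.2 7 (by decide)]
    obtain ⟨hlow, hnew⟩ := layerCode_spec Et hk htk (by rw [ht7]; exact hC)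
    rw [ht7] at hnew
    have hidx : ∀ k' ≤ k, ∀ v < m + 1, k' * (m + 1) + v < (k + 1) * (m + 1) := by
      intro k' hk' v hv
      have := Nat.mul_le_mul_right (m + 1) hk'
      rw [Nat.succ_mul]; omega
    have h8 : ∀ k' ≤ k, ∀ v < m + 1, mat m 8 (layerCode.ev t) k' v = mat m 8 t k' v :=
      fun k' hk' v hv => (hlow _ (hidx k' hk' v hv)).1
    have h9 : ∀ k' ≤ k, ∀ v < m + 1, mat m 9 (layerCode.ev t) k' v = mat m 9 t k' v :=
      fun k' hk' v hv => (hlow _ (hidx k' hk' v hv)).2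
    refine ⟨fun v hv => by rw [mat_setR, h8 0 (by omega) v hv, h0 v hv], fun k' hk' v hv => ?_⟩
    rcases Nat.lt_succ_iff_lt_or_eq.mp hk' with h | rfl
    · obtain ⟨u, hu, h1, h2, h3⟩ := hrel k' h v hv
      refine ⟨u, hu, ?_, ?_, fun w hw => ?_⟩
      · rw [mat_setR, h9 _ (by omega) v hv, h1]
      · rw [mat_setR, h8 _ (by omega) v hv, h8 _ (by omega) u hu, h2]
      · rw [mat_setR, h8 _ (by omega) v hv, h8 _ (by omega) w hw]; exact h3 w hw
    · exact hnew v hv)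
  obtain ⟨h0, hrel⟩ := key
  set r := (Cm.for 11 1 layerCode).ev s1
  refine ⟨⟨h0, fun k hk v hv => ?_, fun k hk v hv => ?_, fun k hk u hu v hv => ?_⟩,
    fun k hk v hv => ?_⟩ <;> obtain ⟨w, hw, h1, h2, h3⟩ := hrel k hk v hv
  · simpa [parent, h1] using hw
  · simpa [parent, h1] using h2
  · exact h3 u hu
  · simp [parent, h1]

theorem detectCode_spec (E : Env m H I p U sc s) :
    ((detectCode.ev s).reg 15 = 1 ∧ ∃ v < m + 1, (detectCode.ev s).reg 16 = v ∧
      mat m 8 s (m + 1) v < mat m 8 s m v) ∨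
    ((detectCode.ev s).reg 15 = 0 ∧ ∀ v < m + 1, ¬ mat m 8 s (m + 1) v < mat m 8 s m v) := by
  rw [detectCode, Cm.ev, Cm.ev]
  set s1 := (Cm.set 16 (.c 0)).ev ((Cm.set 15 (.c 0)).ev s) with hs1
  have E1 : Env m H I p U sc s1 := (E.setR _ (by decide)).setR _ (by decide)
  refine Cm.for_inv (i := 10) (N := 1) s1 E1.hK (by decide) (by decide) (fun k t =>
    (t.reg 15 = 1 ∧ ∃ v < m + 1, t.reg 16 = v ∧ mat m 8 s (m + 1) v < mat m 8 s m v) ∨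
    (t.reg 15 = 0 ∧ ∀ v < k, ¬ mat m 8 s (m + 1) v < mat m 8 s m v))
    (Or.inr ⟨by simp [hs1, Cm.ev, Ex.ev], by simp⟩) ?_
  intro k hk t ht htk hI
  have Et := E1.of_keeps ht (by decide) (by decide)
  have h8 : mat m 8 t = mat m 8 s := by unfold mat; rw [ht.2 8 (by decide)]; rfl
  have e1 := ev_rd2 Et 8 (e := .r 0) (f := .r 10) Et.hm htk (by omega)
  have e2 := ev_rd2 Et 8 (e := .r 1) (f := .r 10) Et.hK htk (by omega)
  have hc : ((rd2 8 (.r 0) (.r 10)).sub (rd2 8 (.r 1) (.r 10))).ev t =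
      mat m 8 s m k - mat m 8 s (m + 1) k := by rw [Ex.ev, e1, e2, h8]
  by_cases h : mat m 8 s (m + 1) k < mat m 8 s m k
  · rw [Cm.ev_ite_pos (by rw [hc]; omega)]
    exact Or.inl ⟨by simp [Cm.ev, Ex.ev], k, hk, by simp [Cm.ev, Ex.ev, htk], h⟩
  · rw [Cm.ev_ite_neg (by rw [hc]; omega)]
    rcases hI with ⟨h1, v, hv, h2, h3⟩ | ⟨h1, h2⟩
    · exact Or.inl ⟨by simpa [Cm.ev] using h1, v, hv, by simpa [Cm.ev] using h2, h3⟩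
    · refine Or.inr ⟨by simpa [Cm.ev] using h1, fun v hv => ?_⟩
      rcases Nat.lt_succ_iff_lt_or_eq.mp hv with h' | rfl
      · exact h2 v h'
      · exact h

theorem walkCode_spec (E : Env m H I p U sc s) {v : ℕ} (hv : v < m + 1) (hsv : s.reg 16 = v)
    (hpar : ∀ k < m + 1, ∀ v < m + 1, mat m 9 s (k + 1) v = parent m s (k + 1) v)
    (hlt : ∀ k < m + 1, ∀ v < m + 1, parent m s (k + 1) v < m + 1) :
    ∃ a : ℕ → ℕ, a 0 = v ∧ (∀ i ≤ m + 1, a i < m + 1) ∧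
      (∀ i < m + 1, a (i + 1) = parent m s (m + 1 - i) (a i)) ∧
      ∀ i ≤ m + 1, (walkCode.ev s).arr 10 i = a i := by
  rw [walkCode, Cm.ev]
  set s1 := (Cm.wr 10 (.c 0) (.r 16)).ev s with hs1
  have E1 : Env m H I p U sc s1 := E.ev (by decide) (by decide)
  obtain ⟨a, ha0, hasucc⟩ : ∃ a : ℕ → ℕ, a 0 = v ∧
      ∀ i, a (i + 1) = parent m s (m + 1 - i) (a i) :=
    ⟨fun i => Nat.rec v (fun i x => parent m s (m + 1 - i) x) i, rfl, fun _ => rfl⟩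
  have ha : ∀ i ≤ m + 1, a i < m + 1 := by
    intro i
    induction i with
    | zero => intro _; rwa [ha0]
    | succ i ih =>
      intro hi
      rw [hasucc]
      have := hlt (m - i) (by omega) (a i) (ih (by omega))
      rwa [show m - i + 1 = m + 1 - i by omega] at this
  refine ⟨a, ha0, ha, fun i _ => hasucc i, ?_⟩
  have := Cm.for_inv (i := 17) (N := 1) s1
    (B := .wr 10 (.add (.r 17) (.c 1)) (rd2 9 (.sub (.r 1) (.r 17)) (.rd 10 (.r 17)))) E1.hK
    (by decide) (by decide) (fun k t => ∀ i ≤ k, t.arr 10 i = ((a i : ℕ) : ℤ))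
    (by intro i hi; obtain rfl : i = 0 := by omega
        simp [hs1, Cm.ev, Ex.ev, hsv, ha0]) (by
    intro k hk t ht htk hI i hi
    have Et := E1.of_keeps ht (by decide) (by decide)
    have h9 : mat m 9 t = mat m 9 s := by unfold mat; rw [ht.2 9 (by decide)]; rfl
    have e9 := ev_rd2 Et 9 (e := .sub (.r 1) (.r 17)) (f := .rd 10 (.r 17)) (u := m + 1 - k)
      (v := a k) (by simp only [Ex.ev, Et.hK, htk]; omega)
      (by simp only [Ex.ev, htk, Int.toNat_natCast]; exact hI k le_rfl) (by omega)
    have h1 := hpar (m - k) (by omega) (a k) (ha k (by omega))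
    rw [show m - k + 1 = m + 1 - k by omega] at h1
    rw [Cm.ev, e9, h9, h1]
    have h2 : ((Ex.r 17).add (.c 1)).ev t = ((k + 1 : ℕ) : ℤ) := by simp [Ex.ev, htk]
    rw [h2, Int.toNat_natCast, St.setR_arr, St.setA_arr]
    split_ifs with h
    · rw [h.2, hasucc]
    · exact hI i (by omega))
  exact this

/-- Pigeonhole: `m + 2` positions, `m + 1` nodes. Array `11` stores positions plus one, so that `0`
means unseen. Register `18` freezes the search at the first repetition, and therefore all nodes
before `hi` are distinct. -/
theorem cycleCode_spec (E : Env m H I p U sc s) {a : ℕ → ℕ} (ha : ∀ i ≤ m + 1, a i < m + 1)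
    (hs : ∀ i ≤ m + 1, s.arr 10 i = a i) :
    ∃ lo hi, lo < hi ∧ hi ≤ m + 1 ∧ a lo = a hi ∧ (∀ i < hi, ∀ j < hi, a i = a j → i = j) ∧
      (cycleCode.ev s).reg 19 = lo ∧ (cycleCode.ev s).reg 20 = hi := by
  rw [cycleCode, Cm.ev, Cm.ev, Cm.ev, Cm.ev]
  have hfill := (Cm.for_fill (i := 10) (N := 1) (a := 11) (B := .wr 11 (.r 10) (.c 0)) s E.hK
    (by decide) (by decide) (fun v => v) (fun _ => 0) (by intros; omega) (by
      intro k hk t ht htk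
      simp [Cm.ev, Ex.ev, htk, setA_arr_self])).1
  have E1 : Env m H I p U sc ((Cm.for 10 1 (.wr 11 (.r 10) (.c 0))).ev s) :=
    E.ev (by decide) (by decide)
  have h10 := Cm.ev_arr (Cm.for 10 1 (.wr 11 (.r 10) (.c 0))) 10 (by decide) s
  set s1 := (Cm.for 10 1 (.wr 11 (.r 10) (.c 0))).ev s
  set s2 := (Cm.set 20 (.c 0)).ev ((Cm.set 19 (.c 0)).ev ((Cm.set 18 (.c 0)).ev s1)) with hs2
  have E2 : Env m H I p U sc s2 :=
    ((E1.setR _ (by decide)).setR _ (by decide)).setR _ (by decide)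
  have key := Cm.for_inv (i := 17) (N := 2) s2
    (B := .ite (.r 18) .skip <| .ite (.rd 11 (.rd 10 (.r 17)))
      (.seq (.set 18 (.c 1)) <| .seq (.set 19 (.sub (.rd 11 (.rd 10 (.r 17))) (.c 1)))
        (.set 20 (.r 17)))
      (.wr 11 (.rd 10 (.r 17)) (.add (.r 17) (.c 1)))) E2.hK1
    (by decide) (by decide) (fun k t =>
      (t.reg 18 = 0 ∧ (∀ i < k, ∀ j < k, a i = a j → i = j) ∧
        ∀ v < m + 1, (t.arr 11 v = 0 ∧ ∀ j < k, a j ≠ v) ∨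
          ∃ q < k, a q = v ∧ t.arr 11 v = q + 1) ∨
      (t.reg 18 = 1 ∧ ∃ lo hi, lo < hi ∧ hi ≤ m + 1 ∧ a lo = a hi ∧
        (∀ i < hi, ∀ j < hi, a i = a j → i = j) ∧ t.reg 19 = lo ∧ t.reg 20 = hi))
    (Or.inl ⟨by simp [hs2, Cm.ev, Ex.ev], by simp, fun v hv => Or.inl
      ⟨by simpa [hs2, Cm.ev] using hfill v hv, by simp⟩⟩) (by
    intro k hk t ht htk hI
    have Et := E2.of_keeps ht (by decide) (by decide)
    have ht10 : t.arr 10 k = a k := by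
      rw [ht.2 10 (by decide)]
      exact (congrFun h10 k).trans (hs k (by omega))
    rcases hI with ⟨h18, hinj, hlast⟩ | ⟨h18, hrest⟩
    · rw [Cm.ev_ite_neg (by simp [Ex.ev, h18])]
      have hc : (Ex.rd 11 (.rd 10 (.r 17))).ev t = t.arr 11 (a k) := by
        simp [Ex.ev, htk, ht10]
      rcases hlast (a k) (ha k (by omega)) with ⟨h1, h2⟩ | ⟨q, hq, h1, h2⟩
      · rw [Cm.ev_ite_neg (by rw [hc, h1]; omega)]
        refine Or.inl ⟨by simpa [Cm.ev] using h18, ?_, fun v hv => ?_⟩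
        · intro i hi j hj hij
          rcases Nat.lt_succ_iff_lt_or_eq.mp hi with hi' | rfl <;>
            rcases Nat.lt_succ_iff_lt_or_eq.mp hj with hj' | rfl
          · exact hinj i hi' j hj' hij
          · exact absurd hij (h2 i hi')
          · exact absurd hij.symm (h2 j hj')
          · rfl
        · by_cases hva : v = a k
          · exact Or.inr ⟨k, by omega, hva.symm, by simp [Cm.ev, Ex.ev, htk, ht10, hva]⟩
          · rcases hlast v hv with ⟨h3, h4⟩ | ⟨q, hq, h3, h4⟩
            · refine Or.inl ⟨by simpa [Cm.ev, Ex.ev, htk, ht10, hva] using h3, fun j hj => ?_⟩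
              rcases Nat.lt_succ_iff_lt_or_eq.mp hj with hj' | rfl
              · exact h4 j hj'
              · exact fun h => hva h.symm
            · exact Or.inr ⟨q, by omega, h3, by simpa [Cm.ev, Ex.ev, htk, ht10, hva] using h4⟩
      · rw [Cm.ev_ite_pos (by rw [hc, h2]; omega)]
        refine Or.inr ⟨by simp [Cm.ev, Ex.ev], q, k, hq, by omega, h1, hinj, ?_, ?_⟩
        · simp [Cm.ev, Ex.ev, htk, ht10, h2]
        · simp [Cm.ev, Ex.ev, htk]
    · rw [Cm.ev_ite_pos (by simp [Ex.ev, h18])]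
      obtain ⟨lo, hi, h1, h2, h3, h4, h5, h6⟩ := hrest
      exact Or.inr ⟨by simpa [Cm.ev] using h18, lo, hi, h1, h2, h3, h4, by simpa [Cm.ev] using h5,
        by simpa [Cm.ev] using h6⟩)
  rcases key with ⟨_, hinj, _⟩ | ⟨_, h⟩
  · exfalso
    have := Finset.card_le_card_of_injOn (s := range (m + 2)) (t := range (m + 1)) a
      (fun i hi => by simpa using ha i (by simp at hi; omega))
      (fun i hi j hj h => hinj i (by simpa using hi) j (by simpa using hj) h)
    simp at this
  · exact h

theorem pushCode_spec (E : Env m H I p U sc s) {a : ℕ → ℕ} (ha : ∀ i ≤ m + 1, a i < m + 1)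
    (hs : ∀ i ≤ m + 1, s.arr 10 i = a i) {lo hi : ℕ} (hlo : lo < hi) (hhi : hi ≤ m + 1)
    (hne : ∀ i, lo ≤ i → i < hi → a (i + 1) ≠ a i)
    (h19 : s.reg 19 = lo) (h20 : s.reg 20 = hi) :
    ∀ u < m + 1, ∀ v < m + 1, mat m 6 (pushCode.ev s) u v =
      pushSeq (s.reg 8) (fun i => a (lo + i)) (mat m 6 s) (hi - lo) u v := by
  have key := Cm.for_inv (i := 17) (N := 1) s
    (B := .ite (.sub (.r 20) (.r 17)) (.ite (.sub (.add (.r 17) (.c 1)) (.r 19))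
    (.seq (wr2 6 (.rd 10 (.add (.r 17) (.c 1))) (.rd 10 (.r 17))
        (.add (rd2 6 (.rd 10 (.add (.r 17) (.c 1))) (.rd 10 (.r 17))) (.r 8)))
      (wr2 6 (.rd 10 (.r 17)) (.rd 10 (.add (.r 17) (.c 1)))
        (.sub (rd2 6 (.rd 10 (.r 17)) (.rd 10 (.add (.r 17) (.c 1)))) (.r 8))))
    .skip) .skip) E.hK (by decide) (by decide)
    -- The loop visits all positions, because `lo` and `hi` are not admitted as loop bounds; the
    -- truncated difference counts the positions of the cycle already passed.
    (fun k t => ∀ u < m + 1, ∀ v < m + 1, mat m 6 t u v =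
      pushSeq (s.reg 8) (fun i => a (lo + i)) (mat m 6 s) (min k hi - lo) u v)
    (by simp [pushSeq]) (by
    intro k hk t ht htk hI u hu v hv
    have Et := E.of_keeps ht (by decide) (by decide)
    have t10 : ∀ i ≤ m + 1, t.arr 10 i = a i := fun i hi => by
      rw [ht.2 10 (by decide)]; exact hs i hi
    have t8 : t.reg 8 = s.reg 8 := ht.1 8 (by decide)
    have t19 : t.reg 19 = lo := by rw [ht.1 19 (by decide), h19]
    have t20 : t.reg 20 = hi := by rw [ht.1 20 (by decide), h20]
    by_cases hk1 : k < hi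
    · rw [Cm.ev_ite_pos (by simp only [Ex.ev, t20, htk]; omega)]
      by_cases hk2 : lo ≤ k
      · rw [Cm.ev_ite_pos (by simp only [Ex.ev, t19, htk]; omega)]
        have hne' := hne k hk2 hk1
        have hx := ha (k + 1) (by omega)
        have hy := ha k (by omega)
        have v1 : ∀ t' : St, t'.arr 10 = t.arr 10 → t'.reg 17 = k →
            (Ex.rd 10 (.r 17)).ev t' = a k := by
          intro t' h1 h2; simp [Ex.ev, h1, h2, t10 k (by omega)]
        have v2 : ∀ t' : St, t'.arr 10 = t.arr 10 → t'.reg 17 = k →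
            (Ex.rd 10 (.add (.r 17) (.c 1))).ev t' = a (k + 1) := by
          intro t' h1 h2
          simp only [Ex.ev, h1, h2]
          rw [show ((k : ℤ) + 1).toNat = k + 1 by omega, t10 (k + 1) (by omega)]
        have w1 := ev_wr2 Et 6 (g := .add (rd2 6 (.rd 10 (.add (.r 17) (.c 1))) (.rd 10 (.r 17)))
          (.r 8)) (v2 t rfl htk) (v1 t rfl htk) (by omega)
        rw [Ex.ev, ev_rd2 Et 6 (v2 t rfl htk) (v1 t rfl htk) (by omega), Ex.ev] at w1
        rw [Cm.ev]
        have E1 := Et.ev (S := wr2 6 (.rd 10 (.add (.r 17) (.c 1))) (.rd 10 (.r 17))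
          (.add (rd2 6 (.rd 10 (.add (.r 17) (.c 1))) (.rd 10 (.r 17))) (.r 8))) (by decide)
          (by decide)
        rw [w1] at E1 ⊢
        set r := t.setA 6 (a (k + 1) * (m + 1) + a k) (mat m 6 t (a (k + 1)) (a k) + t.reg 8)
          with hr
        have r10 : r.arr 10 = t.arr 10 := by funext x; simp [hr]
        have r8 : r.reg 8 = t.reg 8 := by simp [hr]
        have r6 : mat m 6 r (a k) (a (k + 1)) = mat m 6 t (a k) (a (k + 1)) := by
          rw [hr, mat_setA _ _ _ _ _ _ _ _ hy hx, if_neg (by simp [hne'])]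
        rw [ev_wr2 E1 6 (v1 r r10 htk) (v2 r r10 htk) (by omega), Ex.ev,
          ev_rd2 E1 6 (v1 r r10 htk) (v2 r r10 htk) (by omega), Ex.ev, r6, r8, mat_setR,
          mat_setA _ _ _ _ _ _ _ _ hx hv, hr, mat_setA _ _ _ _ _ _ _ _ hy hv, t8,
          hI _ hu _ hv, hI _ hx _ hy, hI _ hy _ hx]
        rw [show min (k + 1) hi - lo = (k - lo) + 1 by omega, show min k hi - lo = k - lo by omega,
          pushSeq, push, ← add_assoc, show lo + (k - lo) = k by omega]
        simp only [true_and]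
        by_cases c1 : u = a (k + 1) ∧ v = a k
        · rw [if_neg (by rw [c1.1]; simp [hne']), if_pos c1, if_pos c1, c1.1, c1.2]
        · by_cases c2 : u = a k ∧ v = a (k + 1)
          · rw [if_pos c2, if_neg c1, if_pos c2, c2.1, c2.2]
          · rw [if_neg c2, if_neg c1, if_neg c1, if_neg c2]
      · rw [Cm.ev_ite_neg (by simp only [Ex.ev, t19, htk]; omega), Cm.ev, mat_setR, hI u hu v hv,
          show min (k + 1) hi - lo = min k hi - lo by omega]
    · rw [Cm.ev_ite_neg (by simp only [Ex.ev, t20, htk]; omega), Cm.ev, mat_setR, hI u hu v hv,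
        show min (k + 1) hi - lo = min k hi - lo by omega])
  intro u hu v hv
  have := key u hu v hv
  rwa [show min (m + 1) hi = hi by omega] at this

/-- Admissible data. -/
structure Admissible (m : ℕ) (I B : ℤ) (p U : ℕ → ℕ → ℤ) : Prop where
  price : ∀ u < m + 1, ∀ v < m + 1, 0 ≤ p u v ∧ p u v ≤ 2
  price_self : ∀ u < m + 1, p u u = 0
  cap : ∀ u < m + 1, ∀ v < m + 1, 0 ≤ U u v
  cap_self : ∀ u < m + 1, U u u = B
  big : 2 * ((m + 1 : ℕ) : ℤ) < I

theorem _root_.Circ.IsPotential.congr {K : ℕ} {C C' : ℕ → ℕ → ℤ} {π : ℕ → ℤ}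
    (h : IsPotential K C π) (hC : ∀ u < K, ∀ v < K, C u v = C' u v) : IsPotential K C' π :=
  ⟨h.1, fun u hu v hv => by rw [← hC u hu v hv]; exact h.2 u hu v hv⟩

theorem _root_.Circ.cost_congr {K : ℕ} {p X Y : ℕ → ℕ → ℤ} (h : ∀ u < K, ∀ v < K, X u v = Y u v) :
    cost K p X = cost K p Y :=
  sum_congr rfl fun u hu => sum_congr rfl fun v hv => by
    rw [h u (mem_range.mp hu) v (mem_range.mp hv)]

theorem _root_.Circ.colSum_congr {K : ℕ} {X Y : ℕ → ℕ → ℤ} (h : ∀ u < K, ∀ v < K, X u v = Y u v)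
    {v : ℕ} (hv : v < K) : colSum K X v = colSum K Y v :=
  sum_congr rfl fun u hu => h u (mem_range.mp hu) v hv

/-- The second alternative records that no potential exists at all. Hence, once a potential has been
found, later rounds are forced into the first alternative and leave the matrix alone. -/
theorem cancelCode_spec {B : ℤ} (E : Env m H I p U sc s) (A : Admissible m I B p U)
    (hX : Anti (m + 1) (mat m 6 s)) (hXU : Within (m + 1) U (mat m 6 s)) (hD : 0 < s.reg 8)
    (hDB : s.reg 8 ≤ B) :
    (IsPotential (m + 1) (resCost p U I (s.reg 8) (mat m 6 s)) (mat m 8 (cancelCode.ev s) m) ∧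
      mat m 6 (cancelCode.ev s) = mat m 6 s) ∨
    ((∀ π, ¬ IsPotential (m + 1) (resCost p U I (s.reg 8) (mat m 6 s)) π) ∧
      Anti (m + 1) (mat m 6 (cancelCode.ev s)) ∧ Within (m + 1) U (mat m 6 (cancelCode.ev s)) ∧
      cost (m + 1) p (mat m 6 (cancelCode.ev s)) ≤ cost (m + 1) p (mat m 6 s) - s.reg 8 ∧
      ∀ v < m + 1, colSum (m + 1) (mat m 6 (cancelCode.ev s)) v =
        colSum (m + 1) (mat m 6 s) v) := by
  rw [cancelCode, Cm.ev, Cm.ev, Cm.ev]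
  have hX0 : ∀ u < m + 1, mat m 6 s u u = 0 := fun u hu => by have := hX u hu u hu; omega
  have hres := resCode_spec E
  have E1 : Env m H I p U sc (resCode.ev s) := E.ev (by decide) (by decide)
  have k1 := resCode.keeps_ev s
  set s1 := resCode.ev s
  have hC0 : ∀ v < m + 1, mat m 7 s1 v v = 0 := fun v hv => by
    rw [hres v hv v hv, resCost_self (A.price_self v hv) (hX0 v hv)
      (by rw [A.cap_self v hv]; exact hDB)]
  have hC2 : ∀ u < m + 1, ∀ v < m + 1, -2 ≤ mat m 7 s1 u v := fun u hu v hv => by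
    rw [hres u hu v hv]
    exact neg_two_le_resCost (A.price u hu v hv).1 (A.price v hv u hu).2 (by have := A.big; omega)
  obtain ⟨hT, hpar⟩ := tableCode_spec E1 hC0
  have E2 : Env m H I p U sc (tableCode.ev s1) := E1.ev (by decide) (by decide)
  have k2 := tableCode.keeps_ev s1
  set s2 := tableCode.ev s1
  have hdet := detectCode_spec E2
  have E3 : Env m H I p U sc (detectCode.ev s2) := E2.ev (by decide) (by decide)
  have k3 := detectCode.keeps_ev s2
  set s3 := detectCode.ev s2
  have h36 : mat m 6 s3 = mat m 6 s := by
    unfold mat; rw [k3.2 6 (by decide), k2.2 6 (by decide), k1.2 6 (by decide)]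
  have h38 : mat m 8 s3 = mat m 8 s2 := by unfold mat; rw [k3.2 8 (by decide)]
  have h39 : mat m 9 s3 = mat m 9 s2 := by unfold mat; rw [k3.2 9 (by decide)]
  have hp3 : parent m s3 = parent m s2 := by unfold parent; rw [h39]
  have hr8 : s3.reg 8 = s.reg 8 := by
    rw [k3.1 8 (by decide), k2.1 8 (by decide), k1.1 8 (by decide)]
  rcases hdet with ⟨h15, v, hv, h16, himp⟩ | ⟨h15, hst⟩
  · right
    rw [Cm.ev_ite_pos (by simp [Ex.ev, h15]), Cm.ev, Cm.ev]
    obtain ⟨a, ha0, ha, hap, harr⟩ := walkCode_spec E3 hv h16 (by rw [h39, hp3]; exact hpar)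
      (by rw [hp3]; exact hT.par_lt)
    have E4 : Env m H I p U sc (walkCode.ev s3) := E3.ev (by decide) (by decide)
    have k4 := walkCode.keeps_ev s3
    set s4 := walkCode.ev s3
    obtain ⟨lo, hi, hlo, hhi, heq, hinj, h19, h20⟩ := cycleCode_spec E4 ha harr
    have E5 : Env m H I p U sc (cycleCode.ev s4) := E4.ev (by decide) (by decide)
    have k5 := cycleCode.keeps_ev s4
    set s5 := cycleCode.ev s4
    have h56 : mat m 6 s5 = mat m 6 s := by
      rw [← h36]; unfold mat; rw [k5.2 6 (by decide), k4.2 6 (by decide)]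
    have hr5 : s5.reg 8 = s.reg 8 := by rw [k5.1 8 (by decide), k4.1 8 (by decide), hr8]
    have hsum : ∑ i ∈ range (hi - lo), resCost p U I (s.reg 8) (mat m 6 s)
        (a (lo + (i + 1))) (a (lo + i)) < 0 := by
      refine lt_of_eq_of_lt (sum_congr rfl fun i hi' => ?_) (hT.cycle_neg hC0 ha
        (by rw [hp3] at hap; exact hap) (by rw [ha0]; exact himp) hlo hhi heq)
      rw [mem_range] at hi'
      rw [← hres _ (ha _ (by omega)) _ (ha _ (by omega))]; rfl
    have hinj' : ∀ i < hi - lo, ∀ j < hi - lo, a (lo + i) = a (lo + j) → i = j :=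
      fun i hi' j hj h => by have := hinj (lo + i) (by omega) (lo + j) (by omega) h; omega
    have hcyc : a (lo + 0) = a (lo + (hi - lo)) := by
      rw [Nat.add_zero, heq, show lo + (hi - lo) = hi by omega]
    have hpush := pushSeq_cycle (K := m + 1) (a := fun i => a (lo + i)) (c := hi - lo) A.price
      A.price_self A.cap hX hXU hD (fun u hu => by rw [A.cap_self u hu]; exact hDB) A.big
      (by omega) (by omega) (fun i hi' => ha _ (by omega)) hinj' hcyc hsum
    -- Equal neighbours would make the cycle a single loop, whose residual cost is 0 and not
    -- negative.
    have hne : ∀ i, lo ≤ i → i < hi → a (i + 1) ≠ a i := by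
      intro i hi1 hi2 h
      rcases Nat.lt_or_ge (i + 1) hi with h1 | h1
      · have := hinj _ h1 _ hi2 h; omega
      · obtain rfl : hi = i + 1 := by omega
        rw [← heq] at h
        have h3 := hinj _ (by omega) _ hi2 h
        subst h3
        rw [show lo + 1 - lo = 1 by omega, sum_range_one] at hsum
        simp only [Nat.add_zero, zero_add, ← heq] at hsum
        rw [resCost_self (A.price_self _ (ha _ (by omega))) (hX0 _ (ha _ (by omega)))
          (by rw [A.cap_self _ (ha _ (by omega))]; exact hDB)] at hsum
        omega
    have hspec := pushCode_spec E5 ha (fun i hi' => by rw [k5.2 10 (by decide)]; exact harr i hi')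
      hlo hhi hne h19 h20
    rw [h56, hr5] at hspec
    obtain ⟨p1, p2, p3, p4⟩ := hpush
    refine ⟨not_isPotential_of_cycle (a := fun i => a (lo + i)) (c := hi - lo)
      (fun i hi' => ha _ (by omega)) hcyc hsum, ?_, ?_, ?_, ?_⟩
    · intro u hu v hv
      rw [hspec u hu v hv, hspec v hv u hu]; exact p1 u hu v hv
    · intro u hu v hv
      rw [hspec u hu v hv]; exact p2 u hu v hv
    · rw [cost_congr hspec]; exact p3
    · intro v hv
      rw [colSum_congr hspec hv]; exact p4 v
  · left
    rw [Cm.ev_ite_neg (by simp [Ex.ev, h15])]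
    refine ⟨?_, h36⟩
    have := hT.isPotential hC0 hC2 hst
    rw [Cm.ev, h38]
    exact this.congr hres

end Borda

/-! ### Capacity scaling for a fixed score -/

namespace Borda

open Finset Circ

variable {m H : ℕ} {I : ℤ} {p U : ℕ → ℕ → ℤ} {sc : ℕ → ℤ} {s : St}

theorem ev_iterate_reg (f : Cm) {j : ℕ} (hf : f.modR j = false) (s : St) (k : ℕ) :
    (f.ev^[k] s).reg j = s.reg j := by
  induction k generalizing s with
  | zero => rfl
  | succ k ih => rw [Function.iterate_succ_apply, ih, f.ev_reg j hf]

/-- Nesting loops over one register multiplies the counts; five of them give `(m + 1) ^ 5` rounds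
although only `m + 1` is stored. -/
theorem ev_rep_iterate {S f : Cm} {r n j : ℕ} (hf : f.modR r = false)
    (hS : ∀ s : St, s.reg r = n → S.ev s = f.ev^[j] s) (s : St) (hs : s.reg r = n) :
    (Cm.rep r S).ev s = f.ev^[j * n] s := by
  have key : ∀ (c : ℕ) (s : St), s.reg r = n → S.ev^[c] s = f.ev^[j * c] s := by
    intro c
    induction c with
    | zero => intro s _; rfl
    | succ c ih =>
      intro s hs
      rw [Function.iterate_succ_apply, ih _ (by rw [hS s hs, ev_iterate_reg f hf, hs]), hS s hs,
        ← Function.iterate_add_apply, Nat.mul_succ]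
  have := key n s hs
  simpa [Cm.ev, hs] using this

/-- The cost exceeds the optimum at most by `g`. -/
def Gap (m : ℕ) (p U X : ℕ → ℕ → ℤ) (g : ℤ) : Prop :=
  ∀ Y, Anti (m + 1) Y → Within (m + 1) U Y →
    (∀ v < m + 1, colSum (m + 1) Y v = colSum (m + 1) X v) →
    cost (m + 1) p X - cost (m + 1) p Y ≤ g

/-- For equal inflows the potential term of `cost_gap` vanishes; the constant is half of `K ^ 2 * (2
* K + 4)` with `K = m + 1`. -/
theorem Gap.of_isPotential {B D : ℤ} {X : ℕ → ℕ → ℤ} {π : ℕ → ℤ} (A : Admissible m I B p U)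
    (hD : 1 ≤ D) (hX : Anti (m + 1) X)
    (hπ : IsPotential (m + 1) (resCost p U I D X) π) :
    Gap m p U X (((m + 1) ^ 2 * (m + 3) : ℕ) * (D - 1)) := by
  intro Y hY hYU hcol
  have h := cost_gap A.price hD hX hY hYU hπ
  rw [sum_eq_zero fun v hv => by rw [hcol v (mem_range.mp hv)]; ring] at h
  push_cast at h ⊢
  nlinarith

/-- Either each of the `k` rounds has saved one step length, or some round met a potential and
nothing has changed since. -/
theorem iterate_cancel {B : ℤ} (A : Admissible m I B p U) (k : ℕ) (s : St)
    (E : Env m H I p U sc s) (hX : Anti (m + 1) (mat m 6 s)) (hXU : Within (m + 1) U (mat m 6 s))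
    (hD : 0 < s.reg 8) (hDB : s.reg 8 ≤ B) :
    Anti (m + 1) (mat m 6 (cancelCode.ev^[k] s)) ∧
    Within (m + 1) U (mat m 6 (cancelCode.ev^[k] s)) ∧
    (∀ v < m + 1, colSum (m + 1) (mat m 6 (cancelCode.ev^[k] s)) v =
      colSum (m + 1) (mat m 6 s) v) ∧
    (cost (m + 1) p (mat m 6 (cancelCode.ev^[k] s)) ≤ cost (m + 1) p (mat m 6 s) - k * s.reg 8 ∨
      IsPotential (m + 1) (resCost p U I (s.reg 8) (mat m 6 (cancelCode.ev^[k] s)))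
        (mat m 8 (cancelCode.ev^[k] s) m)) := by
  have key : Env m H I p U sc (cancelCode.ev^[k] s) ∧ (cancelCode.ev^[k] s).reg 8 = s.reg 8 ∧
    Anti (m + 1) (mat m 6 (cancelCode.ev^[k] s)) ∧
    Within (m + 1) U (mat m 6 (cancelCode.ev^[k] s)) ∧
    (∀ v < m + 1, colSum (m + 1) (mat m 6 (cancelCode.ev^[k] s)) v =
      colSum (m + 1) (mat m 6 s) v) ∧
    (cost (m + 1) p (mat m 6 (cancelCode.ev^[k] s)) ≤ cost (m + 1) p (mat m 6 s) - k * s.reg 8 ∨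
      IsPotential (m + 1) (resCost p U I (s.reg 8) (mat m 6 (cancelCode.ev^[k] s)))
        (mat m 8 (cancelCode.ev^[k] s) m)) := by
    induction k with
    | zero => exact ⟨E, rfl, hX, hXU, fun _ _ => rfl, Or.inl (by simp)⟩
    | succ k ih =>
      obtain ⟨h1, h2, h3, h4, h5, h6⟩ := ih
      rw [Function.iterate_succ_apply']
      set t := cancelCode.ev^[k] s
      have h8 : (cancelCode.ev t).reg 8 = s.reg 8 := by rw [Cm.ev_reg _ 8 (by decide), h2]
      rcases cancelCode_spec h1 A h3 h4 (by rw [h2]; exact hD) (by rw [h2]; exact hDB) with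
        ⟨c1, c2⟩ | ⟨c1, c2, c3, c4, c5⟩
      · rw [h2] at c1
        rw [c2]
        exact ⟨h1.ev (by decide) (by decide), h8, h3, h4, h5, Or.inr c1⟩
      · refine ⟨h1.ev (by decide) (by decide), h8, c2, c3,
          fun v hv => (c5 v hv).trans (h5 v hv), ?_⟩
        rw [h2] at c1 c4
        rcases h6 with h6 | h6
        · left; push_cast; linarith
        -- A matrix that has a potential cannot have entered the pushing branch.
        · exact absurd h6 (c1 _)
  exact key.2.2

/-- The matrix written by `startCode`. -/
def startMat (m : ℕ) (sc : ℕ → ℤ) (l : ℤ) (u v : ℕ) : ℤ :=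
  if u = m then (if v = m then 0 else sc v - l) else if v = m then l - sc u else 0

theorem startCode_spec (E : Env m H I p U sc s) : ∀ u < m + 1, ∀ v < m + 1,
    mat m 6 (startCode.ev s) u v = startMat m sc (s.reg 23) u v := by
  refine (Cm.for2_fill (a := 6) s E.hK (by decide) (by decide) (by decide) (by decide) (by decide)
    (by decide) (fun u v => u * (m + 1) + v) _ (fun u _ v hv u' _ v' hv' h => index_inj hv hv' h)
    ?_).1
  intro u hu v hv t ht htu htv
  have Et := E.of_keeps ht (by decide) (by decide)
  have h23 : t.reg 23 = s.reg 23 := ht.1 23 (by decide)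
  have w := fun g => ev_wr2 Et 6 (e := .r 9) (f := .r 10) (g := g) htu htv (by omega)
  have c1 : (Ex.r 9).ev t = (Ex.r 0).ev t ↔ u = m := by
    simp only [Ex.ev, htu, Et.hm]; omega
  have c2 : (Ex.r 10).ev t = (Ex.r 0).ev t ↔ v = m := by
    simp only [Ex.ev, htv, Et.hm]; omega
  unfold startMat
  split_ifs with h1 h2 h2
  · rw [Cm.ev_ifEq_pos (c1.2 h1), Cm.ev_ifEq_pos (c2.2 h2), w, setA_arr_self]; rfl
  · rw [Cm.ev_ifEq_pos (c1.2 h1), Cm.ev_ifEq_neg (mt c2.1 h2), w, setA_arr_self]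
    simp only [Ex.ev, htv, h23, Int.toNat_natCast, Et.score v (by omega)]
  · rw [Cm.ev_ifEq_neg (mt c1.1 h1), Cm.ev_ifEq_pos (c2.2 h2), w, setA_arr_self]
    simp only [Ex.ev, htu, h23, Int.toNat_natCast, Et.score u (by omega)]
  · rw [Cm.ev_ifEq_neg (mt c1.1 h1), Cm.ev_ifEq_neg (mt c2.1 h2), w, setA_arr_self]; rfl

theorem startMat_anti (m : ℕ) (sc : ℕ → ℤ) (l : ℤ) : Anti (m + 1) (startMat m sc l) := by
  intro u _ v _
  unfold startMat
  split_ifs <;> omega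

theorem startMat_le {M : ℤ} (hM : 0 ≤ M) {l : ℤ} (h : ∀ x < m, |sc x - l| ≤ M) :
    ∀ u < m + 1, ∀ v < m + 1, startMat m sc l u v ≤ M := by
  intro u hu v hv
  unfold startMat
  split_ifs
  · exact hM
  · exact (le_abs_self _).trans (h v (by omega))
  · have := neg_abs_le (sc u - l)
    have := h u (by omega)
    omega
  · exact hM

theorem cost_nonneg {K : ℕ} {X : ℕ → ℕ → ℤ} (hp : ∀ u < K, ∀ v < K, 0 ≤ p u v) :
    0 ≤ cost K p X :=
  sum_nonneg fun u hu => sum_nonneg fun v hv =>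
    mul_nonneg (hp u (mem_range.mp hu) v (mem_range.mp hv)) (le_max_right _ _)

theorem cost_le {K : ℕ} {X : ℕ → ℕ → ℤ} {M : ℤ} (hM : 0 ≤ M)
    (hp : ∀ u < K, ∀ v < K, 0 ≤ p u v ∧ p u v ≤ 2) (hX : ∀ u < K, ∀ v < K, X u v ≤ M) :
    cost K p X ≤ K * K * (2 * M) := by
  have h1 : cost K p X ≤ ∑ u ∈ range K, ∑ v ∈ range K, 2 * M := by
    refine sum_le_sum fun u hu => sum_le_sum fun v hv => ?_
    rw [mem_range] at hu hv
    have h2 := hp u hu v hv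
    exact mul_le_mul h2.2 (max_le (hX u hu v hv) hM) (le_max_right _ _) (by norm_num)
  refine h1.trans (le_of_eq ?_)
  simp; ring

/-- The invariant of the phases: a phase with step `D` starts within `2 * G * D` of the optimum. It
ends with a potential, hence within `G * (D - 1)`, which is below `2 * G` times the next step `D /
2`. The potential of the last phase, with `D = 1`, is kept because the search needs its slope. -/
theorem solveCode_spec {B : ℤ} (E : Env m H I p U sc s) (A : Admissible m I B p U) (hm : 2 ≤ m)
    (hB : 2 ^ H ≤ B) (hsc : ∀ x < m, |sc x - s.reg 23| ≤ 2 ^ (H + 1))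
    (hU : ∀ x < m, 2 ^ (H + 1) ≤ U m x ∧ 2 ^ (H + 1) ≤ U x m) :
    Anti (m + 1) (mat m 6 (solveCode.ev s)) ∧ Within (m + 1) U (mat m 6 (solveCode.ev s)) ∧
    (∀ v < m + 1, colSum (m + 1) (mat m 6 (solveCode.ev s)) v =
      colSum (m + 1) (startMat m sc (s.reg 23)) v) ∧
    IsPotential (m + 1) (resCost p U I 1 (mat m 6 (solveCode.ev s)))
      (mat m 8 (solveCode.ev s) m) := by
  rw [solveCode, Cm.ev]
  have hst := startCode_spec E
  have E1 : Env m H I p U sc (startCode.ev s) := E.ev (by decide) (by decide)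
  set s1 := startCode.ev s
  have hle := startMat_le (m := m) (l := s.reg 23) (by positivity) hsc
  have hanti := startMat_anti m sc (s.reg 23)
  have hwith : Within (m + 1) U (startMat m sc (s.reg 23)) := by
    intro u hu v hv
    have h0 := A.cap u hu v hv
    have h1 := hle u hu v hv
    by_cases hum : u = m
    · by_cases hvm : v = m
      · have h2 : startMat m sc (s.reg 23) u v = 0 := by simp [startMat, hum, hvm]
        rwa [h2]
      · exact h1.trans (hum ▸ (hU v (by omega)).1)
    · by_cases hvm : v = m
      · exact h1.trans (hvm ▸ (hU u (by omega)).2)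
      · simpa [startMat, hum, hvm] using h0
  have hK : ((m + 1 : ℕ) : ℤ) = m + 1 := by push_cast; ring
  set G : ℕ := (m + 1) ^ 2 * (m + 3) with hG
  -- The number of rounds exceeds the gap measured in steps.
  have hT : 2 * G < (m + 1) ^ 5 := by
    have h1 : (m + 1) ^ 5 = (m + 1) ^ 2 * (m + 1) ^ 3 := by ring
    have h2 : 2 * (m + 3) < (m + 1) ^ 3 := by nlinarith [Nat.zero_le (m ^ 2), Nat.zero_le (m ^ 3)]
    rw [h1, hG]
    have h3 : 0 < (m + 1) ^ 2 := by positivity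
    nlinarith
  have key := Cm.for_inv (i := 21) (N := 3)
    (B := .seq (.set 8 (.rd 2 (.sub (.sub (.r 3) (.c 1)) (.r 21)))) <|
      .rep 1 <| .rep 1 <| .rep 1 <| .rep 1 <| .rep 1 cancelCode) s1 E1.hH (by decide) (by decide)
    (fun k t => Anti (m + 1) (mat m 6 t) ∧ Within (m + 1) U (mat m 6 t) ∧
      (∀ v < m + 1, colSum (m + 1) (mat m 6 t) v = colSum (m + 1) (startMat m sc (s.reg 23)) v) ∧
      (k ≤ H → Gap m p U (mat m 6 t) (2 * G * 2 ^ (H - k))) ∧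
      (k = H + 1 → IsPotential (m + 1) (resCost p U I 1 (mat m 6 t)) (mat m 8 t m)))
    ⟨?_, ?_, ?_, ?_, by simp⟩ ?_
  · exact ⟨key.1, key.2.1, key.2.2.1, key.2.2.2.2 rfl⟩
  · intro u hu v hv
    rw [mat_setR, hst u hu v hv, hst v hv u hu]; exact hanti u hu v hv
  · intro u hu v hv
    rw [mat_setR, hst u hu v hv]; exact hwith u hu v hv
  · intro v hv
    rw [mat_setR, colSum_congr hst hv]
  · intro _ Y _ _ _
    rw [mat_setR, cost_congr hst, Nat.sub_zero]
    have h1 := cost_le (p := p) (by positivity) A.price hle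
    have h2 := cost_nonneg (p := p) (X := Y) fun u hu v hv => (A.price u hu v hv).1
    -- Initial gap: all entries of the start are at most `2 ^ (H + 1)` and all prices at most 2,
    -- while the optimum is nonnegative.
    have h3 : (((m + 1 : ℕ) : ℤ) * ((m + 1 : ℕ) : ℤ)) * (2 * 2 ^ (H + 1)) ≤ 2 * G * 2 ^ H := by
      rw [hG, pow_succ]; push_cast
      have : (0 : ℤ) < 2 ^ H := by positivity
      have h4 : (0 : ℤ) ≤ (m + 1) * (m + 1) * 2 ^ H := by positivity
      nlinarith
    linarith
  · rintro k hk t ht htk ⟨i1, i2, i3, i4, -⟩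
    have Et := E1.of_keeps ht (by decide) (by decide)
    rw [Cm.ev]
    have hset : (Cm.set 8 (.rd 2 (.sub (.sub (.r 3) (.c 1)) (.r 21)))).ev t =
        t.setR 8 (2 ^ (H - k)) := by
      simp only [Cm.ev, Ex.ev, Et.hH, htk]
      rw [show (((H + 1 : ℕ) : ℤ) - 1 - k).toNat = H - k by omega, Et.pow _ (by omega)]
    rw [hset]
    set r := t.setR 8 (2 ^ (H - k)) with hr
    have Er : Env m H I p U sc r := Et.setR _ (by decide)
    have hc1 : cancelCode.modR 1 = false := by decide
    have hiter : (Cm.rep 1 <| .rep 1 <| .rep 1 <| .rep 1 <| .rep 1 cancelCode).ev r =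
        cancelCode.ev^[1 * (m + 1) * (m + 1) * (m + 1) * (m + 1) * (m + 1)] r :=
      ev_rep_iterate hc1 (ev_rep_iterate hc1 (ev_rep_iterate hc1 (ev_rep_iterate hc1
        (ev_rep_iterate hc1 fun _ _ => rfl)))) r Er.hK
    rw [hiter, show 1 * (m + 1) * (m + 1) * (m + 1) * (m + 1) * (m + 1) = (m + 1) ^ 5 by ring]
    have hr8 : r.reg 8 = 2 ^ (H - k) := by simp [hr]
    have hr6 : mat m 6 r = mat m 6 t := mat_setR _ _ _ _ _
    have hpos : (0 : ℤ) < 2 ^ (H - k) := by positivity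
    obtain ⟨j1, j2, j3, j4⟩ := iterate_cancel A ((m + 1) ^ 5) r Er (by rw [hr6]; exact i1)
      (by rw [hr6]; exact i2) (by rw [hr8]; exact hpos)
      (by rw [hr8]; exact (pow_le_pow_right₀ (by norm_num) (by omega)).trans hB)
    rw [hr8] at j4
    rw [hr6] at j3 j4
    have j4' : IsPotential (m + 1)
        (resCost p U I (2 ^ (H - k)) (mat m 6 (cancelCode.ev^[(m + 1) ^ 5] r)))
        (mat m 8 (cancelCode.ev^[(m + 1) ^ 5] r) m) := by
      -- Otherwise `(m + 1) ^ 5` savings of one step each would undercut the optimum.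
      refine j4.resolve_left fun hcost => ?_
      have h1 := i4 (by omega) _ j1 j2 j3
      have h2 : (2 * G : ℤ) + 1 ≤ (((m + 1) ^ 5 : ℕ) : ℤ) := by exact_mod_cast hT
      have h3 := mul_le_mul_of_nonneg_right h2 hpos.le
      linarith
    simp only [mat_setR]
    refine ⟨j1, j2, fun v hv => (j3 v hv).trans (i3 v hv), fun hk' => ?_, fun hk' => ?_⟩
    · have h1 := Gap.of_isPotential A (by omega) j1 j4'
      intro Y hY hYU hcol
      have h2 := h1 Y hY hYU hcol
      have h3 : (2 : ℤ) ^ (H - k) = 2 * 2 ^ (H - (k + 1)) := by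
        rw [show H - k = H - (k + 1) + 1 by omega, pow_succ]; ring
      rw [← hG, h3] at h2
      have h4 : (0 : ℤ) ≤ G := by positivity
      nlinarith
    · rw [show H - k = 0 by omega, pow_zero] at j4'
      exact j4'

end Borda

/-! ### Cost, slope and the bisection for the best score -/

namespace Borda

open Finset Circ

variable {m H : ℕ} {I : ℤ} {p U : ℕ → ℕ → ℤ} {sc : ℕ → ℤ} {s : St}

/-- Prices are 0, 1 or 2, so the products are formed by adding at most twice. -/
theorem costCode_spec {B : ℤ} (E : Env m H I p U sc s) (A : Admissible m I B p U) :
    (costCode.ev s).reg 25 = cost (m + 1) p (mat m 6 s) := by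
  rw [costCode, Cm.ev]
  have E1 : Env m H I p U sc ((Cm.set 25 (.c 0)).ev s) := E.setR _ (by decide)
  rw [Cm.for2_sum (r := 25) _ E1.hK (by decide) (by decide) (by decide) (by decide) (by decide)
    (by decide) (by decide) (by decide) (fun u v => p u v * max (mat m 6 s u v) 0) ?_]
  · simp [Cm.ev, Ex.ev, cost]
  intro u hu v hv t ht htu htv
  have Et := E1.of_keeps ht (by decide) (by decide)
  have e6 := ev_rd2 Et 6 (e := .r 9) (f := .r 10) htu htv (by omega)
  have e4 := ev_rd2 Et 4 (e := .r 9) (f := .r 10) htu htv (by omega)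
  rw [show mat m 6 t = mat m 6 s by unfold mat; rw [ht.2 6 (by decide)]; rfl] at e6
  rw [Et.price u hu v hv] at e4
  have hp := A.price u hu v hv
  have hadd : ∀ r : St, r.arr = t.arr → r.reg 9 = t.reg 9 → r.reg 10 = t.reg 10 →
      (rd2 6 (.r 9) (.r 10)).ev r = mat m 6 s u v := by
    intro r h1 h2 h3
    rw [← e6]; simp [rd2, Ex.ev, h1, h2, h3]
  have hpr : ∀ r : St, r.arr = t.arr → r.reg 9 = t.reg 9 → r.reg 10 = t.reg 10 →
      (rd2 4 (.r 9) (.r 10)).ev r = p u v := by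
    intro r h1 h2 h3
    rw [← e4]; simp [rd2, Ex.ev, h1, h2, h3]
  by_cases hx : 0 < mat m 6 s u v
  · rw [Cm.ev_ite_pos (by rw [e6]; exact hx), max_eq_left hx.le]
    by_cases h0 : 0 < p u v
    · rw [Cm.ev_ite_pos (by rw [e4]; exact h0), Cm.ev]
      have hset : (Cm.set 25 (.add (.r 25) (rd2 6 (.r 9) (.r 10)))).ev t =
          t.setR 25 (t.reg 25 + mat m 6 s u v) := by simp only [Cm.ev, Ex.ev, e6]
      rw [hset]
      have e6' := hadd (t.setR 25 (t.reg 25 + mat m 6 s u v)) rfl (by simp) (by simp)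
      have e4' := hpr (t.setR 25 (t.reg 25 + mat m 6 s u v)) rfl (by simp) (by simp)
      by_cases h1 : 0 < p u v - 1
      · rw [Cm.ev_ite_pos (by rw [Ex.ev, e4']; exact h1)]
        simp only [Cm.ev, Ex.ev, e6', St.setR_reg, if_true]
        rw [show p u v = 2 by omega]; ring
      · rw [Cm.ev_ite_neg (by rw [Ex.ev, e4']; exact h1)]
        simp only [Cm.ev, St.setR_reg, if_true]
        rw [show p u v = 1 by omega]; ring
    · rw [Cm.ev_ite_neg (by rw [e4]; exact h0), Cm.ev, show p u v = 0 by omega]; ring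
  · rw [Cm.ev_ite_neg (by rw [e6]; exact hx), max_eq_right (by omega), Cm.ev]; ring

theorem slopeCode_spec (E : Env m H I p U sc s) :
    (slopeCode.ev s).reg 26 = ∑ v ∈ range m, (mat m 8 s m v - mat m 8 s m m) := by
  rw [slopeCode, Cm.ev]
  have E1 : Env m H I p U sc ((Cm.set 26 (.c 0)).ev s) := E.setR _ (by decide)
  rw [Cm.for_sum (r := 26) _ E1.hm (by decide) (by decide) (by decide)
    (fun v => mat m 8 s m v - mat m 8 s m m) ?_]
  · simp [Cm.ev, Ex.ev]
  intro v hv t ht htv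
  have Et := E1.of_keeps ht (by decide) (by decide)
  have e1 := ev_rd2 Et 8 (e := .r 0) (f := .r 10) Et.hm htv (by omega)
  have e2 := ev_rd2 Et 8 (e := .r 0) (f := .r 0) Et.hm Et.hm (by omega)
  rw [show mat m 8 t = mat m 8 s by unfold mat; rw [ht.2 8 (by decide)]; rfl] at e1 e2
  simp [Cm.ev, Ex.ev, e1, e2]

theorem outCode_spec (E : Env m H I p U sc s) :
    (outCode.ev s).reg 27 = s.reg 25 ∧ (outCode.ev s).reg 28 = 1 ∧
      (outCode.ev s).arr 0 0 = -s.reg 25 ∧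
      ∀ x < m, ∀ y < m, (outCode.ev s).arr 0 (1 + x * m + y) = mat m 6 s x y := by
  simp only [outCode, Cm.ev_seq]
  have E1 : Env m H I p U sc ((Cm.wr 0 (.c 0) (.sub (.c 0) (.r 25))).ev
      ((Cm.set 28 (.c 1)).ev ((Cm.set 27 (.r 25)).ev s))) :=
    ((E.setR _ (by decide)).setR _ (by decide)).ev (by decide) (by decide)
  set s1 := (Cm.wr 0 (.c 0) (.sub (.c 0) (.r 25))).ev
      ((Cm.set 28 (.c 1)).ev ((Cm.set 27 (.r 25)).ev s)) with hs1
  have h16 : mat m 6 s1 = mat m 6 s := by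
    unfold mat; simp [hs1, Cm.ev, Ex.ev]
  obtain ⟨h1, h2⟩ := Cm.for2_fill (a := 0) s1 E1.hm (i := 9) (j := 10) (N := 0)
    (B := .wr 0 (.add (.add (.c 1) (.rd 12 (.r 9))) (.r 10)) (rd2 6 (.r 9) (.r 10)))
    (by decide) (by decide) (by decide) (by decide) (by decide)
    (by decide) (fun u v => 1 + u * m + v) (mat m 6 s)
    (fun u _ v hv u' _ v' hv' h => index_inj hv hv' (by omega)) (by
    intro u hu v hv t ht htu htv
    have Et := E1.of_keeps ht (by decide) (by decide)
    have e6 := ev_rd2 Et 6 (e := .r 9) (f := .r 10) htu htv (by omega)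
    rw [show mat m 6 t = mat m 6 s by rw [← h16]; unfold mat; rw [ht.2 6 (by decide)]] at e6
    have hi : (Ex.add (.add (.c 1) (.rd 12 (.r 9))) (.r 10)).ev t = ((1 + u * m + v : ℕ) : ℤ) := by
      simp [Ex.ev, htu, htv, Et.rowm u hu.le]
    rw [Cm.ev, hi, e6, Int.toNat_natCast, setA_arr_self])
  refine ⟨?_, ?_, ?_, h1⟩
  · rw [Cm.ev_reg _ 27 (by decide)]; simp [hs1, Cm.ev, Ex.ev]
  · rw [Cm.ev_reg _ 28 (by decide)]; simp [hs1, Cm.ev, Ex.ev]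
  · rw [h2 0 (by intros; omega)]; simp [hs1, Cm.ev, Ex.ev]

/-- Circulations for the score `l`. -/
structure Sol (m : ℕ) (U : ℕ → ℕ → ℤ) (sc : ℕ → ℤ) (l : ℤ) (X : ℕ → ℕ → ℤ) : Prop where
  anti : Anti (m + 1) X
  within : Within (m + 1) U X
  col : ∀ v < m + 1, colSum (m + 1) X v = colSum (m + 1) (startMat m sc l) v

theorem colSum_startMat_lt (l : ℤ) {v : ℕ} (hv : v < m) :
    colSum (m + 1) (startMat m sc l) v = sc v - l := by
  unfold colSum
  rw [sum_range_succ, sum_eq_zero fun u hu => ?_]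
  · simp [startMat, hv.ne]
  · have := mem_range.mp hu
    simp [startMat, hv.ne, this.ne]

theorem colSum_startMat_self (l : ℤ) :
    colSum (m + 1) (startMat m sc l) m = m * l - ∑ u ∈ range m, sc u := by
  unfold colSum
  rw [sum_range_succ, sum_congr rfl fun u hu => show startMat m sc l u m = l - sc u by
    have := mem_range.mp hu
    simp [startMat, this.ne]]
  simp [startMat]

/-- The optimum cost is convex in the score, with slope from the potentials. -/
theorem Sol.cost_le {B l l' : ℤ} {X Y : ℕ → ℕ → ℤ} {π : ℕ → ℤ} (A : Admissible m I B p U)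
    (hX : Sol m U sc l X) (hπ : IsPotential (m + 1) (resCost p U I 1 X) π)
    (hY : Sol m U sc l' Y) :
    cost (m + 1) p X + (l - l') * ∑ v ∈ range m, (π v - π m) ≤ cost (m + 1) p Y := by
  have h := cost_gap A.price le_rfl hX.anti hY.anti hY.within hπ
  -- Passing from score `l` to `l'` changes the inflow of every alternative by `l - l'` and that of
  -- the terminal node by `-m * (l - l')`.
  rw [sum_range_succ, hX.col m (by omega), hY.col m (by omega), colSum_startMat_self,
    colSum_startMat_self, sum_congr rfl fun v hv => show π v * (colSum (m + 1) Y v -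
      colSum (m + 1) X v) = (l - l') * π v by
    have hv := mem_range.mp hv
    rw [hX.col v (by omega), hY.col v (by omega), colSum_startMat_lt _ hv,
      colSum_startMat_lt _ hv]; ring, ← mul_sum] at h
  rw [sum_sub_distrib]
  simp only [sum_const, card_range, nsmul_eq_mul]
  linarith

/-- Bisection by the sign of a subgradient. After `k` rounds every admissible score either lies
strictly between register `22` and register `22` plus `2 ^ (H + 1 - k)`, or cannot beat the best
cost found. The interval is open, so it starts at `-1` to contain the score `0`, and at width 1 it
contains no integer. -/
theorem searchCode_spec {B : ℤ} (E : Env m H I p U sc s) (A : Admissible m I B p U) (hm : 2 ≤ m)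
    (hB : 2 ^ H ≤ B) (hsc : ∀ x < m, 0 ≤ sc x ∧ sc x ≤ 2 ^ H)
    (hU : ∀ x < m, 2 ^ (H + 1) ≤ U m x ∧ 2 ^ (H + 1) ≤ U x m) :
    ∃ l X, Sol m U sc l X ∧ (searchCode.ev s).arr 0 0 = -cost (m + 1) p X ∧
      (∀ x < m, ∀ y < m, (searchCode.ev s).arr 0 (1 + x * m + y) = X x y) ∧
      ∀ l' : ℤ, 0 ≤ l' → l' < 2 ^ (H + 1) - 1 → ∀ Y, Sol m U sc l' Y →
        cost (m + 1) p X ≤ cost (m + 1) p Y := by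
  simp only [searchCode, Cm.ev_seq]
  set s1 := (Cm.set 28 (.c 0)).ev ((Cm.set 22 (.c (-1))).ev s) with hs1
  have E1 : Env m H I p U sc s1 := (E.setR _ (by decide)).setR _ (by decide)
  have key := Cm.for_inv (i := 24) (N := 3)
    (B := .seq (.set 23 (.add (.r 22) (.rd 2 (.sub (.sub (.r 3) (.c 1)) (.r 24))))) <|
      .seq solveCode <| .seq costCode <| .seq slopeCode <|
      .seq (.set 29 (.c 1)) <| .seq (.ite (.r 28) (.set 29 (.sub (.r 27) (.r 25))) .skip) <|
      .seq (.ite (.r 29) outCode .skip) (.ite (.r 26) (.set 22 (.r 23)) .skip)) s1 E1.hH (by decide)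
    (by decide) (fun k t => (-1 ≤ t.reg 22 ∧ t.reg 22 ≤ 2 ^ (H + 1) - 2 ^ (H + 1 - k) - 1) ∧
      (0 < k → t.reg 28 = 1) ∧ (t.reg 28 = 0 ∨ t.reg 28 = 1) ∧
      (t.reg 28 = 1 → ∃ l X, Sol m U sc l X ∧ t.reg 27 = cost (m + 1) p X ∧
        t.arr 0 0 = -cost (m + 1) p X ∧
        ∀ x < m, ∀ y < m, t.arr 0 (1 + x * m + y) = X x y) ∧
      ∀ l' : ℤ, 0 ≤ l' → l' < 2 ^ (H + 1) - 1 →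
        (t.reg 22 < l' ∧ l' < t.reg 22 + 2 ^ (H + 1 - k)) ∨
        (t.reg 28 = 1 ∧ ∀ Y, Sol m U sc l' Y → t.reg 27 ≤ cost (m + 1) p Y))
    ⟨by simp [hs1, Cm.ev, Ex.ev], by simp, by simp [hs1, Cm.ev, Ex.ev],
      by simp [hs1, Cm.ev, Ex.ev], fun l' h1 h2 => Or.inl (by
        simp [hs1, Cm.ev, Ex.ev]; omega)⟩ ?_
  · obtain ⟨-, h1, -, h2, h3⟩ := key
    obtain ⟨l, X, g1, g2, g3, g4⟩ := h2 (h1 (by omega))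
    refine ⟨l, X, g1, g3, g4, fun l' hl hl' Y hY => ?_⟩
    rcases h3 l' hl hl' with ⟨h4, h5⟩ | ⟨-, h4⟩
    · rw [Nat.sub_self, pow_zero] at h5; omega
    · rw [← g2]; exact h4 Y hY
  rintro k hk t ht htk ⟨⟨b1, b2⟩, i1, i2, i3, i4⟩
  have Et := E1.of_keeps ht (by decide) (by decide)
  simp only [Cm.ev_seq]
  have hset : (Cm.set 23 (.add (.r 22) (.rd 2 (.sub (.sub (.r 3) (.c 1)) (.r 24))))).ev t =
      t.setR 23 (t.reg 22 + 2 ^ (H - k)) := by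
    simp only [Cm.ev, Ex.ev, Et.hH, htk]
    rw [show (((H + 1 : ℕ) : ℤ) - 1 - k).toNat = H - k by omega, Et.pow _ (by omega)]
  rw [hset]
  have hpk : (2 : ℤ) ^ (H + 1 - k) = 2 * 2 ^ (H - k) := by
    rw [show H + 1 - k = H - k + 1 by omega, pow_succ]; ring
  have hpos : (0 : ℤ) < 2 ^ (H - k) := by positivity
  have hpH : (2 : ℤ) ^ (H + 1) = 2 * 2 ^ H := by rw [pow_succ]; ring
  rw [hpk] at b2 i4
  rw [show H + 1 - (k + 1) = H - k by omega]
  set l := t.reg 22 + 2 ^ (H - k) with hl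
  set D := (2 : ℤ) ^ (H - k)
  have E2 : Env m H I p U sc (t.setR 23 l) := Et.setR _ (by decide)
  obtain ⟨c1, c2, c3, c4⟩ := solveCode_spec E2 A hm hB (fun x hx => by
    have := hsc x hx
    rw [St.setR_reg, if_pos rfl, abs_le]
    constructor <;> omega) hU
  rw [St.setR_reg, if_pos rfl] at c3
  have E3 : Env m H I p U sc (solveCode.ev (t.setR 23 l)) := E2.ev (by decide) (by decide)
  have k3 := solveCode.keeps_ev (t.setR 23 l)
  set t3 := solveCode.ev (t.setR 23 l)
  have d4 := costCode_spec E3 A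
  have E4 : Env m H I p U sc (costCode.ev t3) := E3.ev (by decide) (by decide)
  have k4 := costCode.keeps_ev t3
  set t4 := costCode.ev t3
  have d5 := slopeCode_spec E4
  have E5 : Env m H I p U sc (slopeCode.ev t4) := E4.ev (by decide) (by decide)
  have k5 := slopeCode.keeps_ev t4
  set t5 := slopeCode.ev t4
  have hm8 : mat m 8 t4 = mat m 8 t3 := by unfold mat; rw [k4.2 8 (by decide)]
  have hm6 : mat m 6 t5 = mat m 6 t3 := by unfold mat; rw [k5.2 6 (by decide), k4.2 6 (by decide)]
  rw [hm8] at d5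
  have hreg : ∀ j ∈ [22, 23, 27, 28], t5.reg j = (t.setR 23 l).reg j := by
    intro j hj
    simp only [List.mem_cons, List.not_mem_nil, or_false] at hj
    rcases hj with rfl | rfl | rfl | rfl <;>
      rw [k5.1 _ (by decide), k4.1 _ (by decide), k3.1 _ (by decide)]
  have r22 : t5.reg 22 = t.reg 22 := by rw [hreg 22 (by decide)]; simp
  have r23 : t5.reg 23 = l := by rw [hreg 23 (by decide)]; simp
  have r27 : t5.reg 27 = t.reg 27 := by rw [hreg 27 (by decide)]; simp
  have r28 : t5.reg 28 = t.reg 28 := by rw [hreg 28 (by decide)]; simp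
  have r25 : t5.reg 25 = cost (m + 1) p (mat m 6 t3) := by rw [k5.1 _ (by decide), d4]
  have a0 : t5.arr 0 = t.arr 0 := by
    rw [k5.2 0 (by decide), k4.2 0 (by decide), k3.2 0 (by decide)]; rfl
  have hsol : Sol m U sc l (mat m 6 t3) := ⟨c1, c2, c3⟩
  have hcl := fun l' Y => hsol.cost_le (l' := l') (Y := Y) A c4
  set c := cost (m + 1) p (mat m 6 t3)
  rw [← d5] at hcl
  -- the flag
  obtain ⟨t6, ht6, E6, k6, h29⟩ : ∃ t6 : St, (Cm.ite (.r 28) (.set 29 (.sub (.r 27) (.r 25)))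
      .skip).ev ((Cm.set 29 (.c 1)).ev t5) = t6 ∧ Env m H I p U sc t6 ∧
      ((∀ j ≠ 29, t6.reg j = t5.reg j) ∧ t6.arr = t5.arr) ∧
      (0 < t6.reg 29 ↔ (t.reg 28 = 0 ∨ c < t.reg 27)) := by
    refine ⟨_, rfl, (E5.setR (j := 29) _ (by decide)).ev (by decide) (by decide), ?_⟩
    have h28 : (Ex.r 28).ev ((Cm.set 29 (.c 1)).ev t5) = t.reg 28 := by simp [Cm.ev, Ex.ev, r28]
    rcases i2 with h0 | h1
    · rw [Cm.ev_ite_neg (by rw [h28, h0]; omega)]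
      exact ⟨⟨fun j hj => by simp [Cm.ev, hj], rfl⟩, by simp [Cm.ev, Ex.ev, h0]⟩
    · rw [Cm.ev_ite_pos (by rw [h28, h1]; omega)]
      exact ⟨⟨fun j hj => by simp [Cm.ev, hj], rfl⟩, by simp [Cm.ev, Ex.ev, h1, r27, r25]⟩
  rw [ht6]
  have hm66 : mat m 6 t6 = mat m 6 t3 := by rw [← hm6]; unfold mat; rw [k6.2]
  -- the output
  obtain ⟨t7, ht7, r7, n28, n27, n27', hout⟩ : ∃ t7 : St,
      (Cm.ite (.r 29) outCode .skip).ev t6 = t7 ∧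
      (t7.reg 22 = t.reg 22 ∧ t7.reg 23 = l ∧ t7.reg 26 = t5.reg 26) ∧ t7.reg 28 = 1 ∧
      t7.reg 27 ≤ c ∧ (t.reg 28 = 1 → t7.reg 27 ≤ t.reg 27) ∧
      ∃ l X, Sol m U sc l X ∧ t7.reg 27 = cost (m + 1) p X ∧ t7.arr 0 0 = -cost (m + 1) p X ∧
        ∀ x < m, ∀ y < m, t7.arr 0 (1 + x * m + y) = X x y := by
    refine ⟨_, rfl, ?_⟩
    by_cases h : 0 < t6.reg 29
    · rw [Cm.ev_ite_pos (by exact h)]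
      obtain ⟨o1, o2, o3, o4⟩ := outCode_spec E6
      rw [k6.1 25 (by decide), r25] at o1 o3
      rw [hm66] at o4
      refine ⟨⟨?_, ?_, ?_⟩, o2, o1.le, fun h1 => ?_, l, _, hsol, o1, o3, o4⟩
      · rw [Cm.ev_reg _ 22 (by decide), k6.1 22 (by decide), r22]
      · rw [Cm.ev_reg _ 23 (by decide), k6.1 23 (by decide), r23]
      · rw [Cm.ev_reg _ 26 (by decide), k6.1 26 (by decide)]
      · rcases h29.mp h with h2 | h2
        · omega
        · omega
    · rw [Cm.ev_ite_neg (by exact h)]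
      have h1 : t.reg 28 ≠ 0 ∧ t.reg 27 ≤ c := by
        have := mt h29.mpr h
        exact ⟨fun h0 => this (Or.inl h0), not_lt.mp fun h0 => this (Or.inr h0)⟩
      have h2 : t.reg 28 = 1 := i2.resolve_left h1.1
      obtain ⟨l0, X, g1, g2, g3, g4⟩ := i3 h2
      simp only [Cm.ev, k6.2, a0]
      rw [k6.1 22 (by decide), k6.1 23 (by decide), k6.1 26 (by decide), k6.1 28 (by decide),
        k6.1 27 (by decide), r22, r23, r27, r28]
      exact ⟨⟨rfl, rfl, rfl⟩, h2, h1.2, fun _ => le_rfl, l0, X, g1, g2, g3, g4⟩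
  rw [ht7]
  -- By `Sol.cost_le`, a positive slope settles all scores up to `l`, and any other slope all scores
  -- from `l` on.
  by_cases hS : 0 < t5.reg 26
  · rw [Cm.ev_ite_pos (by rw [Ex.ev, r7.2.2]; exact hS)]
    simp only [Cm.ev, Ex.ev, r7.2.1, St.setR_reg, St.setR_arr]
    norm_num
    refine ⟨⟨by omega, by omega⟩, n28, Or.inr n28, fun _ => hout, fun l' h1 h2 => ?_⟩
    by_cases hll : l' ≤ l
    · right
      refine ⟨n28, fun Y hY => ?_⟩
      have h3 := hcl l' Y hY
      have h4 : 0 ≤ (l - l') * t5.reg 26 := mul_nonneg (by omega) hS.le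
      omega
    · rcases i4 l' h1 h2 with h3 | ⟨h3, h4⟩
      · left; omega
      · right; exact ⟨n28, fun Y hY => (n27' h3).trans (h4 Y hY)⟩
  · rw [Cm.ev_ite_neg (by rw [Ex.ev, r7.2.2]; exact hS)]
    simp only [Cm.ev, St.setR_reg, St.setR_arr, r7.1]
    norm_num
    refine ⟨⟨b1, by omega⟩, n28, Or.inr n28, fun _ => hout, fun l' h1 h2 => ?_⟩
    by_cases hll : l ≤ l'
    · right
      refine ⟨n28, fun Y hY => ?_⟩
      have h3 := hcl l' Y hY
      have h4 : 0 ≤ (l - l') * t5.reg 26 := mul_nonneg_of_nonpos_of_nonpos (by omega) (by omega)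
      omega
    · rcases i4 l' h1 h2 with h3 | ⟨h3, h4⟩
      · left; omega
      · right; exact ⟨n28, fun Y hY => (n27' h3).trans (h4 Y hY)⟩

end Borda

/-! ### The tables of capacities, prices and scores -/

namespace Borda

open Finset Circ

variable {m H : ℕ} {s : St}

/-- The capacities. -/
def capFun (m : ℕ) (w : ℕ → ℕ → ℤ) (B : ℤ) (u v : ℕ) : ℤ :=
  if u = v then B else if u = m then B else if v = m then B else w v u

/-- The unit costs. -/
def priceFun (m d u v : ℕ) : ℤ :=
  if u = v then 0 else if u = m then (if v = d then 0 else 2)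
  else if v = m then (if u = d then 2 else 0) else 1

/-- The Borda scores. -/
def scoreFun (m : ℕ) (w : ℕ → ℕ → ℤ) (x : ℕ) : ℤ :=
  ∑ y ∈ range m, if x = y then 0 else w x y

/-- There are `m + 2` multiples because the distance table has the layers `0, …, m + 1`. -/
theorem rowCode_spec (a r c : ℕ) (h2 : s.reg 2 = ((m + 2 : ℕ) : ℤ)) (hr : s.reg r = c)
    (hr9 : r ≠ 9) (hr31 : r ≠ 31) :
    ∀ u < m + 2, ((rowCode a r).ev s).arr a u = ((u * c : ℕ) : ℤ) := by
  have h2' : ((Cm.set 31 (.c 0)).ev s).reg 2 = ((m + 2 : ℕ) : ℤ) := by simpa [Cm.ev] using h2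
  have key := Cm.for_inv (i := 9) (N := 2) ((Cm.set 31 (.c 0)).ev s)
    (B := .seq (.wr a (.r 9) (.r 31)) (.set 31 (.add (.r 31) (.r r)))) h2' (by decide)
    (by simp [Cm.modR]) (fun k t => t.reg 31 = ((k * c : ℕ) : ℤ) ∧
      ∀ u < k, t.arr a u = ((u * c : ℕ) : ℤ)) ⟨by simp [Cm.ev, Ex.ev], by simp⟩ (by
    rintro k hk t ht htk ⟨h31, harr⟩
    have hr' : t.reg r = c := by
      rw [ht.1 r (by simp [Cm.for, Cm.modR, hr9.symm, hr31.symm])]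
      simpa [Cm.ev, hr31] using hr
    refine ⟨?_, fun u hu => ?_⟩
    · simp [Cm.ev, Ex.ev, h31, hr']; ring
    · simp only [Cm.ev, Ex.ev, htk, Int.toNat_natCast, St.setR_arr, St.setA_arr, h31, true_and]
      split_ifs with h
      · rw [h]
      · exact harr u (by omega))
  exact key.2

theorem powCode_spec (h3 : s.reg 3 = ((H + 1 : ℕ) : ℤ)) :
    ∀ j ≤ H + 1, (powCode.ev s).arr 2 j = 2 ^ j := by
  refine Cm.for_inv (i := 9) (N := 3) ((Cm.wr 2 (.c 0) (.c 1)).ev s)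
    (B := .wr 2 (.add (.r 9) (.c 1)) (.add (.rd 2 (.r 9)) (.rd 2 (.r 9)))) h3 (by decide)
    (by decide) (fun k t => ∀ j ≤ k, t.arr 2 j = 2 ^ j) ?_ ?_
  · intro j hj
    obtain rfl : j = 0 := by omega
    simp [Cm.ev, Ex.ev]
  · intro k hk t ht htk hI j hj
    simp only [Cm.ev, Ex.ev, htk, Int.toNat_natCast, St.setR_arr, St.setA_arr, true_and,
      show ((k : ℤ) + 1).toNat = k + 1 by omega, hI k le_rfl]
    split_ifs with h
    · rw [h, pow_succ]; ring
    · exact hI j (by omega)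

theorem capCode_spec {w : ℕ → ℕ → ℤ} {B : ℤ} (h0 : s.reg 0 = m)
    (h1 : s.reg 1 = ((m + 1 : ℕ) : ℤ)) (h6 : s.reg 6 = B)
    (hrow : ∀ u ≤ m + 1, s.arr 1 u = ((u * (m + 1) : ℕ) : ℤ))
    (hrowm : ∀ u ≤ m, s.arr 12 u = ((u * m : ℕ) : ℤ))
    (hw : ∀ x < m, ∀ y < m, s.arr 0 (3 + x * m + y) = w x y) :
    ∀ u < m + 1, ∀ v < m + 1, mat m 3 (capCode.ev s) u v = capFun m w B u v := by
  refine (Cm.for2_fill (a := 3) s h1 (by decide) (by decide) (by decide) (by decide) (by decide)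
    (by decide) (fun u v => u * (m + 1) + v) _ (fun u _ v hv u' _ v' hv' h => index_inj hv hv' h)
    ?_).1
  intro u hu v hv t ht htu htv
  have t0 : t.reg 0 = m := by rw [ht.1 0 (by decide), h0]
  have t6 : t.reg 6 = B := by rw [ht.1 6 (by decide), h6]
  have wr := fun g => ev_wr2_of_row (m := m) (s := t) (by rw [ht.2 1 (by decide)]; exact hrow) 3
    (e := .r 9) (f := .r 10) (g := g) htu htv (by omega)
  have c1 : (Ex.r 9).ev t = (Ex.r 10).ev t ↔ u = v := by simp only [Ex.ev, htu, htv]; omega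
  have c2 : (Ex.r 9).ev t = (Ex.r 0).ev t ↔ u = m := by simp only [Ex.ev, htu, t0]; omega
  have c3 : (Ex.r 10).ev t = (Ex.r 0).ev t ↔ v = m := by simp only [Ex.ev, htv, t0]; omega
  unfold capFun
  split_ifs with g1 g2 g3
  · rw [Cm.ev_ifEq_pos (c1.2 g1), wr, setA_arr_self, Ex.ev, t6]
  · rw [Cm.ev_ifEq_neg (mt c1.1 g1), Cm.ev_ifEq_pos (c2.2 g2), wr, setA_arr_self, Ex.ev, t6]
  · rw [Cm.ev_ifEq_neg (mt c1.1 g1), Cm.ev_ifEq_neg (mt c2.1 g2), Cm.ev_ifEq_pos (c3.2 g3), wr,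
      setA_arr_self, Ex.ev, t6]
  · rw [Cm.ev_ifEq_neg (mt c1.1 g1), Cm.ev_ifEq_neg (mt c2.1 g2), Cm.ev_ifEq_neg (mt c3.1 g3), wr,
      setA_arr_self]
    have hi : (Ex.add (.add (.c 3) (.rd 12 (.r 10))) (.r 9)).ev t =
        ((3 + v * m + u : ℕ) : ℤ) := by
      simp only [Ex.ev, htu, htv, Int.toNat_natCast, ht.2 12 (by decide), hrowm v (by omega)]
      push_cast; ring
    rw [Ex.ev, hi, Int.toNat_natCast, ht.2 0 (by decide), hw v (by omega) u (by omega)]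

theorem priceCode_spec {d : ℕ} (h0 : s.reg 0 = m)
    (h1 : s.reg 1 = ((m + 1 : ℕ) : ℤ)) (h5 : s.reg 5 = d)
    (hrow : ∀ u ≤ m + 1, s.arr 1 u = ((u * (m + 1) : ℕ) : ℤ)) :
    ∀ u < m + 1, ∀ v < m + 1, mat m 4 (priceCode.ev s) u v = priceFun m d u v := by
  refine (Cm.for2_fill (a := 4) s h1 (by decide) (by decide) (by decide) (by decide) (by decide)
    (by decide) (fun u v => u * (m + 1) + v) _ (fun u _ v hv u' _ v' hv' h => index_inj hv hv' h)
    ?_).1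
  intro u hu v hv t ht htu htv
  have t0 : t.reg 0 = m := by rw [ht.1 0 (by decide), h0]
  have t5 : t.reg 5 = d := by rw [ht.1 5 (by decide), h5]
  have wr := fun g => ev_wr2_of_row (m := m) (s := t) (by rw [ht.2 1 (by decide)]; exact hrow) 4
    (e := .r 9) (f := .r 10) (g := g) htu htv (by omega)
  have c1 : (Ex.r 9).ev t = (Ex.r 10).ev t ↔ u = v := by simp only [Ex.ev, htu, htv]; omega
  have c2 : (Ex.r 9).ev t = (Ex.r 0).ev t ↔ u = m := by simp only [Ex.ev, htu, t0]; omega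
  have c3 : (Ex.r 10).ev t = (Ex.r 0).ev t ↔ v = m := by simp only [Ex.ev, htv, t0]; omega
  have c4 : (Ex.r 10).ev t = (Ex.r 5).ev t ↔ v = d := by simp only [Ex.ev, htv, t5]; omega
  have c5 : (Ex.r 9).ev t = (Ex.r 5).ev t ↔ u = d := by simp only [Ex.ev, htu, t5]; omega
  unfold priceFun
  split_ifs with g1 g2 g3 g3 g4
  · rw [Cm.ev_ifEq_pos (c1.2 g1), wr, setA_arr_self, Ex.ev]
  · rw [Cm.ev_ifEq_neg (mt c1.1 g1), Cm.ev_ifEq_pos (c2.2 g2), Cm.ev_ifEq_pos (c4.2 g3), wr,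
      setA_arr_self, Ex.ev]
  · rw [Cm.ev_ifEq_neg (mt c1.1 g1), Cm.ev_ifEq_pos (c2.2 g2), Cm.ev_ifEq_neg (mt c4.1 g3), wr,
      setA_arr_self, Ex.ev]
  · rw [Cm.ev_ifEq_neg (mt c1.1 g1), Cm.ev_ifEq_neg (mt c2.1 g2), Cm.ev_ifEq_pos (c3.2 g3),
      Cm.ev_ifEq_pos (c5.2 g4), wr, setA_arr_self, Ex.ev]
  · rw [Cm.ev_ifEq_neg (mt c1.1 g1), Cm.ev_ifEq_neg (mt c2.1 g2), Cm.ev_ifEq_pos (c3.2 g3),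
      Cm.ev_ifEq_neg (mt c5.1 g4), wr, setA_arr_self, Ex.ev]
  · rw [Cm.ev_ifEq_neg (mt c1.1 g1), Cm.ev_ifEq_neg (mt c2.1 g2), Cm.ev_ifEq_neg (mt c3.1 g3), wr,
      setA_arr_self, Ex.ev]

theorem scoreCode_spec {w : ℕ → ℕ → ℤ} (h0 : s.reg 0 = m)
    (hrowm : ∀ u ≤ m, s.arr 12 u = ((u * m : ℕ) : ℤ))
    (hw : ∀ x < m, ∀ y < m, s.arr 0 (3 + x * m + y) = w x y) :
    ∀ x < m, (scoreCode.ev s).arr 5 x = scoreFun m w x := by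
  refine (Cm.for_fill (a := 5) s h0 (by decide) (by decide) (fun x => x) _ (fun _ _ _ _ h => h)
    ?_).1
  intro x hx t ht htx
  have t0 : t.reg 0 = m := by rw [ht.1 0 (by decide), h0]
  rw [Cm.ev_seq, Cm.ev_seq]
  set t1 := (Cm.set 31 (.c 0)).ev t with ht1
  have h10 : t1.reg 0 = m := by rw [ht1, Cm.ev_reg _ 0 (by decide), t0]
  have hsum := Cm.for_sum (i := 10) (N := 0) (r := 31) t1 h10
    (B := .ifEq (.r 9) (.r 10) .skip <|
      .set 31 (.add (.r 31) (.rd 0 (.add (.add (.c 3) (.rd 12 (.r 9))) (.r 10)))))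
    (by decide) (by decide) (by decide) (fun y => if x = y then 0 else w x y) (by
    intro y hy r hr hry
    have hr9 : r.reg 9 = x := by rw [hr.1 9 (by decide), ht1, Cm.ev_reg _ 9 (by decide), htx]
    have c1 : (Ex.r 9).ev r = (Ex.r 10).ev r ↔ x = y := by simp only [Ex.ev, hr9, hry]; omega
    split_ifs with g1
    · rw [Cm.ev_ifEq_pos (c1.2 g1), Cm.ev]; ring
    · rw [Cm.ev_ifEq_neg (mt c1.1 g1)]
      have hi : (Ex.add (.add (.c 3) (.rd 12 (.r 9))) (.r 10)).ev r =
          ((3 + x * m + y : ℕ) : ℤ) := by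
        simp only [Ex.ev, hr9, hry, Int.toNat_natCast]
        rw [hr.2 12 (by decide), ht1, Cm.ev_arr _ 12 (by decide), ht.2 12 (by decide),
          hrowm x hx.le]
        push_cast; ring
      simp only [Cm.ev, St.setR_reg, if_true]
      rw [Ex.ev, Ex.ev, Ex.ev, hi, Int.toNat_natCast, hr.2 0 (by decide), ht1,
        Cm.ev_arr _ 0 (by decide), ht.2 0 (by decide), hw x hx y hy])
  have k2 := (Cm.for 10 0 (.ifEq (.r 9) (.r 10) .skip <|
      .set 31 (.add (.r 31) (.rd 0 (.add (.add (.c 3) (.rd 12 (.r 9))) (.r 10)))))).keeps_ev t1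
  set t2 := (Cm.for 10 0 (.ifEq (.r 9) (.r 10) .skip <|
      .set 31 (.add (.r 31) (.rd 0 (.add (.add (.c 3) (.rd 12 (.r 9))) (.r 10)))))).ev t1
  have h29 : t2.reg 9 = x := by rw [k2.1 9 (by decide), ht1, Cm.ev_reg _ 9 (by decide), htx]
  have h25 : t2.arr 5 = t.arr 5 := by rw [k2.2 5 (by decide)]; rfl
  rw [Cm.ev, Ex.ev, Ex.ev, h29, hsum, Int.toNat_natCast, setA_arr_self, h25]
  simp [ht1, Cm.ev, Ex.ev, scoreFun]

theorem initCode_spec {w : ℕ → ℕ → ℤ} {d : ℕ} (h0 : s.reg 0 = m)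
    (h1 : s.reg 1 = ((m + 1 : ℕ) : ℤ)) (h2 : s.reg 2 = ((m + 2 : ℕ) : ℤ))
    (h3 : s.reg 3 = ((H + 1 : ℕ) : ℤ)) (h5 : s.reg 5 = d)
    (hw : ∀ x < m, ∀ y < m, s.arr 0 (3 + x * m + y) = w x y) :
    Env m H (3 * (m + 1)) (priceFun m d) (capFun m w (2 ^ (H + 2))) (scoreFun m w)
      (initCode.ev s) := by
  simp only [initCode, Cm.ev_seq]
  have k1 := (Cm.set 7 (.add (.add (.r 1) (.r 1)) (.r 1))).keeps_ev s
  have v1 : ((Cm.set 7 (.add (.add (.r 1) (.r 1)) (.r 1))).ev s).reg 7 = 3 * (m + 1) := by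
    simp [Cm.ev, Ex.ev, h1]; ring
  set s1 := (Cm.set 7 (.add (.add (.r 1) (.r 1)) (.r 1))).ev s
  have k2 := (rowCode 1 1).keeps_ev s1
  have v2 := rowCode_spec (m := m) (s := s1) 1 1 (m + 1) (by rw [k1.1 2 (by decide), h2])
    (by rw [k1.1 1 (by decide), h1]) (by decide) (by decide)
  set s2 := (rowCode 1 1).ev s1
  have k3 := (rowCode 12 0).keeps_ev s2
  have v3 := rowCode_spec (m := m) (s := s2) 12 0 m
    (by rw [k2.1 2 (by decide), k1.1 2 (by decide), h2])
    (by rw [k2.1 0 (by decide), k1.1 0 (by decide), h0]) (by decide) (by decide)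
  set s3 := (rowCode 12 0).ev s2
  have k4 := powCode.keeps_ev s3
  have v4 := powCode_spec (H := H) (s := s3)
    (by rw [k3.1 3 (by decide), k2.1 3 (by decide), k1.1 3 (by decide), h3])
  set s4 := powCode.ev s3
  have k5 := (Cm.set 6 (.add (.rd 2 (.r 3)) (.rd 2 (.r 3)))).keeps_ev s4
  have r43 : s4.reg 3 = ((H + 1 : ℕ) : ℤ) := by
    rw [k4.1 3 (by decide), k3.1 3 (by decide), k2.1 3 (by decide), k1.1 3 (by decide), h3]
  have v5 : ((Cm.set 6 (.add (.rd 2 (.r 3)) (.rd 2 (.r 3)))).ev s4).reg 6 = 2 ^ (H + 2) := by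
    simp only [Cm.ev, Ex.ev, r43, Int.toNat_natCast, v4 (H + 1) le_rfl, St.setR_reg, if_true]
    ring
  set s5 := (Cm.set 6 (.add (.rd 2 (.r 3)) (.rd 2 (.r 3)))).ev s4
  have r5 : ∀ j ∈ [0, 1, 2, 3, 5], s5.reg j = s.reg j := by
    intro j hj
    simp only [List.mem_cons, List.not_mem_nil, or_false] at hj
    rcases hj with rfl | rfl | rfl | rfl | rfl <;>
      rw [k5.1 _ (by decide), k4.1 _ (by decide), k3.1 _ (by decide), k2.1 _ (by decide),
        k1.1 _ (by decide)]
  have r57 : s5.reg 7 = 3 * (m + 1) := by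
    rw [k5.1 _ (by decide), k4.1 _ (by decide), k3.1 _ (by decide), k2.1 _ (by decide), v1]
  have a50 : s5.arr 0 = s.arr 0 := by
    rw [k5.2 _ (by decide), k4.2 _ (by decide), k3.2 _ (by decide), k2.2 _ (by decide),
      k1.2 _ (by decide)]
  have a51 : ∀ u ≤ m + 1, s5.arr 1 u = ((u * (m + 1) : ℕ) : ℤ) := by
    rw [k5.2 _ (by decide), k4.2 _ (by decide), k3.2 _ (by decide)]
    exact fun u hu => v2 u (by omega)
  have a512 : ∀ u ≤ m, s5.arr 12 u = ((u * m : ℕ) : ℤ) := by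
    rw [k5.2 _ (by decide), k4.2 _ (by decide)]
    exact fun u hu => v3 u (by omega)
  have a52 : ∀ j ≤ H, s5.arr 2 j = 2 ^ j := by
    rw [k5.2 _ (by decide)]
    exact fun j hj => v4 j (by omega)
  have k6 := capCode.keeps_ev s5
  have v6 := capCode_spec (w := w) ((r5 0 (by decide)).trans h0) ((r5 1 (by decide)).trans h1) v5
    a51 a512 (by rw [a50]; exact hw)
  set s6 := capCode.ev s5
  have k7 := priceCode.keeps_ev s6
  have v7 := priceCode_spec (s := s6) (m := m) (d := d)
    (by rw [k6.1 _ (by decide), r5 0 (by decide), h0])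
    (by rw [k6.1 _ (by decide), r5 1 (by decide), h1])
    (by rw [k6.1 _ (by decide), r5 5 (by decide), h5]) (by rw [k6.2 _ (by decide)]; exact a51)
  set s7 := priceCode.ev s6
  have k8 := scoreCode.keeps_ev s7
  have v8 := scoreCode_spec (s := s7) (m := m) (w := w)
    (by rw [k7.1 _ (by decide), k6.1 _ (by decide), r5 0 (by decide), h0])
    (by rw [k7.2 _ (by decide), k6.2 _ (by decide)]; exact a512)
    (by rw [k7.2 _ (by decide), k6.2 _ (by decide), a50]; exact hw)
  set s8 := scoreCode.ev s7
  have rr : ∀ j ∈ [0, 1, 2, 3, 7], s8.reg j = s5.reg j := by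
    intro j hj
    simp only [List.mem_cons, List.not_mem_nil, or_false] at hj
    rcases hj with rfl | rfl | rfl | rfl | rfl <;>
      rw [k8.1 _ (by decide), k7.1 _ (by decide), k6.1 _ (by decide)]
  constructor
  · rw [rr _ (by decide), r5 _ (by decide), h0]
  · rw [rr _ (by decide), r5 _ (by decide), h1]
  · rw [rr _ (by decide), r5 _ (by decide), h2]
  · rw [rr _ (by decide), r5 _ (by decide), h3]
  · rw [rr _ (by decide), r57]
  · rw [k8.2 _ (by decide), k7.2 _ (by decide), k6.2 _ (by decide)]; exact a51
  · rw [k8.2 _ (by decide), k7.2 _ (by decide), k6.2 _ (by decide)]; exact a52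
  · unfold mat; rw [k8.2 _ (by decide), k7.2 _ (by decide)]; exact v6
  · unfold mat; rw [k8.2 _ (by decide)]; exact v7
  · exact v8
  · rw [k8.2 _ (by decide), k7.2 _ (by decide), k6.2 _ (by decide)]; exact a512

/-! ## The number of binary digits -/

theorem _root_.Represents.setR {μ : Memory} {s : St} (h : Represents μ s) (i : ℕ) (z : ℤ) :
    Represents (Function.update μ (regCell i) z) (s.setR i z) := by
  refine ⟨fun j => ?_, fun a ha j => ?_⟩
  · rw [St.setR_reg, Function.update_apply, h.1]
    exact if_congr regCell_inj rfl rfl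
  · rw [Function.update_of_ne (arrCell_ne_regCell ha _ _), h.2 a ha, St.setR_arr]

theorem _root_.Represents.const {μ : Memory} {s : St} (h : Represents μ s) (i : ℕ) (z : ℤ) :
    ∃ ν, UExec (.const (regCell i) z) μ ν 1 ∧ Represents ν (s.setR i z) :=
  ⟨_, .const _ _ _, h.setR i z⟩

theorem _root_.Represents.add {μ : Memory} {s : St} (h : Represents μ s) (i j k : ℕ) :
    ∃ ν, UExec (.add (regCell i) (regCell j) (regCell k)) μ ν 1 ∧
      Represents ν (s.setR i (s.reg j + s.reg k)) :=
  ⟨_, .add _ _ _ _, by rw [h.1, h.1]; exact h.setR i _⟩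

theorem _root_.Represents.sub {μ : Memory} {s : St} (h : Represents μ s) (i j k : ℕ) :
    ∃ ν, UExec (.sub (regCell i) (regCell j) (regCell k)) μ ν 1 ∧
      Represents ν (s.setR i (s.reg j - s.reg k)) :=
  ⟨_, .sub _ _ _ _, by rw [h.1, h.1]; exact h.setR i _⟩

/-- The loop of `digitsCode`. -/
def digitsLoop : Program :=
  .loop (regCell 33) <| .seq (.add (regCell 30) (regCell 30) (regCell 34)) <|
    .seq (.add (regCell 32) (regCell 32) (regCell 32)) <|
    .seq (.sub (regCell 33) (regCell 4) (regCell 32)) (.add (regCell 33) (regCell 33) (regCell 34))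

/-- Write the number of binary digits of register `4` to register `30`. -/
def digitsCode : Program :=
  .seq (.const (regCell 30) 0) <| .seq (.const (regCell 32) 1) <| .seq (.const (regCell 34) 1) <|
  .seq (.const (regCell 33) 0) <| .seq (.add (regCell 33) (regCell 4) (regCell 33)) digitsLoop

/-- Register `33` is positive exactly while `2 ^ c ≤ n`, that is, while `c < n.size`; `r` counts the
rounds left. The loop is written in machine code since its length is what it computes, so no
register can bound it beforehand. -/
theorem digitsLoop_spec {n : ℕ} (r : ℕ) (s : St) (μ : Memory) (c : ℕ) (hμ : Represents μ s)
    (hc : c + r = n.size) (h4 : s.reg 4 = n) (h30 : s.reg 30 = c) (h32 : s.reg 32 = 2 ^ c)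
    (h33 : s.reg 33 = n + 1 - 2 ^ c) (h34 : s.reg 34 = 1) :
    ∃ ν k s', UExec digitsLoop μ ν k ∧ k ≤ 5 * r + 1 ∧ Represents ν s' ∧ s'.arr = s.arr ∧
      (∀ j < 30, s'.reg j = s.reg j) ∧ s'.reg 30 = n.size := by
  induction r generalizing s μ c with
  | zero =>
    have : n < 2 ^ c := by rw [show c = n.size by omega]; exact Nat.lt_size_self n
    have h : (n : ℤ) < 2 ^ c := by exact_mod_cast this
    refine ⟨μ, 1, s, .loop_neg ?_, by omega, hμ, rfl, fun _ _ => rfl, by rw [h30]; simpa using hc⟩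
    rw [hμ.1, h33]; omega
  | succ r ih =>
    have : 2 ^ c ≤ n := Nat.lt_size.mp (by omega)
    have h : (2 : ℤ) ^ c ≤ n := by exact_mod_cast this
    obtain ⟨μ1, e1, hμ1⟩ := hμ.add 30 30 34
    obtain ⟨μ2, e2, hμ2⟩ := hμ1.add 32 32 32
    obtain ⟨μ3, e3, hμ3⟩ := hμ2.sub 33 4 32
    obtain ⟨μ4, e4, hμ4⟩ := hμ3.add 33 33 34
    obtain ⟨ν, k, s', e, hk, hν, h1, h2, h3⟩ := ih _ _ (c + 1) hμ4 (by omega) (by simpa using h4)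
      (by simp [h30, h34]) (by simp [h32, pow_succ]; ring) (by
        simp [h4, h32, h34, pow_succ]; ring) (by simpa using h34)
    refine ⟨ν, _, s', .loop_pos (by rw [hμ.1, h33]; omega) (.seq e1 (.seq e2 (.seq e3 e4))) e,
      by omega, hν, h1, fun j hj => ?_, h3⟩
    rw [h2 j hj]
    simp [show j ≠ 30 by omega, show j ≠ 32 by omega, show j ≠ 33 by omega]

theorem digitsCode_spec {n : ℕ} (s : St) (μ : Memory) (hμ : Represents μ s) (h4 : s.reg 4 = n) :
    ∃ ν k s', UExec digitsCode μ ν k ∧ k ≤ 5 * n.size + 6 ∧ Represents ν s' ∧ s'.arr = s.arr ∧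
      (∀ j < 30, s'.reg j = s.reg j) ∧ s'.reg 30 = n.size := by
  obtain ⟨μ1, e1, hμ1⟩ := hμ.const 30 0
  obtain ⟨μ2, e2, hμ2⟩ := hμ1.const 32 1
  obtain ⟨μ3, e3, hμ3⟩ := hμ2.const 34 1
  obtain ⟨μ4, e4, hμ4⟩ := hμ3.const 33 0
  obtain ⟨μ5, e5, hμ5⟩ := hμ4.add 33 4 33
  obtain ⟨ν, k, s', e, hk, hν, h1, h2, h3⟩ := digitsLoop_spec (n := n) n.size _ _ 0 hμ5 (by omega)
    (by simpa using h4) (by simp) (by simp) (by simp [h4]) (by simp)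
  refine ⟨ν, _, s', .seq e1 (.seq e2 (.seq e3 (.seq e4 (.seq e5 e)))), by omega, hν, h1,
    fun j hj => ?_, h3⟩
  rw [h2 j hj]
  simp [show j ≠ 30 by omega, show j ≠ 32 by omega, show j ≠ 33 by omega,
    show j ≠ 34 by omega]

end Borda

/-! ### The whole program on the input memory -/

namespace Borda

open Finset Circ

/-- The program. -/
def program : Program :=
  .seq (readCode.code 0) (.seq digitsCode (.seq (phaseCode.code 0) (mainCode.code 0)))

/-- A bound for the number of unit steps, in terms of `m + n.size`. -/
noncomputable def stepPoly : Polynomial ℕ :=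
  .C (readCode.steps.eval 0 + phaseCode.steps.eval 0 + 6) + .C 5 * .X +
    mainCode.steps.comp (.X + .C 2)

/-- A bound for the logarithmic cost, in terms of `m + n.size`. -/
noncomputable def costPoly : Polynomial ℕ :=
  stepPoly * (.C 3 + .C 2 * (.C program.constBound + .X + stepPoly))

theorem program_spec {m n d : ℕ} {w : ℕ → ℕ → ℤ} {s : St} {μ : Memory} (hμ : Represents μ s)
    (h0 : s.arr 0 0 = m) (h1 : s.arr 0 1 = n) (h2 : s.arr 0 2 = d)
    (hw : ∀ x < m, ∀ y < m, s.arr 0 (3 + x * m + y) = w x y) :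
    ∃ ν k t, UExec program μ ν k ∧ k ≤ stepPoly.eval (m + n.size) ∧
      Represents ν (searchCode.ev t) ∧
      Env m (n.size + m) (3 * (m + 1)) (priceFun m d) (capFun m w (2 ^ (n.size + m + 2)))
        (scoreFun m w) t := by
  obtain ⟨μ1, k1, e1, b1, r1, -⟩ := readCode.code_spec [] 0 readCode_wf s (by simp) 0 μ hμ
  have g0 : (readCode.ev s).reg 0 = m := by simp [readCode, Cm.ev, Ex.ev, h0]
  have g1 : (readCode.ev s).reg 1 = ((m + 1 : ℕ) : ℤ) := by
    simp [readCode, Cm.ev, Ex.ev, h0]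
  have g2 : (readCode.ev s).reg 2 = ((m + 2 : ℕ) : ℤ) := by
    simp [readCode, Cm.ev, Ex.ev, h0]; ring
  have g4 : (readCode.ev s).reg 4 = n := by simp [readCode, Cm.ev, Ex.ev, h1]
  have g5 : (readCode.ev s).reg 5 = d := by simp [readCode, Cm.ev, Ex.ev, h2]
  have ga : (readCode.ev s).arr 0 = s.arr 0 := Cm.ev_arr _ 0 (by decide) _
  obtain ⟨μ2, k2, s2, e2, b2, r2, a2, c2, d2⟩ := digitsCode_spec _ μ1 r1 g4
  obtain ⟨μ3, k3, e3, b3, r3, -⟩ := phaseCode.code_spec [] 0 phaseCode_wf s2 (by simp) 0 μ2 r2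
  have p3 : (phaseCode.ev s2).reg 3 = ((n.size + m + 1 : ℕ) : ℤ) := by
    simp [phaseCode, Cm.ev, Ex.ev, d2, c2 1 (by omega), g1]; ring
  have pk : ∀ j < 30, j ≠ 3 → (phaseCode.ev s2).reg j = (readCode.ev s).reg j := by
    intro j hj hj3
    rw [← c2 j hj]
    simp [phaseCode, Cm.ev, hj3]
  have pa : (phaseCode.ev s2).arr 0 = s.arr 0 := by
    rw [Cm.ev_arr _ 0 (by decide), a2, ga]
  have q0 := (pk 0 (by omega) (by omega)).trans g0
  have q1 := (pk 1 (by omega) (by omega)).trans g1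
  have q2 := (pk 2 (by omega) (by omega)).trans g2
  have q5 := (pk 5 (by omega) (by omega)).trans g5
  -- This number bounds all four repetition counts: `m`, `m + 1`, `m + 2` and `n.size + m + 1`. It
  -- is the shift in `stepPoly`.
  obtain ⟨μ4, k4, e4, b4, r4, -⟩ := mainCode.code_spec [0, 1, 2, 3] (m + n.size + 2) mainCode_wf
    (phaseCode.ev s2) (by
      intro i hi
      simp only [List.mem_cons, List.not_mem_nil, or_false] at hi
      rcases hi with rfl | rfl | rfl | rfl
      · rw [q0]; push_cast; omega
      · rw [q1]; push_cast; omega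
      · rw [q2]; push_cast; omega
      · rw [p3]; push_cast; omega) 0 μ3 r3
  refine ⟨μ4, _, initCode.ev (phaseCode.ev s2), .seq e1 (.seq e2 (.seq e3 e4)), ?_, ?_,
    initCode_spec q0 q1 q2 p3 q5 (by rw [pa]; exact hw)⟩
  · simp only [stepPoly, Polynomial.eval_add, Polynomial.eval_mul, Polynomial.eval_C,
      Polynomial.eval_X, Polynomial.eval_comp]
    omega
  · rwa [mainCode, Cm.ev_seq] at r4

theorem index_add_inj {m : ℕ} {x y x' y' : Fin m}
    (h : 3 + ((x : ℕ) : ℤ) * m + ((y : ℕ) : ℤ) = 3 + ((x' : ℕ) : ℤ) * m + ((y' : ℕ) : ℤ)) :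
    x = x' ∧ y = y' := by
  have h' : (x : ℕ) * m + y = x' * m + y' := by
    have : (((x : ℕ) * m + y : ℕ) : ℤ) = ((x' * m + y' : ℕ) : ℤ) := by push_cast; linarith
    exact_mod_cast this
  have hm : 0 < m := x.pos
  have e1 : ((x : ℕ) * m + y) / m = x := by
    rw [Nat.add_comm, Nat.add_mul_div_right _ _ hm, Nat.div_eq_of_lt y.2, zero_add]
  have e2 : ((x' : ℕ) * m + y') / m = x' := by
    rw [Nat.add_comm, Nat.add_mul_div_right _ _ hm, Nat.div_eq_of_lt y'.2, zero_add]
  have hx : (x : ℕ) = x' := by rw [← e1, ← e2, h']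
  rw [hx] at h'
  exact ⟨Fin.ext hx, Fin.ext (by omega)⟩

variable {m n : ℕ} (T : WeightedTournament (Fin m) n) (d : Fin m)

theorem inputMemory_weight (x y : Fin m) :
    inputMemory T d (3 + ((x : ℕ) : ℤ) * m + ((y : ℕ) : ℤ)) = T.w x y := by
  have hp : (0 : ℤ) ≤ ((x : ℕ) : ℤ) * m := by positivity
  unfold inputMemory
  rw [if_neg (by omega), if_neg (by omega), if_neg (by omega), sum_eq_single x, sum_eq_single y,
    if_pos rfl]
  · intro y' _ hy
    exact if_neg fun h => hy (index_add_inj h).2.symm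
  · simp
  · intro x' _ hx
    exact sum_eq_zero fun y' _ => if_neg fun h => hx (index_add_inj h).1.symm
  · simp

theorem inputMemory_eq_zero {a : ℤ} (h : a < 0) : inputMemory T d a = 0 := by
  unfold inputMemory
  rw [if_neg (by omega), if_neg (by omega), if_neg (by omega)]
  refine sum_eq_zero fun x _ => sum_eq_zero fun y _ => if_neg fun h' => ?_
  have hp : (0 : ℤ) ≤ ((x : ℕ) : ℤ) * m := by positivity
  omega

theorem abs_inputMemory_le (a : ℤ) : |inputMemory T d a| ≤ 2 ^ (m + n.size) := by
  have hn : (n : ℤ) < 2 ^ n.size := by exact_mod_cast Nat.lt_size_self n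
  have hm : (m : ℤ) < 2 ^ m := by exact_mod_cast Nat.lt_two_pow_self
  have h1 : (1 : ℤ) ≤ 2 ^ n.size := one_le_pow₀ (by norm_num)
  have h2 : (1 : ℤ) ≤ 2 ^ m := one_le_pow₀ (by norm_num)
  have key : ∀ k : ℕ, k ≤ m ∨ k ≤ n → |(k : ℤ)| ≤ 2 ^ (m + n.size) := by
    intro k hk
    rw [abs_of_nonneg (by positivity), pow_add]
    rcases hk with hk | hk
    · have : (k : ℤ) ≤ m := by exact_mod_cast hk
      nlinarith
    · have : (k : ℤ) ≤ n := by exact_mod_cast hk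
      nlinarith
  by_cases h : ∃ x y : Fin m, a = 3 + ((x : ℕ) : ℤ) * m + ((y : ℕ) : ℤ)
  · obtain ⟨x, y, rfl⟩ := h
    rw [inputMemory_weight]
    exact key _ (.inr (T.w_le _ _))
  · push Not at h
    unfold inputMemory
    split_ifs
    · exact key _ (.inl le_rfl)
    · exact key _ (.inr le_rfl)
    · exact key _ (.inl d.2.le)
    · rw [sum_eq_zero fun x _ => sum_eq_zero fun y _ => if_neg (h x y)]
      simp

/-- The weights, extended by zero. -/
def weightFun (x y : ℕ) : ℤ := if h : x < m ∧ y < m then T.w ⟨x, h.1⟩ ⟨y, h.2⟩ else 0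

theorem weightFun_fin (x y : Fin m) : weightFun T x y = T.w x y := by
  simp [weightFun]

theorem weightFun_nonneg (x y : ℕ) : 0 ≤ weightFun T x y := by
  unfold weightFun; split <;> positivity

theorem scoreFun_fin (x : Fin m) : scoreFun m (weightFun T) x = T.bordaScore x := by
  unfold scoreFun WeightedTournament.bordaScore
  rw [← Fin.sum_univ_eq_sum_range (fun y => if (x : ℕ) = y then 0 else weightFun T x y) m]
  push_cast
  rw [← sum_erase_add univ _ (mem_univ x), if_pos rfl, add_zero]
  refine sum_congr rfl fun y hy => ?_
  rw [if_neg fun h => (mem_erase.mp hy).1 (Fin.ext h.symm), weightFun_fin]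

/-- Bounding `m` by `2 ^ m` is wasteful, but it costs only additional phases, linearly many in `m`,
and spares the program the digits of `m`. -/
theorem bordaScore_le (x : Fin m) : T.bordaScore x ≤ 2 ^ (n.size + m) := by
  have h1 : T.bordaScore x ≤ m * n := by
    unfold WeightedTournament.bordaScore
    refine (sum_le_card_nsmul _ _ n fun y _ => T.w_le x y).trans ?_
    rw [smul_eq_mul]
    exact Nat.mul_le_mul_right _ (by simp)
  have hn : n < 2 ^ n.size := Nat.lt_size_self n
  have hm : m < 2 ^ m := Nat.lt_two_pow_self
  rw [pow_add, mul_comm (2 ^ n.size)]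
  exact h1.trans (Nat.mul_le_mul hm.le hn.le)

theorem admissible : Admissible m (3 * (m + 1)) (2 ^ (n.size + m + 2)) (priceFun m d)
    (capFun m (weightFun T) (2 ^ (n.size + m + 2))) where
  price u _ v _ := by unfold priceFun; split_ifs <;> omega
  price_self u _ := by simp [priceFun]
  cap u _ v _ := by
    have := weightFun_nonneg T v u
    unfold capFun; split_ifs <;> positivity
  cap_self u _ := by simp [capFun]
  big := by push_cast; omega

/-- The run of the program: it computes a cheapest solution, over all target scores. -/
theorem exec_program (hm : 2 ≤ m) :
    ∃ (ν : Memory) (t : ℕ) (l : ℤ) (X : ℕ → ℕ → ℤ), Exec program (inputMemory T d) ν t ∧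
      t ≤ costPoly.eval (m + n.size) ∧
      Sol m (capFun m (weightFun T) (2 ^ (n.size + m + 2))) (scoreFun m (weightFun T)) l X ∧
      ν 0 = -cost (m + 1) (priceFun m d) X ∧
      (∀ x y : Fin m, ν (1 + ((x : ℕ) : ℤ) * m + ((y : ℕ) : ℤ)) = X x y) ∧
      ∀ l' : ℤ, 0 ≤ l' → l' ≤ 2 ^ (n.size + m) → ∀ Y,
        Sol m (capFun m (weightFun T) (2 ^ (n.size + m + 2))) (scoreFun m (weightFun T)) l' Y →
          cost (m + 1) (priceFun m d) X ≤ cost (m + 1) (priceFun m d) Y := by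
  have hs : ∀ i : ℕ, arrCell 0 i = i := fun i => by simp [arrCell]
  obtain ⟨ν, k, s, e, hk, hν, E⟩ := program_spec (m := m) (n := n) (d := d) (w := weightFun T)
    (s := ⟨fun _ => 0, fun a i => if a = 0 then inputMemory T d i else 0⟩)
    (μ := inputMemory T d)
    ⟨fun i => inputMemory_eq_zero T d (by unfold regCell; omega), fun a ha i => by
      dsimp only
      split_ifs with h
      · rw [h, hs]
      · exact inputMemory_eq_zero T d (by unfold arrCell; rw [if_neg h]; omega)⟩
    (by simp [inputMemory]) (by simp [inputMemory]) (by simp [inputMemory])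
    (by
      intro x hx y hy
      rw [weightFun, dif_pos ⟨hx, hy⟩, ← inputMemory_weight T d]
      simp)
  obtain ⟨l, X, hX, h0, hout, hmin⟩ := searchCode_spec E (admissible T d) hm
    (pow_le_pow_right₀ (by norm_num) (by omega))
    (by
      intro x hx
      have := scoreFun_fin T ⟨x, hx⟩
      dsimp only at this
      rw [this]
      exact ⟨by positivity, by exact_mod_cast bordaScore_le T _⟩)
    (by
      intro x hx
      have : (2 : ℤ) ^ (n.size + m + 1) ≤ 2 ^ (n.size + m + 2) :=
        pow_le_pow_right₀ (by norm_num) (by omega)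
      unfold capFun
      rw [if_neg (by omega), if_pos rfl, if_neg (by omega), if_neg (by omega), if_pos rfl]
      exact ⟨this, this⟩)
  obtain ⟨-, t, ht, htk⟩ := e.exec (program.constBound + (m + n.size))
    ((Nat.lt_two_pow_self (n := program.constBound)).le.trans
      (Nat.pow_le_pow_right (by norm_num) (by omega)))
    fun a => (abs_inputMemory_le T d a).trans (pow_le_pow_right₀ (by norm_num) (by omega))
  refine ⟨ν, t, l, X, ht, htk.trans ?_, hX, ?_, fun x y => ?_, fun l' h h' => hmin l' h ?_⟩
  · simp only [costPoly, Polynomial.eval_add, Polynomial.eval_mul, Polynomial.eval_C,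
      Polynomial.eval_X]
    gcongr
  · rw [← h0, ← hν.2 0 (by omega), hs]; rfl
  · rw [← hout x x.2 y y.2, ← hν.2 0 (by omega), hs]; push_cast; rfl
  -- The search covers the scores below `2 ^ (H + 1) - 1`, and this reaches `2 ^ H` because `2 ^ H ≥
  -- 2`.
  · have h2 : (2 : ℤ) ≤ 2 ^ (n.size + m) := by
      calc (2 : ℤ) = 2 ^ 1 := by norm_num
        _ ≤ _ := pow_le_pow_right₀ (by norm_num) (by omega)
    rw [pow_succ]; linarith

end Borda

/-! ### Repairing a deficit of the score by unit reversals -/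

namespace Reversal

open Finset

variable {V : Type*} {n : ℕ} {T : WeightedTournament V n}

theorem val_self (R : Reversal T) (x : V) : R.val x x = 0 := by
  have := R.antisymm x x
  omega

theorem size_eq_sum [Fintype V] (R : Reversal T) : R.size = ∑ x, ∑ y, max (R.val x y) 0 := by
  rw [size, sum_filter, Fintype.sum_prod_type]
  refine sum_congr rfl fun x _ => sum_congr rfl fun y _ => ?_
  split_ifs with h
  · exact (max_eq_left h.le).symm
  · exact (max_eq_right (not_lt.mp h)).symm

theorem reverse_w (R : Reversal T) (x y : V) :
    ((T.reverse R).w x y : ℤ) = T.w x y + R.val x y :=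
  Int.toNat_of_nonneg (R.nonneg x y)

variable [Fintype V] [DecidableEq V]

theorem bordaScore_reverse (R : Reversal T) (x : V) :
    ((T.reverse R).bordaScore x : ℤ) = T.bordaScore x + ∑ y, R.val x y := by
  rw [← sum_erase univ (R.val_self x)]
  unfold WeightedTournament.bordaScore
  push_cast
  rw [← sum_add_distrib]
  exact sum_congr rfl fun y _ => R.reverse_w x y

/-- Raise the value at `(d, e)` by one. -/
def raise (R : Reversal T) (d e : V) (hde : d ≠ e) (h : 0 < (T.reverse R).w e d) : Reversal T where
  val x y := R.val x y + ((if x = d ∧ y = e then 1 else 0) - if x = e ∧ y = d then 1 else 0)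
  antisymm x y := by
    rw [R.antisymm x y]; simp only [and_comm (a := x = d), and_comm (a := x = e)]; ring
  nonneg x y := by
    have h1 := R.nonneg x y
    have h2 : (0 : ℤ) < (T.reverse R).w e d := by exact_mod_cast h
    rw [R.reverse_w] at h2
    split_ifs with h3 h4 h4
    · linarith
    · linarith
    · rw [h4.1, h4.2]; linarith
    · linarith
  le x y := by
    have h1 := R.le x y
    have h2 : (0 : ℤ) < (T.reverse R).w e d := by exact_mod_cast h
    have h5 : (((T.reverse R).w d e : ℕ) : ℤ) + (T.reverse R).w e d = n := by
      exact_mod_cast (T.reverse R).w_add d e hde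
    rw [R.reverse_w d e] at h5
    split_ifs with h3 h4 h4
    · linarith
    · rw [h3.1, h3.2]; linarith
    · linarith
    · linarith

theorem bordaScore_raise (R : Reversal T) {d e : V} (hde : d ≠ e)
    (h : 0 < (T.reverse R).w e d) (x : V) :
    ((T.reverse (R.raise d e hde h)).bordaScore x : ℤ) =
      (T.reverse R).bordaScore x + ((if x = d then 1 else 0) - if x = e then 1 else 0) := by
  rw [bordaScore_reverse, bordaScore_reverse]
  simp only [raise, sum_add_distrib, sum_sub_distrib, ite_and]
  have : ∀ (P : Prop) [Decidable P] (z : V),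
      (∑ y, if P then (if y = z then (1 : ℤ) else 0) else 0) = if P then 1 else 0 := by
    intro P _ z
    split_ifs <;> simp
  rw [this, this]; ring

theorem size_raise_le (R : Reversal T) {d e : V} (hde : d ≠ e) (h : 0 < (T.reverse R).w e d) :
    (R.raise d e hde h).size ≤ R.size + 1 := by
  rw [size_eq_sum, size_eq_sum]
  have h1 : (∑ x, ∑ y, if x = d ∧ y = e then (1 : ℤ) else 0) = 1 := by
    simp [ite_and]
  rw [← h1, ← sum_add_distrib]
  refine sum_le_sum fun x _ => ?_
  rw [← sum_add_distrib]
  refine sum_le_sum fun y _ => ?_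
  simp only [raise]
  split_ifs <;> omega

/-- An alternative whose score is at most `g` below the maximum becomes a Borda winner by `g` unit
reversals. -/
theorem exists_winner (d : V) (g : ℕ) (R : Reversal T)
    (hR : ∀ x, (T.reverse R).bordaScore x ≤ (T.reverse R).bordaScore d + g) :
    ∃ R' : Reversal T, d ∈ (T.reverse R').bordaWinners ∧ R'.size ≤ R.size + g := by
  induction g generalizing R with
  | zero => exact ⟨R, hR, by simp⟩
  | succ g ih =>
    by_cases hg : ∀ x, (T.reverse R).bordaScore x ≤ (T.reverse R).bordaScore d + g
    · obtain ⟨R', h1, h2⟩ := ih R hg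
      exact ⟨R', h1, h2.trans (by push_cast; linarith)⟩
    -- If no unit can be taken from any `e`, then `d` has the full score `(|V| - 1) * n` and there
    -- is no deficit.
    · obtain ⟨e, hde, he⟩ : ∃ e, d ≠ e ∧ 0 < (T.reverse R).w e d := by
        by_contra hc
        push Not at hc
        refine hg fun x => ?_
        have h1 : (T.reverse R).bordaScore d = (Fintype.card V - 1) * n := by
          unfold WeightedTournament.bordaScore
          rw [sum_congr rfl fun y hy => show (T.reverse R).w d y = n by
            have h1 := hc y (ne_of_mem_erase hy).symm
            have h2 := (T.reverse R).w_add d y (ne_of_mem_erase hy).symm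
            omega]
          simp [card_erase_of_mem, card_univ]
        have h2 : (T.reverse R).bordaScore x ≤ (Fintype.card V - 1) * n := by
          unfold WeightedTournament.bordaScore
          refine (sum_le_card_nsmul _ _ n fun y _ => (T.reverse R).w_le x y).trans ?_
          simp [card_erase_of_mem, card_univ]
        omega
      -- One unit lifts `d` and lifts nobody else, so every deficit shrinks by at least one.
      obtain ⟨R', h1, h2⟩ := ih (R.raise d e hde he) fun x => by
        have hd := R.bordaScore_raise hde he d
        have hx := R.bordaScore_raise hde he x
        have := hR x
        rw [if_pos rfl, if_neg hde] at hd
        by_cases hxd : x = d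
        · subst hxd; omega
        · rw [if_neg hxd] at hx
          split_ifs at hx <;> omega
      exact ⟨R', h1, h2.trans (by have := R.size_raise_le hde he; push_cast; linarith)⟩

end Reversal

/-! ### Circulations and reversal functions; exactness of the penalty -/

namespace Borda

open Finset Circ

/-- Splits the cost into the size and the penalty. On a terminal arc only the harmful direction is
priced: into `x ≠ d` (score above `l`) and out of `d` (score below `l`). -/
theorem cost_priceFun {m : ℕ} (d : Fin m) {X : ℕ → ℕ → ℤ} (hX : Anti (m + 1) X) :
    cost (m + 1) (priceFun m d) X = ∑ x : Fin m, ∑ y : Fin m, max (X x y) 0 +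
      2 * ∑ x : Fin m, if x = d then max (X d m) 0 else max (X m x) 0 := by
  have h1 : ∀ x : Fin m, (∑ v ∈ range (m + 1), priceFun m d x v * max (X x v) 0) =
      ∑ y : Fin m, max (X x y) 0 + if x = d then 2 * max (X d m) 0 else 0 := by
    intro x
    have hx := x.2
    rw [sum_range_succ, ← Fin.sum_univ_eq_sum_range (fun v => priceFun m d x v * max (X x v) 0)]
    congr 1
    · refine sum_congr rfl fun y _ => ?_
      have hy := y.2
      unfold priceFun
      split_ifs with g1 g2 g3 <;> try omega
      have := hX x (by omega) x (by omega)
      rw [← g1, show X x x = 0 by omega]; simp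
    · unfold priceFun
      rw [if_neg (by omega), if_neg (by omega), if_pos rfl]
      simp only [Fin.val_inj]
      split_ifs with g
      · rw [g]
      · ring
  have h2 : (∑ v ∈ range (m + 1), priceFun m d m v * max (X m v) 0) =
      ∑ x : Fin m, if x = d then 0 else 2 * max (X m x) 0 := by
    rw [sum_range_succ, ← Fin.sum_univ_eq_sum_range (fun v => priceFun m d m v * max (X m v) 0)]
    have : priceFun m d m m = 0 := by simp [priceFun]
    rw [this, zero_mul, add_zero]
    refine sum_congr rfl fun x _ => ?_
    have hx := x.2
    unfold priceFun
    rw [if_neg (by omega), if_pos rfl]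
    simp only [Fin.val_inj]
    split_ifs <;> ring
  unfold cost
  rw [sum_range_succ, ← Fin.sum_univ_eq_sum_range
    (fun u => ∑ v ∈ range (m + 1), priceFun m d u v * max (X u v) 0), h2, sum_congr rfl fun x _ =>
    h1 x, sum_add_distrib, add_assoc, ← sum_add_distrib, mul_sum]
  congr 1
  refine sum_congr rfl fun x _ => ?_
  split_ifs <;> ring

variable {m n : ℕ} {T : WeightedTournament (Fin m) n} {B l : ℤ} {X : ℕ → ℕ → ℤ}

theorem Sol.le_weight (hX : Sol m (capFun m (weightFun T) B) (scoreFun m (weightFun T)) l X)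
    {x y : Fin m} (hxy : x ≠ y) : X x y ≤ T.w y x := by
  have hx := x.2
  have hy := y.2
  have := hX.within x (by omega) y (by omega)
  unfold capFun at this
  rwa [if_neg (by rwa [Fin.val_inj]), if_neg (by omega), if_neg (by omega), weightFun_fin] at this

/-- The reversal function of a solution. -/
def Sol.reversal
    (hX : Sol m (capFun m (weightFun T) B) (scoreFun m (weightFun T)) l X) : Reversal T where
  val x y := X x y
  antisymm x y := hX.anti x (by omega) y (by omega)
  nonneg x y := by
    have h1 := hX.anti x (by omega) y (by omega)
    rcases eq_or_ne x y with rfl | h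
    · have := Int.natCast_nonneg (T.w x x); omega
    · have := hX.le_weight h.symm; omega
  le x y := by
    have h1 := hX.anti x (by omega) y (by omega)
    have h2 : (T.w x y : ℤ) ≤ n := by exact_mod_cast T.w_le x y
    rcases eq_or_ne x y with rfl | h
    · omega
    · have h3 := hX.le_weight h
      have h4 : (T.w x y : ℤ) + T.w y x = n := by exact_mod_cast T.w_add x y h
      omega

/-- The prescribed inflow of `x` is its old score minus `l`. Since the inflow from the other
alternatives is minus the gain of `x`, the terminal arc carries exactly the excess of the new score
over `l`. -/
theorem Sol.bordaScore
    (hX : Sol m (capFun m (weightFun T) B) (scoreFun m (weightFun T)) l X) (x : Fin m) :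
    ((T.reverse hX.reversal).bordaScore x : ℤ) = l + X m x := by
  have h1 := hX.col x (by omega)
  rw [colSum_startMat_lt l x.2, scoreFun_fin, colSum, sum_range_succ,
    ← Fin.sum_univ_eq_sum_range (fun u => X u x)] at h1
  have h2 : ∑ y, hX.reversal.val x y = -∑ y : Fin m, X y x := by
    rw [← sum_neg_distrib]
    exact sum_congr rfl fun y _ => hX.anti x (by omega) y (by omega)
  rw [Reversal.bordaScore_reverse, h2]
  linarith

/-- The solution of a reversal function. -/
def solMat (R : Reversal T) (l : ℤ) (u v : ℕ) : ℤ :=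
  if hu : u < m then
    if hv : v < m then R.val ⟨u, hu⟩ ⟨v, hv⟩ else l - (T.reverse R).bordaScore ⟨u, hu⟩
  else if hv : v < m then (T.reverse R).bordaScore ⟨v, hv⟩ - l else 0

theorem solMat_fin (R : Reversal T) (l : ℤ) (x y : Fin m) : solMat R l x y = R.val x y := by
  simp [solMat]

theorem solMat_left (R : Reversal T) (l : ℤ) (x : Fin m) :
    solMat R l m x = (T.reverse R).bordaScore x - l := by
  simp [solMat]

theorem solMat_right (R : Reversal T) (l : ℤ) (x : Fin m) :
    solMat R l x m = l - (T.reverse R).bordaScore x := by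
  simp [solMat]

theorem solMat_self (R : Reversal T) (l : ℤ) : solMat R l m m = 0 := by simp [solMat]

theorem solMat_anti (R : Reversal T) (l : ℤ) : Anti (m + 1) (solMat R l) := by
  intro u _ v _
  unfold solMat
  split_ifs
  · exact R.antisymm _ _
  · ring
  · ring
  · simp

/-- The terminal arcs are defined so as to balance the alternatives; the terminal node is then
balanced too, since an antisymmetric matrix sums to zero and reversals preserve the total score. -/
theorem solMat_sol (R : Reversal T) (h0 : 0 ≤ l) (hl : l ≤ 2 ^ (n.size + m))
    (hB : 2 ^ (n.size + m) ≤ B) :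
    Sol m (capFun m (weightFun T) B) (scoreFun m (weightFun T)) l (solMat R l) where
  anti := solMat_anti R l
  within u _ v _ := by
    have hs : ∀ x, 0 ≤ ((T.reverse R).bordaScore x : ℤ) ∧
        ((T.reverse R).bordaScore x : ℤ) ≤ 2 ^ (n.size + m) := fun x =>
      ⟨by positivity, by exact_mod_cast bordaScore_le (T.reverse R) x⟩
    by_cases huv : u = v
    · subst huv
      have := solMat_anti R l u (by omega) u (by omega)
      rw [capFun, if_pos rfl]; omega
    · rw [capFun, if_neg huv]
      by_cases hu : u < m
      · rw [if_neg hu.ne]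
        by_cases hv : v < m
        · rw [if_neg hv.ne, weightFun, dif_pos ⟨hv, hu⟩, solMat, dif_pos hu, dif_pos hv]
          have h8 := R.le ⟨u, hu⟩ ⟨v, hv⟩
          have h9 : (T.w ⟨u, hu⟩ ⟨v, hv⟩ : ℤ) + T.w ⟨v, hv⟩ ⟨u, hu⟩ = n := by
            exact_mod_cast T.w_add ⟨u, hu⟩ ⟨v, hv⟩ (by simpa using huv)
          omega
        · have := hs ⟨u, hu⟩
          rw [if_pos (by omega), solMat, dif_pos hu, dif_neg hv]
          omega
      · have hv : v < m := by omega
        have := hs ⟨v, hv⟩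
        rw [if_pos (by omega), solMat, dif_neg hu, dif_pos hv]
        omega
  col v hv := by
    have hc : ∀ x : Fin m, ∑ u : Fin m, solMat R l u x =
        (T.bordaScore x : ℤ) - (T.reverse R).bordaScore x := by
      intro x
      rw [R.bordaScore_reverse, sub_add_cancel_left, ← sum_neg_distrib]
      refine sum_congr rfl fun y _ => ?_
      rw [solMat_fin, R.antisymm]
    rw [colSum, sum_range_succ, ← Fin.sum_univ_eq_sum_range (fun u => solMat R l u v)]
    rcases Nat.lt_succ_iff_lt_or_eq.mp hv with h | rfl
    · rw [colSum_startMat_lt l h, hc ⟨v, h⟩, scoreFun_fin T ⟨v, h⟩, solMat_left R l ⟨v, h⟩]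
      ring
    · rw [colSum_startMat_self, ← Fin.sum_univ_eq_sum_range, solMat_self, add_zero]
      have hz : ∑ x, ∑ y, R.val x y = 0 := by
        have h1 : ∑ x, ∑ y, R.val x y = -∑ x, ∑ y, R.val x y := by
          conv_lhs => rw [sum_comm]
          rw [← sum_neg_distrib]
          refine sum_congr rfl fun x _ => ?_
          rw [← sum_neg_distrib]
          exact sum_congr rfl fun y _ => R.antisymm _ _
        omega
      simp only [solMat_right, scoreFun_fin, R.bordaScore_reverse, sum_sub_distrib,
        sum_add_distrib, hz]
      simp

/-- A program computes the margin of victory of Borda non-winners in polynomial time. -/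
theorem margin_of_victory_polynomial :
    ∃ (P : Program) (p : Polynomial ℕ),
      ∀ (m n : ℕ) (_ : 0 < n) (T : WeightedTournament (Fin m) n) (d : Fin m),
        d ∉ T.bordaWinners →
          ∃ (ν : Memory) (t : ℕ),
            Exec P (inputMemory T d) ν t ∧
            t ≤ p.eval (m + n.size) ∧
            ν 0 = marginOfVictory WeightedTournament.bordaWinners T d ∧
            ∃ R : Reversal T,
              R.IsMinimum (fun R' => R'.IsWCRS WeightedTournament.bordaWinners d) ∧
              R.size = -ν 0 ∧
              ∀ x y : Fin m, ν (1 + ((x : ℕ) : ℤ) * m + ((y : ℕ) : ℤ)) = R.val x y := by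
  refine ⟨program, costPoly, fun m n _ T d hd => ?_⟩
  have hm : 2 ≤ m := by
    by_contra hm
    refine hd fun y => ?_
    have h1 := y.2
    have h2 := d.2
    rw [show y = d from Fin.ext (by omega)]
  obtain ⟨ν, t, l, X, he, ht, hX, h0, hout, hmin⟩ := exec_program T d hm
  have hXc := cost_priceFun d hX.anti
  have hsize : hX.reversal.size = ∑ x : Fin m, ∑ y : Fin m, max (X x y) 0 :=
    hX.reversal.size_eq_sum
  rw [← hsize] at hXc
  set E := ∑ x : Fin m, if x = d then max (X d m) 0 else max (X m x) 0 with hE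
  have hE0 : ∀ x ∈ (univ : Finset (Fin m)), 0 ≤ if x = d then max (X d m) 0 else max (X m x) 0 :=
    fun x _ => by split_ifs <;> exact le_max_right _ _
  have hEd : X d m ≤ E := by
    refine le_trans ?_ (single_le_sum hE0 (mem_univ d))
    rw [if_pos rfl]; exact le_max_left _ _
  have hanti := hX.anti d (by omega) m (by omega)
  have hEx : ∀ x, x ≠ d → X m x + X d m ≤ E := by
    intro x hx
    rw [hE, ← add_sum_erase _ _ (mem_univ d), if_pos rfl]
    have h1 : X m x ≤ ∑ x ∈ univ.erase d, if x = d then max (X d m) 0 else max (X m x) 0 := by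
      refine le_trans ?_ (single_le_sum (fun y _ => hE0 y (mem_univ y))
        (mem_erase.mpr ⟨hx, mem_univ x⟩))
      rw [if_neg hx]; exact le_max_left _ _
    have := le_max_left (X d m) 0
    linarith
  have hE0' : 0 ≤ E := sum_nonneg hE0
  -- With the new score of `d` as target, nobody exceeds it and `d` meets it: the penalty is zero
  -- and the cost is the size.
  have hwin : ∀ R : Reversal T, d ∈ (T.reverse R).bordaWinners →
      cost (m + 1) (priceFun m d) X ≤ R.size := by
    intro R hR
    obtain ⟨l', hl'⟩ : ∃ l' : ℤ, l' = (T.reverse R).bordaScore d := ⟨_, rfl⟩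
    have hl0 : 0 ≤ l' := by rw [hl']; positivity
    have hl1 : l' ≤ 2 ^ (n.size + m) := by
      rw [hl']; exact_mod_cast bordaScore_le (T.reverse R) d
    have h1 := hmin l' hl0 hl1 (solMat R l') (solMat_sol R hl0 hl1
      (pow_le_pow_right₀ (by norm_num) (by omega)))
    refine h1.trans (le_of_eq ?_)
    rw [cost_priceFun d (solMat_anti R l'), R.size_eq_sum]
    simp only [solMat_fin, solMat_left, solMat_right]
    rw [sum_eq_zero (s := univ) (f := fun x : Fin m => if x = d then _ else _), mul_zero, add_zero]
    intro x _
    split_ifs with h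
    · simp [hl']
    · refine max_eq_right ?_
      have : (T.reverse R).bordaScore x ≤ (T.reverse R).bordaScore d := hR x
      omega
  -- The lead of any `x` over `d` is its excess over `l` plus the shortfall of `d`, hence at most
  -- the total violation `E`.
  obtain ⟨R₁, hR₁, hs₁⟩ := Reversal.exists_winner d E.toNat hX.reversal (by
    intro x
    have h1 := hX.bordaScore x
    have h2 := hX.bordaScore d
    rcases eq_or_ne x d with rfl | hx
    · omega
    · have := hEx x hx
      omega)
  have h4 := hwin R₁ hR₁
  -- The optimum pays its size plus `2 * E`, whereas the repaired competitor pays at most the size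
  -- plus `E`.
  have hEz : E = 0 := by omega
  have hdw : d ∈ (T.reverse hX.reversal).bordaWinners := by
    intro x
    have h1 := hX.bordaScore x
    have h2 := hX.bordaScore d
    rcases eq_or_ne x d with rfl | hx
    · exact le_rfl
    · have := hEx x hx
      omega
  have hν : ν 0 = -hX.reversal.size := by rw [h0, hXc, hEz]; ring
  have hle : ∀ R : Reversal T, d ∈ (T.reverse R).bordaWinners → hX.reversal.size ≤ R.size := by
    intro R hR
    have := hwin R hR
    omega
  refine ⟨ν, t, he, ht, ?_, hX.reversal, ⟨⟨hd, hdw⟩, fun R' h => hle R' h.2⟩, by rw [hν]; ring,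
    fun x y => hout x y⟩
  have hleast : IsLeast {k : ℤ | ∃ R : Reversal T,
      R.IsWCRS WeightedTournament.bordaWinners d ∧ R.size = k} hX.reversal.size :=
    ⟨⟨_, ⟨hd, hdw⟩, rfl⟩, by rintro _ ⟨R, hR, rfl⟩; exact hle R hR.2⟩
  rw [marginOfVictory, if_neg hd, hleast.csInf_eq, hν]

end Borda

/-! ## The flow network -/

namespace BordaFlow

open Finset

variable {V : Type*}

/-- The reversed pair. -/
def _root_.OPair.swap (p : OPair V) : OPair V := ⟨p.1.swap, p.2.symm⟩

theorem toUPair_eq_iff {p q : OPair V} : p.toUPair = q.toUPair ↔ p = q ∨ p = q.swap := by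
  rw [OPair.toUPair, OPair.toUPair, Subtype.mk.injEq, Sym2.eq_iff, Subtype.ext_iff,
    Subtype.ext_iff, Prod.ext_iff, Prod.ext_iff]
  rfl

theorem exists_toUPair (e : UPair V) : ∃ p : OPair V, p.toUPair = e := by
  obtain ⟨e, he⟩ := e
  induction e with
  | h x y => exact ⟨⟨(x, y), fun h => he (Sym2.mk_isDiag_iff.mpr h)⟩, rfl⟩

variable [DecidableEq V] {d : V}

/-- The flow on the green edges, extended by zero to the diagonal. -/
def green (f : BordaEdge d → ℕ) (x y : V) : ℤ :=
  if h : x ≠ y then f (.inr (.inl ⟨(x, y), h⟩)) else 0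

/-- The flow on the red edges, extended by zero to the diagonal. -/
def red (f : BordaEdge d → ℕ) (x y : V) : ℤ :=
  if h : x ≠ y then f (.inr (.inr (.inl ⟨(x, y), h⟩))) else 0

theorem green_opair (f : BordaEdge d → ℕ) (p : OPair V) :
    (f (.inr (.inl p)) : ℤ) = green f p.1.1 p.1.2 := by
  rw [green, dif_pos p.2]

theorem red_opair (f : BordaEdge d → ℕ) (p : OPair V) :
    (f (.inr (.inr (.inl p))) : ℤ) = red f p.1.1 p.1.2 := by
  rw [red, dif_pos p.2]

theorem red_nonneg (f : BordaEdge d → ℕ) (x y : V) : 0 ≤ red f x y := by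
  unfold red; split <;> positivity

theorem green_nonneg (f : BordaEdge d → ℕ) (x y : V) : 0 ≤ green f x y := by
  unfold green; split <;> positivity

theorem red_self (f : BordaEdge d → ℕ) (x : V) : red f x x = 0 := dif_neg (by simp)

variable [Fintype V]

theorem sum_toUPair (p : OPair V) (F : OPair V → ℤ) :
    (∑ q : OPair V, if q.toUPair = p.toUPair then F q else 0) = F p + F p.swap := by
  have hne : p ≠ p.swap := fun h => p.2 (congrArg (fun q : OPair V => q.1.1) h)
  rw [← sum_filter, ← sum_pair hne]
  refine sum_congr (ext fun q => ?_) fun _ _ => rfl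
  simp [toUPair_eq_iff]

theorem sum_opair (φ : V → V → ℤ) :
    ∑ p : OPair V, φ p.1.1 p.1.2 = ∑ x, ∑ y ∈ univ.erase x, φ x y := by
  rw [← sum_subtype (univ.filter fun p : V × V => p.1 ≠ p.2) (by simp) fun p => φ p.1 p.2,
    sum_filter, Fintype.sum_prod_type]
  refine sum_congr rfl fun x _ => ?_
  rw [← filter_ne, sum_filter]

theorem sum_opair_fst (φ : V → V → ℤ) (x : V) :
    (∑ p : OPair V, if p.1.1 = x then φ p.1.1 p.1.2 else 0) = ∑ y ∈ univ.erase x, φ x y := by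
  rw [sum_opair fun a b => if a = x then φ a b else 0, sum_eq_single x]
  · simp
  · intro z _ hz
    exact sum_eq_zero fun _ _ => if_neg hz
  · simp

variable {n : ℕ} {T : WeightedTournament V n} {l : ℕ} {f : BordaEdge d → ℕ}

theorem card_upair : (Fintype.card (UPair V)) = (Fintype.card V).choose 2 := by
  rw [← Sym2.card_subtype_not_diag]

theorem flowCost_eq (T : WeightedTournament V n) (l : ℕ) (f : BordaEdge d → ℕ) :
    (bordaNetwork T d l).flowCost f = ∑ x, ∑ y, red f x y := by
  have h : (bordaNetwork T d l).flowCost f = ∑ p : OPair V, red f p.1.1 p.1.2 := by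
    simp [FlowNetwork.flowCost, bordaNetwork, red_opair]
  rw [h, sum_opair]
  exact sum_congr rfl fun x _ => sum_erase _ (red_self f x)

/-- `f` is an integral `b`-flow, in terms of its values. -/
theorem isFlow_iff : (bordaNetwork T d l).IsFlow f ↔
    (∀ e, f e ≤ (bordaNetwork T d l).capacity e) ∧
    ∑ e, (f (.inl e) : ℤ) = n * (Fintype.card V).choose 2 ∧
    (∀ p : OPair V, green f p.1.1 p.1.2 + green f p.1.2 p.1.1 +
      (red f p.1.1 p.1.2 + red f p.1.2 p.1.1) = f (.inl p.toUPair)) ∧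
    ∑ y ∈ univ.erase d, (green f d y + red f d y) = l ∧
    (∀ x : {x : V // x ≠ d}, (f (.inr (.inr (.inr x))) : ℤ) =
      ∑ y ∈ univ.erase x.1, (green f x y + red f x y)) ∧
    ∑ x : {x : V // x ≠ d}, (f (.inr (.inr (.inr x))) : ℤ) =
      n * (Fintype.card V).choose 2 - l := by
  rw [FlowNetwork.IsFlow]
  refine and_congr_right fun _ => ⟨fun h => ⟨?_, ?_, ?_, ?_, ?_⟩, ?_⟩
  · have := h .source
    rw [sum_filter, sum_filter] at this
    simpa [bordaNetwork] using this
  · intro p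
    have := h (.pair p.toUPair)
    rw [sum_filter, sum_filter] at this
    simp [bordaNetwork, green_opair, red_opair, sum_toUPair] at this
    simp only [OPair.swap, Prod.fst_swap, Prod.snd_swap] at this
    linarith
  · have := h (.alt d)
    rw [sum_filter, sum_filter] at this
    simp [bordaNetwork, green_opair, red_opair, sum_opair_fst, -sum_erase_eq_sub] at this
    rw [sum_add_distrib]
    rw [sum_eq_zero fun x _ => if_neg x.2] at this
    linarith
  · intro x
    have := h (.alt x)
    rw [sum_filter, sum_filter] at this
    simp [bordaNetwork, green_opair, red_opair, sum_opair_fst, -sum_erase_eq_sub, x.2,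
      ← Subtype.ext_iff] at this
    rw [sum_add_distrib]
    linarith
  · have := h .sink
    rw [sum_filter, sum_filter] at this
    simp [bordaNetwork] at this
    linarith
  · rintro ⟨h1, h2, h3, h4, h5⟩ v
    rw [sum_filter, sum_filter]
    cases v with
    | source => simpa [bordaNetwork] using h1
    | pair e =>
      obtain ⟨p, rfl⟩ := exists_toUPair e
      have := h2 p
      simp [bordaNetwork, green_opair, red_opair, sum_toUPair]
      simp only [OPair.swap, Prod.fst_swap, Prod.snd_swap]
      linarith
    | alt x =>
      simp [bordaNetwork, green_opair, red_opair, sum_opair_fst, -sum_erase_eq_sub]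
      split_ifs with h
      · subst h
        rw [sum_add_distrib] at h3
        rw [sum_eq_zero fun x _ => if_neg x.2]
        linarith
      · have := h4 ⟨x, h⟩
        rw [sum_add_distrib] at this
        have h6 : (∑ y : {x // x ≠ d}, if (y : V) = x then (f (.inr (.inr (.inr y))) : ℤ) else 0) =
            f (.inr (.inr (.inr ⟨x, h⟩))) := by
          rw [sum_eq_single ⟨x, h⟩] <;> simp +contextual [Subtype.ext_iff]
        rw [h6]
        linarith
    | sink => simp [bordaNetwork]; linarith

/-- The outflow demanded of the source equals the total capacity of its edges, so each of them is
saturated. -/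
theorem pair_flow (hf : (bordaNetwork T d l).IsFlow f) (p : OPair V) :
    green f p.1.1 p.1.2 + green f p.1.2 p.1.1 + (red f p.1.1 p.1.2 + red f p.1.2 p.1.1) = n := by
  obtain ⟨hc, h1, h2, -⟩ := isFlow_iff.mp hf
  rw [h2 p]
  have h3 : ∑ e : UPair V, (f (.inl e) : ℤ) = ∑ e : UPair V, (n : ℤ) := by
    rw [h1, sum_const, card_univ, card_upair]; simp [mul_comm]
  refine (sum_eq_sum_iff_of_le fun e _ => ?_).mp h3 p.toUPair (mem_univ _)
  exact_mod_cast hc (.inl e)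

theorem green_le (hf : (bordaNetwork T d l).IsFlow f) {x y : V} (h : x ≠ y) :
    green f x y ≤ T.w x y := by
  rw [green, dif_pos h]
  exact_mod_cast hf.1 (.inr (.inl ⟨(x, y), h⟩))

/-- The reversal function of a flow: it changes the weights to the inflows. -/
def toReversal (hf : (bordaNetwork T d l).IsFlow f) : Reversal T where
  val x y := if x = y then 0 else green f x y + red f x y - T.w x y
  antisymm x y := by
    rcases eq_or_ne x y with rfl | h
    · simp
    · rw [if_neg h, if_neg h.symm]
      have h1 := pair_flow hf ⟨(x, y), h⟩
      have h2 : (T.w x y : ℤ) + T.w y x = n := by exact_mod_cast T.w_add x y h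
      dsimp only at h1
      linarith
  nonneg x y := by
    have h1 := green_nonneg f x y
    have h2 := red_nonneg f x y
    split_ifs <;> omega
  le x y := by
    rcases eq_or_ne x y with rfl | h
    · have : (T.w x x : ℤ) ≤ n := by exact_mod_cast T.w_le x x
      simpa using this
    · rw [if_neg h]
      have h1 := pair_flow hf ⟨(x, y), h⟩
      have h2 := green_nonneg f y x
      have h3 := red_nonneg f y x
      dsimp only at h1
      linarith

theorem bordaScore_toReversal (hf : (bordaNetwork T d l).IsFlow f) (x : V) :
    ((T.reverse (toReversal hf)).bordaScore x : ℤ) =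
      ∑ y ∈ univ.erase x, (green f x y + red f x y) := by
  unfold WeightedTournament.bordaScore
  push_cast
  refine sum_congr rfl fun y hy => ?_
  rw [Reversal.reverse_w, toReversal]
  dsimp only
  rw [if_neg (ne_of_mem_erase hy).symm]
  ring

theorem bordaScore_toReversal_self (hf : (bordaNetwork T d l).IsFlow f) :
    (T.reverse (toReversal hf)).bordaScore d = l := by
  have := bordaScore_toReversal hf d
  rw [(isFlow_iff.mp hf).2.2.2.1] at this
  exact_mod_cast this

/-- The new score of `x ≠ d` leaves through its edge to the sink, whose capacity is `l`, the score
of `d`. -/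
theorem mem_bordaWinners_toReversal (hf : (bordaNetwork T d l).IsFlow f) :
    d ∈ (T.reverse (toReversal hf)).bordaWinners := by
  intro x
  rw [bordaScore_toReversal_self]
  rcases eq_or_ne x d with rfl | h
  · exact (bordaScore_toReversal_self hf).le
  · have h1 := bordaScore_toReversal hf x
    rw [← (isFlow_iff.mp hf).2.2.2.2.1 ⟨x, h⟩] at h1
    have h2 : f (.inr (.inr (.inr ⟨x, h⟩))) ≤ l := hf.1 (.inr (.inr (.inr ⟨x, h⟩)))
    omega

/-- Green edges carry at most the old weight, so any gain must come through the red edge. -/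
theorem max_toReversal_le (hf : (bordaNetwork T d l).IsFlow f) (x y : V) :
    max ((toReversal hf).val x y) 0 ≤ red f x y := by
  refine max_le ?_ (red_nonneg f x y)
  rw [toReversal]
  dsimp only
  split_ifs with h
  · exact red_nonneg f x y
  · have := green_le hf h
    linarith

theorem size_toReversal_le (hf : (bordaNetwork T d l).IsFlow f) :
    (toReversal hf).size ≤ (bordaNetwork T d l).flowCost f := by
  rw [Reversal.size_eq_sum, flowCost_eq]
  exact sum_le_sum fun x _ => sum_le_sum fun y _ => max_toReversal_le hf x y

/-- Equality of the sums turns the termwise bound `max_toReversal_le` into equality; and `R x y` is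
its positive part minus that of `R y x`. -/
theorem isReadOff_toReversal (hf : (bordaNetwork T d l).IsFlow f)
    (h : (toReversal hf).size = (bordaNetwork T d l).flowCost f) : (toReversal hf).IsReadOff f := by
  rw [Reversal.size_eq_sum, flowCost_eq] at h
  have h1 : ∀ x y, max ((toReversal hf).val x y) 0 = red f x y := fun x y =>
    (sum_eq_sum_iff_of_le fun y _ => max_toReversal_le hf x y).mp
      ((sum_eq_sum_iff_of_le fun x _ => sum_le_sum fun y _ => max_toReversal_le hf x y).mp h x
        (mem_univ x)) y (mem_univ y)
  intro x y hxy
  rw [red_opair, red_opair]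
  dsimp only
  rw [← h1, ← h1, (toReversal hf).antisymm y x]
  omega

/-- The flow of a reversal function. -/
def ofReversal (d : V) (R : Reversal T) : BordaEdge d → ℕ
  | .inl _ => n
  | .inr (.inl p) => ((T.w p.1.1 p.1.2 : ℤ) + min (R.val p.1.1 p.1.2) 0).toNat
  | .inr (.inr (.inl p)) => (R.val p.1.1 p.1.2).toNat
  | .inr (.inr (.inr x)) => (T.reverse R).bordaScore x

theorem green_ofReversal (R : Reversal T) {x y : V} (h : x ≠ y) :
    green (ofReversal d R) x y = T.w x y + min (R.val x y) 0 := by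
  rw [green, dif_pos h]
  have := R.nonneg x y
  simp only [ofReversal]
  omega

theorem red_ofReversal (R : Reversal T) (x y : V) :
    red (ofReversal d R) x y = max (R.val x y) 0 := by
  rw [red]
  split_ifs with h
  · simp only [ofReversal]
    omega
  · rw [not_not] at h
    rw [h, R.val_self]; simp

theorem flowCost_ofReversal (R : Reversal T) (l : ℕ) :
    (bordaNetwork T d l).flowCost (ofReversal d R) = R.size := by
  rw [flowCost_eq, R.size_eq_sum]
  simp only [red_ofReversal]

theorem isReadOff_ofReversal (R : Reversal T) : R.IsReadOff (ofReversal d R) := by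
  intro x y h
  rw [red_opair, red_opair, red_ofReversal, red_ofReversal]
  dsimp only
  rw [R.antisymm y x]
  omega

theorem sum_bordaScore (T : WeightedTournament V n) :
    ∑ x, (T.bordaScore x : ℤ) = n * (Fintype.card V).choose 2 := by
  have h1 : ∑ x, (T.bordaScore x : ℤ) = ∑ p : OPair V, (T.w p.1.1 p.1.2 : ℤ) := by
    rw [sum_opair fun x y => (T.w x y : ℤ)]
    simp [WeightedTournament.bordaScore]
  rw [h1, ← sum_fiberwise univ OPair.toUPair, ← card_upair]
  rw [sum_congr rfl fun e _ => show _ = (n : ℤ) by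
    obtain ⟨p, rfl⟩ := exists_toUPair e
    rw [sum_filter, sum_toUPair p fun q => (T.w q.1.1 q.1.2 : ℤ)]
    exact_mod_cast T.w_add p.1.1 p.1.2 p.2]
  simp [mul_comm]

/-- Green carries the smaller of old and new weight and red the gain, so the inflow of an
alternative is its new score. The sink capacities hold because `d` wins with `l`, and the balance of
the sink is the invariance of the total score. -/
theorem isFlow_ofReversal (R : Reversal T) (hd : d ∈ (T.reverse R).bordaWinners)
    (hl : (T.reverse R).bordaScore d = l) : (bordaNetwork T d l).IsFlow (ofReversal d R) := by
  have hs : ∀ x, ((T.reverse R).bordaScore x : ℤ) =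
      ∑ y ∈ univ.erase x, (green (ofReversal d R) x y + red (ofReversal d R) x y) := by
    intro x
    unfold WeightedTournament.bordaScore
    push_cast
    refine sum_congr rfl fun y hy => ?_
    rw [R.reverse_w, green_ofReversal R (ne_of_mem_erase hy).symm, red_ofReversal]
    omega
  refine isFlow_iff.mpr ⟨?_, ?_, fun p => ?_, ?_, fun x => hs x, ?_⟩
  · rintro (e | p | p | x)
    · exact le_rfl
    · simp only [ofReversal, bordaNetwork]
      omega
    · have h1 := R.le p.1.1 p.1.2
      have h2 := T.w_add p.1.1 p.1.2 p.2
      simp only [ofReversal, bordaNetwork]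
      omega
    · have := hd x.1
      rw [hl] at this
      exact this
  · simp [ofReversal, ← card_upair, mul_comm]
  · rw [green_ofReversal R p.2, green_ofReversal R p.2.symm, red_ofReversal, red_ofReversal,
      R.antisymm p.1.2 p.1.1]
    have : (T.w p.1.1 p.1.2 : ℤ) + T.w p.1.2 p.1.1 = n := by
      exact_mod_cast T.w_add p.1.1 p.1.2 p.2
    simp only [ofReversal]
    omega
  · rw [← hs, hl]
  · have h1 := sum_bordaScore (T.reverse R)
    rw [← add_sum_erase _ _ (mem_univ d), hl,
      sum_subtype (univ.erase d) (p := fun x => x ≠ d) (by simp)] at h1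
    simp only [ofReversal]
    linarith

/-- A sandwich: the size of `toReversal` is at most the cost of `f`, which by minimality is at most
the size of every competitor, in particular of `toReversal` itself. -/
theorem exists_of_isMinCostFlow (hd : d ∉ T.bordaWinners)
    (hf : (bordaNetwork T d l).IsMinCostFlow f) :
    ∃ R : Reversal T, R.IsReadOff f ∧ R.size = (bordaNetwork T d l).flowCost f ∧
      R.IsMinimum (fun R' => R'.IsWCRS WeightedTournament.bordaWinners d ∧
        (T.reverse R').bordaScore d = l) := by
  have hle : ∀ R : Reversal T, R.IsWCRS WeightedTournament.bordaWinners d →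
      (T.reverse R).bordaScore d = l → (bordaNetwork T d l).flowCost f ≤ R.size := by
    intro R h1 h2
    rw [← flowCost_ofReversal (d := d) R l]
    exact hf.2 _ (isFlow_ofReversal R h1.2 h2)
  have hw : (toReversal hf.1).IsWCRS WeightedTournament.bordaWinners d :=
    ⟨hd, mem_bordaWinners_toReversal hf.1⟩
  have hs := bordaScore_toReversal_self hf.1
  have heq := le_antisymm (size_toReversal_le hf.1) (hle _ hw hs)
  exact ⟨toReversal hf.1, isReadOff_toReversal hf.1 heq, heq, ⟨hw, hs⟩, fun R' h =>
    heq.le.trans (hle R' h.1 h.2)⟩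

theorem exists_isMinCostFlow (hd : d ∉ T.bordaWinners) {R : Reversal T}
    (hR : R.IsMinimum (fun R' => R'.IsWCRS WeightedTournament.bordaWinners d ∧
      (T.reverse R').bordaScore d = l)) :
    ∃ f : BordaEdge d → ℕ, (bordaNetwork T d l).IsMinCostFlow f ∧ R.IsReadOff f ∧
      R.size = (bordaNetwork T d l).flowCost f := by
  refine ⟨ofReversal d R, ⟨isFlow_ofReversal R hR.1.1.2 hR.1.2, fun g hg => ?_⟩,
    isReadOff_ofReversal R, (flowCost_ofReversal R l).symm⟩
  rw [flowCost_ofReversal]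
  exact (hR.2 (toReversal hg) ⟨⟨hd, mem_bordaWinners_toReversal hg⟩,
    bordaScore_toReversal_self hg⟩).trans (size_toReversal_le hg)

end BordaFlow

theorem mainTheorem2 :
    (∃ (P : Program) (p : Polynomial ℕ),
      ∀ (m n : ℕ) (_ : 0 < n) (T : WeightedTournament (Fin m) n) (d : Fin m),
        d ∉ T.bordaWinners →
          ∃ (ν : Memory) (t : ℕ),
            Exec P (inputMemory T d) ν t ∧
            t ≤ p.eval (m + n.size) ∧
            ν 0 = marginOfVictory WeightedTournament.bordaWinners T d ∧
            ∃ R : Reversal T,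
              R.IsMinimum (fun R' => R'.IsWCRS WeightedTournament.bordaWinners d) ∧
              R.size = -ν 0 ∧
              ∀ x y : Fin m, ν (1 + ((x : ℕ) : ℤ) * m + ((y : ℕ) : ℤ)) = R.val x y) ∧
    (∀ (V : Type*) [Fintype V] [DecidableEq V] (n : ℕ) (_ : 0 < n)
        (T : WeightedTournament V n) (d : V), d ∉ T.bordaWinners → ∀ l : ℕ,
      (∀ f : BordaEdge d → ℕ, (bordaNetwork T d l).IsMinCostFlow f →
        ∃ R : Reversal T, R.IsReadOff f ∧
          R.size = (bordaNetwork T d l).flowCost f ∧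
          R.IsMinimum (fun R' => R'.IsWCRS WeightedTournament.bordaWinners d ∧
            (T.reverse R').bordaScore d = l)) ∧
      (∀ R : Reversal T,
        R.IsMinimum (fun R' => R'.IsWCRS WeightedTournament.bordaWinners d ∧
            (T.reverse R').bordaScore d = l) →
        ∃ f : BordaEdge d → ℕ, (bordaNetwork T d l).IsMinCostFlow f ∧ R.IsReadOff f ∧
          R.size = (bordaNetwork T d l).flowCost f)) :=
  ⟨Borda.margin_of_victory_polynomial, fun _ _ _ _ _ _ _ hd _ =>
    ⟨fun _ hf => BordaFlow.exists_of_isMinCostFlow hd hf,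
      fun _ hR => BordaFlow.exists_isMinCostFlow hd hR⟩⟩
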